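/- Let $G$ be a real $n$-dimensional Lie group with Lie algebra $\mathfrak g$, $g$ a left invariant Riemannian metric on $G$, $X\in\mathfrak g$ a left invariant vector field, $b_0>0$, and $\phi:(-b_0,b_0)\to(0,\infty)$ a smooth function with $$\phi(s)-s\phi'(s)+(b^2-s^2)\phi''(s)>0\qquad\text{for } |s|\le b<b_0,$$ and let $\|X\|_g<b_0$. Let $$F(x,y)=\sqrt{g(y,y)}\;\phi\!\left(\frac{g(X(x),y)}{\sqrt{g(y,y)}}\right)$$ be the corresponding left invariant $(\alpha,\beta)$-metric. Assume that $F$ is of Berwald type, i.e. that its spray coefficients in local coordinates are $G^i(x,y)=\tfrac12\Gamma^i_{jk}(x)y^jy^k$; in the exceptional case that $F$ is itself a Riemannian norm ($F^2$ quadratic on every tangent space), assume in addition that $X$ is parallel for the Levi-Civita connection of $g$. For a vector field $X=\xi^i\partial_{x^i}$ on $G$ let $X^v=\xi^i\partial_{y^i}$ and $X^c=\xi^i\partial_{x^i}+\frac{\partial\xi^i}{\partial x^j}y^j\partial_{y^i}$ be its vertical and complete lifts to $TG$. Let $\tilde g$ be the Riemannian metric on $TG$ with $\tilde g(U^c,W^c)=\tilde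 g(U^v,W^v)=g(U,W)$ and $\tilde g(U^c,W^v)=0$ for all left invariant $U,W$, and let $$F^c(\tilde z)=\sqrt{\tilde g(\tilde z,\tilde z)}\;\phi\!\left(\frac{\tilde g(X^c,\tilde z)}{\sqrt{\tilde g(\tilde z,\tilde z)}}\right)\qquad(\tilde z\in T(TG)).$$ Let $\nabla$ and $K$ be the Levi-Civita connection and the sectional curvature of $g$, let $ad^*_U$ be the $g$-adjoint of $ad_U$ on $\mathfrak g$, that is $g(ad^*_UW,Z)=g(W,[U,Z])$, and let $D(s)=\phi''(s)/(\phi(s)-s\phi'(s))$. For a Finsler metric write $$K(\mathrm{span}\{u,y\},y)=\frac{g_y(R(u,y)y,u)}{g_y(y,y)g_y(u,u)-g_y(u,y)^2}$$ for the flag curvature, where $g_y$ is the fundamental tensor and $R$ the curvature of the Chern connection. Then for all $Y,V\in\mathfrak g$ that are orthonormal with respect to $g$, the flag curvature of $F^c$ satisfies, at every point of $TG$: 1. $\displaystyle K^{F^c}(\mathrm{span}\{Y^c,V^c\},Y^c)=\frac{K(V,Y)}{\phi^2(g(X,Y))\,\bigl(1+g(X,V)^2D(g(X,Y))\bigr)}$;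 2. $\displaystyle K^{F^c}(\mathrm{span}\{Y^c,V^v\},Y^c)=\frac{1}{\phi^2(g(X,Y))}\Bigl\{K(V,Y)+\tfrac12g([V,\nabla_YV],Y)-\tfrac12g(\nabla_Vad^*_VY,Y)+\tfrac14g([V,ad^*_VY],Y)+\tfrac12g([[Y,V],V],Y)\Bigr\}$; 3. $\displaystyle K^{F^c}(\mathrm{span}\{Y^v,V^c\},Y^v)=\frac{1}{\phi^2(0)\,\bigl(1+g(X,V)^2D(0)\bigr)}\Bigl\{K(V,Y)+\tfrac12g([Y,\nabla_VY],V)-\tfrac12g(\nabla_Yad^*_YV,V)+\tfrac14g([Y,ad^*_YV],V)+\tfrac12g([[V,Y],Y],V)\Bigr\}$; 4. $\displaystyle K^{F^c}(\mathrm{span}\{Y^v,V^v\},Y^v)=\frac{1}{\phi^2(0)}\Bigl\{K(V,Y)+g(\nabla_{[V,Y]}Y,V)+\tfrac14\|[V,Y]\|_g^2\Bigr\}$. -/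

import Mathlib

open Bundle VectorField
open scoped Manifold ContDiff

noncomputable section

/-! ### Finsler geometry on an open subset of a normed space

`F x y` is the value of the Finsler function at the point `x` on the tangent vector `y`. -/

section LocalFinsler

variable {E : Type*} [NormedAddCommGroup E] [NormedSpace ℝ E]

/-- The fundamental tensor `g_y(u, v) = ½ ∂²/∂s∂t F²(x, y + s u + t v)` at `s = t = 0`. -/
def fundamentalTensor (F : E → E → ℝ) (x y : E) : E →L[ℝ] E →L[ℝ] ℝ :=
  (1 / 2 : ℝ) • fderiv ℝ (fderiv ℝ fun z : E => F x z ^ 2) y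

/-- The spray coefficients `Gⁱ = ¼ gⁱˡ ([F²]_{xᵐ yˡ} yᵐ - [F²]_{xˡ})`. -/
def sprayCoeff (F : E → E → ℝ) (x y : E) : E :=
  (1 / 4 : ℝ) • (fundamentalTensor F x y).inverse
    (fderiv ℝ (fun x' : E => fderiv ℝ (fun z : E => F x' z ^ 2) y) x y
      - fderiv ℝ (fun x' : E => F x' y ^ 2) x)

/-- The nonlinear connection `Nⁱⱼ = ∂Gⁱ/∂yʲ`. -/
def nonlinearConnection (F : E → E → ℝ) (x y : E) : E →L[ℝ] E :=
  fderiv ℝ (fun z : E => sprayCoeff F x z) y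

/-- The horizontal derivative `δT/δxᵏ = ∂T/∂xᵏ - Nᵐₖ ∂T/∂yᵐ` of a function `T` of `(x, y)`. -/
def horizontalDeriv {W : Type*} [NormedAddCommGroup W] [NormedSpace ℝ W]
    (F : E → E → ℝ) (T : E → E → W) (x y : E) : E →L[ℝ] W :=
  fderiv ℝ (fun x' : E => T x' y) x
    - (fderiv ℝ (fun z : E => T x z) y).comp (nonlinearConnection F x y)

/-- The Chern connection
`Γⁱⱼₖ = ½ gⁱˡ (δg_{lj}/δxᵏ + δg_{lk}/δxʲ - δg_{jk}/δxˡ)`, as `Γ(u, v)`. -/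
def chernConnection (F : E → E → ℝ) (x y u v : E) : E :=
  (fundamentalTensor F x y).inverse
    ((1 / 2 : ℝ) •
      (horizontalDeriv F (fundamentalTensor F) x y u v
        + horizontalDeriv F (fundamentalTensor F) x y v u
        - ((horizontalDeriv F (fundamentalTensor F) x y).flip u).flip v))

/-- The curvature `R(u, v)w` of the Chern connection at `(x, y)`, in components
`Rⱼⁱₖₗ = δΓⁱⱼₗ/δxᵏ - δΓⁱⱼₖ/δxˡ + Γⁱₖₘ Γᵐⱼₗ - Γⁱₗₘ Γᵐⱼₖ`. -/
def chernCurvature (F : E → E → ℝ) (x y u v w : E) : E :=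
  horizontalDeriv F (fun x' y' => chernConnection F x' y' v w) x y u
    - horizontalDeriv F (fun x' y' => chernConnection F x' y' u w) x y v
    + chernConnection F x y u (chernConnection F x y v w)
    - chernConnection F x y v (chernConnection F x y u w)

/-- The flag curvature
`K(P, y) = g_y(R(u, y)y, u) / (g_y(y, y) g_y(u, u) - g_y(u, y)²)`, `P = span {u, y}`. -/
def localFlagCurvature (F : E → E → ℝ) (x y u : E) : ℝ :=
  fundamentalTensor F x y (chernCurvature F x y u y y) u /
    (fundamentalTensor F x y y y * fundamentalTensor F x y u u
      - fundamentalTensor F x y u y ^ 2)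

/-- The Christoffel symbols of a Riemannian metric `g`, as `Γ(u, v)`. -/
def christoffel (g : E → E →L[ℝ] E →L[ℝ] ℝ) (x u v : E) : E :=
  (g x).inverse ((1 / 2 : ℝ) •
    (fderiv ℝ g x u v + fderiv ℝ g x v u - ((fderiv ℝ g x).flip u).flip v))

end LocalFinsler

/-! ### Finsler and Riemannian geometry on manifolds

The tangent space of a manifold at `p` is, in Mathlib, the model vector space, the identification
being the derivative of the preferred chart at `p`. Local coordinates around `p` are those of the
preferred chart at `p`, so that a tangent vector at `p` is equal to its own coordinates. -/

section Manifold

variable {E : Type*} [NormedAddCommGroup E] [NormedSpace ℝ E]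
  {H : Type*} [TopologicalSpace H] (I : ModelWithCorners ℝ E H)
  {M : Type*} [TopologicalSpace M] [ChartedSpace H M]

/-- The expression of a function on the tangent bundle in the chart at `p`. -/
def finslerInChart (F : ∀ q : M, TangentSpace I q → ℝ) (p : M) (x y : E) : ℝ :=
  F ((extChartAt I p).symm x) (mfderiv 𝓘(ℝ, E) I (extChartAt I p).symm x y)

/-- The flag curvature `K(span {u, y}, y)` of a Finsler metric at the point `p`. -/
def flagCurvature (F : ∀ q : M, TangentSpace I q → ℝ) (p : M) (y u : TangentSpace I p) : ℝ :=
  localFlagCurvature (finslerInChart I F p) (extChartAt I p p) y u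

/-- A Finsler metric is of Berwald type if in local coordinates its spray coefficients are
`Gⁱ(x, y) = ½ Γⁱⱼₖ(x) yʲ yᵏ`. -/
def IsBerwald (F : ∀ q : M, TangentSpace I q → ℝ) : Prop :=
  ∀ p : M, ∃ Γ : E → E →L[ℝ] E →L[ℝ] E, ∀ x ∈ (extChartAt I p).target, ∀ y : E, y ≠ 0 →
    sprayCoeff (finslerInChart I F p) x y = (1 / 2 : ℝ) • Γ x y y

/-- `F` is the norm of a Riemannian metric: `F²` is a quadratic form on every tangent space. -/
def IsRiemannian (F : ∀ q : M, TangentSpace I q → ℝ) : Prop :=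
  ∀ q : M, ∃ h : TangentSpace I q →L[ℝ] TangentSpace I q →L[ℝ] ℝ, ∀ y, F q y ^ 2 = h y y

/-- The expression of a metric in the chart at `p`. -/
def metricInChart (g : ∀ q : M, TangentSpace I q →L[ℝ] TangentSpace I q →L[ℝ] ℝ) (p : M)
    (x : E) : E →L[ℝ] E →L[ℝ] ℝ :=
  let B : E →L[ℝ] E →L[ℝ] ℝ := g ((extChartAt I p).symm x)
  let A : E →L[ℝ] E := mfderiv 𝓘(ℝ, E) I (extChartAt I p).symm x
  B.bilinearComp A A

/-- The expression of a vector field in the chart at `p`. -/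
def fieldInChart (V : ∀ q : M, TangentSpace I q) (p : M) (x : E) : E :=
  mpullback 𝓘(ℝ, E) I (extChartAt I p).symm V x

/-- The Levi-Civita connection of `g`: the covariant derivative `∇_v V` at `p`, for `v` a tangent
vector at `p`. -/
def leviCivita (g : ∀ q : M, TangentSpace I q →L[ℝ] TangentSpace I q →L[ℝ] ℝ)
    (V : ∀ q : M, TangentSpace I q) (p : M) (v : TangentSpace I p) : TangentSpace I p :=
  (fderiv ℝ (fieldInChart I V p) (extChartAt I p p) v
    + christoffel (metricInChart I g p) (extChartAt I p p) v (V p) : E)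

/-- `∇V = 0` for the Levi-Civita connection `∇` of `g`. -/
def IsParallel (g : ∀ q : M, TangentSpace I q →L[ℝ] TangentSpace I q →L[ℝ] ℝ)
    (V : ∀ q : M, TangentSpace I q) : Prop :=
  ∀ (p : M) (v : TangentSpace I p), leviCivita I g V p v = 0

/-- The curvature `R(U, V)W = ∇_U ∇_V W - ∇_V ∇_U W - ∇_[U, V] W` of `g` at the point `p`. -/
def riemannCurvature (g : ∀ q : M, TangentSpace I q →L[ℝ] TangentSpace I q →L[ℝ] ℝ)
    (U V W : ∀ q : M, TangentSpace I q) (p : M) : TangentSpace I p :=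
  leviCivita I g (fun q => leviCivita I g W q (V q)) p (U p)
    - leviCivita I g (fun q => leviCivita I g W q (U q)) p (V p)
    - leviCivita I g W p (mlieBracket I U V p)

/-- The sectional curvature of `g` at `p` of the plane spanned by `U p` and `V p`. -/
def sectionalCurvature (g : ∀ q : M, TangentSpace I q →L[ℝ] TangentSpace I q →L[ℝ] ℝ)
    (U V : ∀ q : M, TangentSpace I q) (p : M) : ℝ :=
  g p (riemannCurvature I g U V V p) (U p) /
    (g p (U p) (U p) * g p (V p) (V p) - g p (U p) (V p) ^ 2)

/-- The vertical lift: `Xᵛ = ξⁱ ∂/∂yⁱ` for `X = ξⁱ ∂/∂xⁱ`. -/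
def verticalLift [IsManifold I 1 M] (X : ∀ q : M, TangentSpace I q) (p : TangentBundle I M) :
    TangentSpace I.tangent p :=
  ((0, X p.1) : E × E)

/-- The complete lift: `Xᶜ = ξⁱ ∂/∂xⁱ + (∂ξⁱ/∂xʲ) yʲ ∂/∂yⁱ` for `X = ξⁱ ∂/∂xⁱ`. -/
def completeLift [IsManifold I 1 M] (X : ∀ q : M, TangentSpace I q) (p : TangentBundle I M) :
    TangentSpace I.tangent p :=
  ((X p.1, fderiv ℝ (fieldInChart I X p.1) (extChartAt I p.1 p.1) p.2) : E × E)

/-- The `(α, β)`-function `α φ(β/α)`, with `α = √g(y, y)` and `β = g(X, y)`. -/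
def alphaBeta (φ : ℝ → ℝ) (g : ∀ q : M, TangentSpace I q → TangentSpace I q → ℝ)
    (X : ∀ q : M, TangentSpace I q) (q : M) (y : TangentSpace I q) : ℝ :=
  Real.sqrt (g q y y) * φ (g q (X q) y / Real.sqrt (g q y y))

/-- The function `D = φ'' / (φ - s φ')`. -/
def curvatureD (φ : ℝ → ℝ) (s : ℝ) : ℝ :=
  deriv (deriv φ) s / (φ s - s * deriv φ s)

end Manifold

/-! ### Lie groups -/

section LieGroups

variable {E : Type*} [NormedAddCommGroup E] [NormedSpace ℝ E]
  {H : Type*} [TopologicalSpace H] (I : ModelWithCorners ℝ E H)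
  {G : Type*} [TopologicalSpace G] [ChartedSpace H G] [Group G]

instance lieGroup_minSmoothness [LieGroup I ∞ G] : LieGroup I (minSmoothness ℝ 3) G :=
  LieGroup.of_le (n := ∞) (by simp; norm_cast)

/-- Invariance of a metric under all left translations. -/
def IsLeftInvariant (g : ∀ q : G, TangentSpace I q →L[ℝ] TangentSpace I q →L[ℝ] ℝ) : Prop :=
  ∀ (a x : G) (u v : TangentSpace I x),
    g (a * x) (mfderiv I I (fun z : G => a * z) x u) (mfderiv I I (fun z : G => a * z) x v)
      = g x u v

/-- The element of the Lie algebra whose left invariant vector field has the value `v` at `x`. -/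
def leftInvariantExtension (x : G) (v : TangentSpace I x) : GroupLieAlgebra I G :=
  (mfderiv I I (fun z : G => x * z) 1).inverse v

/-- The projection of a tangent vector of the tangent bundle to the base. -/
def horPart [IsManifold I 1 G] (p : TangentBundle I G) (ξ : TangentSpace I.tangent p) :
    TangentSpace I p.1 :=
  (show E × E from ξ).1

/-- The vertical part `w` of `ξ = Yᶜ + w`, with `Y` the left invariant vector field whose value at
the base point is the projection of `ξ`. -/
def verPart [IsManifold I 1 G] (p : TangentBundle I G) (ξ : TangentSpace I.tangent p) :
    TangentSpace I p.1 :=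
  (show E × E from ξ - completeLift I
    (mulInvariantVectorField (leftInvariantExtension I p.1 (horPart I p ξ))) p).2

/-- The lifted metric `g̃` on the tangent Lie group: the metric with
`g̃(Xᶜ, Yᶜ) = g(X, Y)`, `g̃(Xᵛ, Yᵛ) = g(X, Y)`, `g̃(Xᶜ, Yᵛ) = 0` for left invariant `X` and `Y`.
A tangent vector at `p` is written as `Yᶜ + w`, where `Y` is the left invariant vector field with
the same projection to the base, and `w` is vertical. -/
def liftedMetric [IsManifold I 1 G]
    (g : ∀ q : G, TangentSpace I q →L[ℝ] TangentSpace I q →L[ℝ] ℝ)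
    (p : TangentBundle I G) (ξ η : TangentSpace I.tangent p) : ℝ :=
  g p.1 (horPart I p ξ) (horPart I p η) + g p.1 (verPart I p ξ) (verPart I p η)

/-- The complete lifted Finsler metric `Fᶜ` on the tangent Lie group: the `(α, β)`-function of `φ`,
the lifted metric `g̃` and the complete lift `Xᶜ` of the left invariant vector field `X`. -/
def completeLiftedFinsler [IsManifold I 1 G] (φ : ℝ → ℝ)
    (g : ∀ q : G, TangentSpace I q →L[ℝ] TangentSpace I q →L[ℝ] ℝ) (X : GroupLieAlgebra I G) :
    ∀ p : TangentBundle I G, TangentSpace I.tangent p → ℝ :=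
  alphaBeta I.tangent φ (liftedMetric I g) (completeLift I (mulInvariantVectorField X))

/-- The value at `p` of the complete lift of the left invariant vector field `U`. -/
def lieCompleteLift [IsManifold I 1 G] (U : GroupLieAlgebra I G) (p : TangentBundle I G) :
    TangentSpace I.tangent p :=
  completeLift I (mulInvariantVectorField U) p

/-- The value at `p` of the vertical lift of the left invariant vector field `U`. -/
def lieVerticalLift [IsManifold I 1 G] (U : GroupLieAlgebra I G) (p : TangentBundle I G) :
    TangentSpace I.tangent p :=
  verticalLift I (mulInvariantVectorField U) p

/-- The sectional curvature of `g` of the plane in the Lie algebra spanned by `U` and `V`. -/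
def lieSectionalCurvature (g : ∀ q : G, TangentSpace I q →L[ℝ] TangentSpace I q →L[ℝ] ℝ)
    (U V : GroupLieAlgebra I G) : ℝ :=
  sectionalCurvature I g (mulInvariantVectorField U) (mulInvariantVectorField V) (1 : G)

/-- The Levi-Civita connection on left invariant vector fields, as `∇_Y V` for `Y`, `V` in the Lie
algebra. -/
def lieConnection (g : ∀ q : G, TangentSpace I q →L[ℝ] TangentSpace I q →L[ℝ] ℝ)
    (Y V : GroupLieAlgebra I G) : GroupLieAlgebra I G :=
  leviCivita I g (mulInvariantVectorField V) 1 Y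

/-- The adjoint `ad*_Y V` with respect to `g`: `g(ad*_Y V, Z) = g(V, [Y, Z])` for all `Z`. -/
def adStar [FiniteDimensional ℝ E] [CompleteSpace E] [LieGroup I ∞ G]
    (g : ∀ q : G, TangentSpace I q →L[ℝ] TangentSpace I q →L[ℝ] ℝ)
    (Y V : GroupLieAlgebra I G) : GroupLieAlgebra I G :=
  haveI : FiniteDimensional ℝ (GroupLieAlgebra I G) := inferInstanceAs (FiniteDimensional ℝ E)
  haveI : T2Space (GroupLieAlgebra I G) := inferInstanceAs (T2Space E)
  (g 1).inverse (LinearMap.toContinuousLinearMap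
    ((g 1 V).toLinearMap ∘ₗ (LieAlgebra.ad ℝ (GroupLieAlgebra I G) Y)))

end LieGroups

end

/-! Everything is left invariant, so the curvature reduces to algebra on one Lie algebra `L`. In the
frame of complete and vertical lifts of left invariant fields, `F^c` is one fixed norm on `L × L`:
the (α, β)-norm of φ, of the sum metric and of the vector `(X, 0)`. The frame has the brackets of
the semidirect product `L ⋉ L`, with abelian second factor.

The geometric principle is that a torsion-free linear connection preserving a Finsler metric is its
Chern connection. The Chern curvature is then the ordinary curvature of that linear connection and
does not depend on the direction (`chernCurvature_eq_of_horizontallyConstant`, and in a frame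
`localFlagCurvature_finsler`). Since `F^c` is built from the lifted metric and the complete lift of
`X`, the Levi-Civita connection of the lifted metric qualifies once that lift is parallel. This
connection is explicit on `L ⋉ L` (`tangentConnection`), and the lift is parallel whenever `X` is
(`tangent_parallel`).

That `X` is parallel comes from the Berwald condition. A spray `½ Γ(y, y)` yields a torsion-free
connection `B` preserving `F` (`partialFst_eq_of_sprayCoeff`, `exists_connection_of_sprayCoeff`). On
unit vectors, preservation of the norm is a linear relation between `φ - s φ'` and `φ'`. Comparing
vectors that differ by the sign of the component orthogonal to `X` leaves two cases
(`isQuadratic_or_parallel`). Either `φ' = k s (φ - s φ')` for a constant `k`; then `φ² = φ(0)² (1 +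
k s²)`, the norm is Euclidean, and parallelism is the extra hypothesis. Or `B` annihilates the form
dual to `X`, hence preserves the metric, hence is its Levi-Civita connection, and `X` is parallel.

Finally, `R(c, a)a` is orthogonal both to `a` and to the parallel vector, so the fundamental tensor
of the (α, β)-norm contributes only a scalar factor (`flag_eq`, `tangent_flag_eq`). What remains is
to expand four curvature expressions of `tangentConnection`. -/

noncomputable section

open Filter Topology

/-! ### Partial derivatives of functions of position and direction. -/

section PartialDerivatives

variable {E : Type*} [NormedAddCommGroup E] [NormedSpace ℝ E]
  {W : Type*} [NormedAddCommGroup W] [NormedSpace ℝ W]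

/-- The derivative of `f x y` in `x`. -/
def partialFst (f : E → E → W) (x y : E) : E →L[ℝ] W := fderiv ℝ (fun x' => f x' y) x

/-- The derivative of `f x y` in `y`. -/
def partialSnd (f : E → E → W) (x y : E) : E →L[ℝ] W := fderiv ℝ (fun z => f x z) y

theorem hasFDerivAt_partialFst {f : E → E → W} {x y : E}
    (h : DifferentiableAt ℝ (fun q : E × E => f q.1 q.2) (x, y)) :
    HasFDerivAt (fun x' => f x' y)
      ((fderiv ℝ (fun q : E × E => f q.1 q.2) (x, y)).comp (.inl ℝ E E)) x :=
  HasFDerivAt.comp (g := fun q : E × E => f q.1 q.2) (f := fun x' => (x', y)) x h.hasFDerivAt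
    (hasFDerivAt_prodMk_left x y)

theorem hasFDerivAt_partialSnd {f : E → E → W} {x y : E}
    (h : DifferentiableAt ℝ (fun q : E × E => f q.1 q.2) (x, y)) :
    HasFDerivAt (fun z => f x z)
      ((fderiv ℝ (fun q : E × E => f q.1 q.2) (x, y)).comp (.inr ℝ E E)) y :=
  HasFDerivAt.comp (g := fun q : E × E => f q.1 q.2) (f := fun z => (x, z)) y h.hasFDerivAt
    (hasFDerivAt_prodMk_right x y)

theorem partialFst_eq {f : E → E → W} {x y : E}
    (h : DifferentiableAt ℝ (fun q : E × E => f q.1 q.2) (x, y)) :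
    partialFst f x y = (fderiv ℝ (fun q : E × E => f q.1 q.2) (x, y)).comp (.inl ℝ E E) :=
  (hasFDerivAt_partialFst h).fderiv

theorem partialSnd_eq {f : E → E → W} {x y : E}
    (h : DifferentiableAt ℝ (fun q : E × E => f q.1 q.2) (x, y)) :
    partialSnd f x y = (fderiv ℝ (fun q : E × E => f q.1 q.2) (x, y)).comp (.inr ℝ E E) :=
  (hasFDerivAt_partialSnd h).fderiv

theorem eventually_differentiableAt_of_contDiffAt_two {V : Type*} [NormedAddCommGroup V]
    [NormedSpace ℝ V] {f : V → W} {x : V} {n : ℕ} (h : ContDiffAt ℝ n f x) (hn : 1 ≤ n) :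
    ∀ᶠ q in 𝓝 x, DifferentiableAt ℝ f q := by
  filter_upwards [h.eventually (by simp)] with q hq
  exact hq.differentiableAt (by simp; omega)

theorem contDiffAt_partialSnd {f : E → E → W} {x y : E} {n : ℕ}
    (h : ContDiffAt ℝ (n + 1 : ℕ) (fun q : E × E => f q.1 q.2) (x, y)) :
    ContDiffAt ℝ n (fun q : E × E => partialSnd f q.1 q.2) (x, y) := by
  have h1 : ContDiffAt ℝ n (fderiv ℝ (fun q : E × E => f q.1 q.2)) (x, y) :=
    h.fderiv_right (by norm_cast)
  have h2 := (((ContinuousLinearMap.compL ℝ E (E × E) W).flip (.inr ℝ E E)).contDiff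
    (n := n)).contDiffAt.comp (x, y) h1
  refine h2.congr_of_eventuallyEq ?_
  filter_upwards [eventually_differentiableAt_of_contDiffAt_two h (by omega)] with q hq
  exact partialSnd_eq hq

theorem contDiffAt_partialFst {f : E → E → W} {x y : E} {n : ℕ}
    (h : ContDiffAt ℝ (n + 1 : ℕ) (fun q : E × E => f q.1 q.2) (x, y)) :
    ContDiffAt ℝ n (fun q : E × E => partialFst f q.1 q.2) (x, y) := by
  have h1 : ContDiffAt ℝ n (fderiv ℝ (fun q : E × E => f q.1 q.2)) (x, y) :=
    h.fderiv_right (by norm_cast)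
  have h2 := (((ContinuousLinearMap.compL ℝ E (E × E) W).flip (.inl ℝ E E)).contDiff
    (n := n)).contDiffAt.comp (x, y) h1
  refine h2.congr_of_eventuallyEq ?_
  filter_upwards [eventually_differentiableAt_of_contDiffAt_two h (by omega)] with q hq
  exact partialFst_eq hq

theorem differentiableAt_of_contDiffAt_fst {f : E → E → W} {x y : E} {n : ℕ} (hn : 1 ≤ n)
    (h : ContDiffAt ℝ n (fun q : E × E => f q.1 q.2) (x, y)) :
    DifferentiableAt ℝ (fun x' => f x' y) x :=
  (hasFDerivAt_partialFst (h.differentiableAt (by simp; omega))).differentiableAt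

theorem differentiableAt_of_contDiffAt_snd {f : E → E → W} {x y : E} {n : ℕ} (hn : 1 ≤ n)
    (h : ContDiffAt ℝ n (fun q : E × E => f q.1 q.2) (x, y)) :
    DifferentiableAt ℝ (fun z => f x z) y :=
  (hasFDerivAt_partialSnd (h.differentiableAt (by simp; omega))).differentiableAt

/-- Derivatives in `x` and in `y` commute. -/
theorem partialFst_partialSnd {f : E → E → W} {x y : E}
    (h : ContDiffAt ℝ (2 : ℕ) (fun q : E × E => f q.1 q.2) (x, y)) (u v : E) :
    partialFst (partialSnd f) x y u v = partialSnd (partialFst f) x y v u := by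
  set k := fun q : E × E => f q.1 q.2
  have hk : DifferentiableAt ℝ (fderiv ℝ k) (x, y) :=
    (h.fderiv_right (m := 1) (by norm_cast)).differentiableAt (by simp)
  have ev := eventually_differentiableAt_of_contDiffAt_two h (by omega)
  -- Both mixed derivatives are values of the second derivative of the joint function on `E × E`, at
  -- `(u, 0)` and `(0, v)`; its symmetry then gives the claim.
  have e1 : partialFst (partialSnd f) x y u v = fderiv ℝ (fderiv ℝ k) (x, y) (u, 0) (0, v) := by
    have h1 : (fun x' => partialSnd f x' y) =ᶠ[𝓝 x]
        fun x' => (ContinuousLinearMap.compL ℝ E (E × E) W).flip (.inr ℝ E E) (fderiv ℝ k (x', y)) := by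
      have : Tendsto (fun x' : E => (x', y)) (𝓝 x) (𝓝 (x, y)) := by
        apply Continuous.tendsto; fun_prop
      filter_upwards [this.eventually ev] with x' hx'
      exact partialSnd_eq hx'
    have h2 := ((ContinuousLinearMap.compL ℝ E (E × E) W).flip (.inr ℝ E E)).hasFDerivAt.comp x
      (hk.hasFDerivAt.comp x (hasFDerivAt_prodMk_left x y))
    unfold partialFst
    rw [h1.fderiv_eq]
    erw [h2.fderiv]
    simp
  have e2 : partialSnd (partialFst f) x y v u = fderiv ℝ (fderiv ℝ k) (x, y) (0, v) (u, 0) := by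
    have h1 : (fun z => partialFst f x z) =ᶠ[𝓝 y]
        fun z => (ContinuousLinearMap.compL ℝ E (E × E) W).flip (.inl ℝ E E) (fderiv ℝ k (x, z)) := by
      have : Tendsto (fun z : E => (x, z)) (𝓝 y) (𝓝 (x, y)) := by
        apply Continuous.tendsto; fun_prop
      filter_upwards [this.eventually ev] with x' hx'
      exact partialFst_eq hx'
    have h2 := ((ContinuousLinearMap.compL ℝ E (E × E) W).flip (.inl ℝ E E)).hasFDerivAt.comp y
      (hk.hasFDerivAt.comp y (hasFDerivAt_prodMk_right x y))
    unfold partialSnd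
    rw [h1.fderiv_eq]
    erw [h2.fderiv]
    simp
  rw [e1, e2]
  exact (h.isSymmSndFDerivAt (by simp)).eq _ _

theorem partialSnd_partialSnd_comm {f : E → E → W} {x y : E}
    (h : ContDiffAt ℝ (2 : ℕ) (fun q : E × E => f q.1 q.2) (x, y)) (u v : E) :
    partialSnd (partialSnd f) x y u v = partialSnd (partialSnd f) x y v u := by
  have : ContDiffAt ℝ (2 : ℕ) (fun z => f x z) y :=
    h.comp (g := fun q : E × E => f q.1 q.2) y (contDiff_prodMk_right x).contDiffAt
  exact (this.isSymmSndFDerivAt (by simp)).eq u v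

end PartialDerivatives

section ApplyConst

variable {E V W : Type*} [NormedAddCommGroup E] [NormedSpace ℝ E]
  [NormedAddCommGroup V] [NormedSpace ℝ V] [NormedAddCommGroup W] [NormedSpace ℝ W]

theorem differentiableAt_apply_const {c : E → V →L[ℝ] W} {x : E} (h : DifferentiableAt ℝ c x)
    (v : V) : DifferentiableAt ℝ (fun x' => c x' v) x :=
  h.clm_apply (differentiableAt_const v)

theorem fderiv_apply_const {c : E → V →L[ℝ] W} {x : E} (h : DifferentiableAt ℝ c x) (v : V)
    (u : E) : fderiv ℝ (fun x' => c x' v) x u = fderiv ℝ c x u v := by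
  rw [(h.hasFDerivAt.clm_apply (hasFDerivAt_const v x)).fderiv]
  simp

end ApplyConst

/-! ### Chern connection and curvature of a metric preserved by a linear connection. -/

section Berwald

variable {E : Type*} [NormedAddCommGroup E] [NormedSpace ℝ E]

theorem fundamentalTensor_eq_partialSnd (F : E → E → ℝ) (x y : E) :
    fundamentalTensor F x y
      = (1 / 2 : ℝ) • partialSnd (partialSnd fun x y => F x y ^ 2) x y := rfl

theorem sprayCoeff_eq_partial (F : E → E → ℝ) (x y : E) :
    sprayCoeff F x y = (1 / 4 : ℝ) • (fundamentalTensor F x y).inverse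
      (partialFst (partialSnd fun x y => F x y ^ 2) x y y
        - partialFst (fun x y => F x y ^ 2) x y) := rfl

/-- `L` is parallel for the connection with symbols `Γ`, in the sense that its derivative along
horizontal lifts vanishes. -/
def HorizontallyConstant (L : E → E → ℝ) (Γ : E → E →L[ℝ] E →L[ℝ] E) (O : Set (E × E)) : Prop :=
  ∀ x y, (x, y) ∈ O → ∀ u, partialFst L x y u = partialSnd L x y (Γ x u y)

variable {L : E → E → ℝ} {Γ : E → E →L[ℝ] E →L[ℝ] E} {O : Set (E × E)}

omit [NormedSpace ℝ E] in
theorem eventually_snd_mem {O : Set (E × E)} (hO : IsOpen O) {x y : E} (h : (x, y) ∈ O) :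
    ∀ᶠ z in 𝓝 y, (x, z) ∈ O :=
  (show Continuous fun z : E => (x, z) by fun_prop).tendsto y |>.eventually (hO.mem_nhds h)

omit [NormedSpace ℝ E] in
theorem eventually_fst_mem {O : Set (E × E)} (hO : IsOpen O) {x y : E} (h : (x, y) ∈ O) :
    ∀ᶠ x' in 𝓝 x, (x', y) ∈ O :=
  (show Continuous fun z : E => (z, y) by fun_prop).tendsto x |>.eventually (hO.mem_nhds h)

/-- Obtained by differentiating the defining identity of `HorizontallyConstant` in `y`: the
direction enters once through `partialSnd L` and once through the linear argument of `Γ`. -/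
theorem HorizontallyConstant.partialSnd_partialFst (hL : HorizontallyConstant L Γ O)
    (hO : IsOpen O) (hs : ∀ q ∈ O, ContDiffAt ℝ (3 : ℕ) (fun q : E × E => L q.1 q.2) q)
    {x y : E} (h : (x, y) ∈ O) (u v : E) :
    partialFst (partialSnd L) x y u v
      = partialSnd (partialSnd L) x y v (Γ x u y) + partialSnd L x y (Γ x u v) := by
  have h2 : ContDiffAt ℝ (2 : ℕ) (fun q : E × E => L q.1 q.2) (x, y) :=
    (hs _ h).of_le (by norm_cast)
  rw [partialFst_partialSnd h2]
  have e : (fun z => partialFst L x z u) =ᶠ[𝓝 y] fun z => partialSnd L x z (Γ x u z) := by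
    filter_upwards [eventually_snd_mem hO h] with z hz using hL x z hz u
  have d1 : HasFDerivAt (fun z => partialFst L x z) (partialSnd (partialFst L) x y) y :=
    (differentiableAt_of_contDiffAt_snd le_rfl (contDiffAt_partialFst h2)).hasFDerivAt
  have d2 : HasFDerivAt (fun z => partialSnd L x z) (partialSnd (partialSnd L) x y) y :=
    (differentiableAt_of_contDiffAt_snd le_rfl (contDiffAt_partialSnd h2)).hasFDerivAt
  have e1 : fderiv ℝ (fun z => partialFst L x z u) y = (partialSnd (partialFst L) x y).flip u := by
    simpa using (d1.clm_apply (hasFDerivAt_const u y)).fderiv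
  have e2 := (d2.clm_apply (Γ x u).hasFDerivAt).fderiv
  have e3 := e.fderiv_eq (𝕜 := ℝ)
  rw [e1, e2] at e3
  simpa [add_comm] using congrArg (fun A : E →L[ℝ] ℝ => A v) e3

/-- In the numerator of the spray the first-order terms cancel by symmetry of `Γ`, leaving the
Hessian of `F²` applied to `Γ(y, y)`. The factor 2 in `key` appears because the fundamental tensor
is half that Hessian. -/
theorem sprayCoeff_eq_of_horizontallyConstant {F : E → E → ℝ}
    (hL : HorizontallyConstant (fun x y => F x y ^ 2) Γ O) (hΓ : ∀ x u v, Γ x u v = Γ x v u)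
    (hO : IsOpen O) (hs : ∀ q ∈ O, ContDiffAt ℝ (3 : ℕ) (fun q : E × E => F q.1 q.2 ^ 2) q)
    {x y : E} (h : (x, y) ∈ O) (hi : (fundamentalTensor F x y).IsInvertible) :
    sprayCoeff F x y = (1 / 2 : ℝ) • Γ x y y := by
  rw [sprayCoeff_eq_partial]
  have key : partialFst (partialSnd fun x y => F x y ^ 2) x y y
        - partialFst (fun x y => F x y ^ 2) x y
        = fundamentalTensor F x y ((2 : ℝ) • Γ x y y) := by
    ext v
    have h1 := hL.partialSnd_partialFst hO hs h y v
    have h2 := hL x y h v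
    have h3 := partialSnd_partialSnd_comm (f := fun x y => F x y ^ 2) ((hs _ h).of_le (m := (2 : ℕ)) (by norm_cast)) v (Γ x y y)
    rw [fundamentalTensor_eq_partialSnd]
    simp only [sub_apply, smul_apply, map_smul, smul_eq_mul]
    rw [hΓ x v y] at h2
    linarith
  rw [key, hi.inverse_apply_eq.2 rfl, smul_smul]
  norm_num

theorem nonlinearConnection_eq_of_horizontallyConstant {F : E → E → ℝ}
    (hL : HorizontallyConstant (fun x y => F x y ^ 2) Γ O) (hΓ : ∀ x u v, Γ x u v = Γ x v u)
    (hO : IsOpen O) (hs : ∀ q ∈ O, ContDiffAt ℝ (3 : ℕ) (fun q : E × E => F q.1 q.2 ^ 2) q)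
    (hi : ∀ x y, (x, y) ∈ O → (fundamentalTensor F x y).IsInvertible)
    {x y : E} (h : (x, y) ∈ O) :
    nonlinearConnection F x y = Γ x y := by
  unfold nonlinearConnection
  have e : (fun z => sprayCoeff F x z) =ᶠ[𝓝 y] fun z => (1 / 2 : ℝ) • Γ x z z := by
    filter_upwards [eventually_snd_mem hO h] with z hz
    exact sprayCoeff_eq_of_horizontallyConstant hL hΓ hO hs hz (hi x z hz)
  have d := (((Γ x).hasFDerivAt (x := y)).clm_apply (hasFDerivAt_id y)).const_smul (1 / 2 : ℝ)
  rw [e.fderiv_eq]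
  erw [d.fderiv]
  ext v
  simp [hΓ x v y, ← add_smul, smul_add]
  norm_num

/-- Metric compatibility, from a second `y`-derivative of the invariance identity. The third-order
term it produces is exactly the one subtracted by the nonlinear connection. -/
theorem horizontalDeriv_fundamentalTensor {F : E → E → ℝ}
    (hL : HorizontallyConstant (fun x y => F x y ^ 2) Γ O) (hΓ : ∀ x u v, Γ x u v = Γ x v u)
    (hO : IsOpen O) (hs : ∀ q ∈ O, ContDiffAt ℝ (3 : ℕ) (fun q : E × E => F q.1 q.2 ^ 2) q)
    (hi : ∀ x y, (x, y) ∈ O → (fundamentalTensor F x y).IsInvertible)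
    {x y : E} (h : (x, y) ∈ O) (u a b : E) :
    horizontalDeriv F (fundamentalTensor F) x y u a b
      = fundamentalTensor F x y (Γ x u a) b + fundamentalTensor F x y a (Γ x u b) := by
  set L : E → E → ℝ := fun x y => F x y ^ 2 with hLdef
  have s3 := hs _ h
  have s2 : ContDiffAt ℝ (2 : ℕ) (fun q : E × E => partialSnd L q.1 q.2) (x, y) :=
    contDiffAt_partialSnd s3
  have s1 : ContDiffAt ℝ (1 : ℕ) (fun q : E × E => partialSnd (partialSnd L) q.1 q.2) (x, y) :=
    contDiffAt_partialSnd s2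
  have m := partialFst_partialSnd s2 u a
  have e : (fun z => partialFst (partialSnd L) x z u) =ᶠ[𝓝 y]
      fun z => (partialSnd (partialSnd L) x z) (Γ x u z) + (partialSnd L x z).comp (Γ x u) := by
    filter_upwards [eventually_snd_mem hO h] with z hz
    ext v
    rw [hL.partialSnd_partialFst hO hs hz,
      partialSnd_partialSnd_comm ((hs _ hz).of_le (m := (2 : ℕ)) (by norm_cast))]
    simp
  have d1 : HasFDerivAt (fun z => partialFst (partialSnd L) x z)
      (partialSnd (partialFst (partialSnd L)) x y) y :=
    (differentiableAt_of_contDiffAt_snd le_rfl (contDiffAt_partialFst (n := 1) s2)).hasFDerivAt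
  have d2 : HasFDerivAt (fun z => partialSnd (partialSnd L) x z)
      (partialSnd (partialSnd (partialSnd L)) x y) y :=
    (differentiableAt_of_contDiffAt_snd le_rfl s1).hasFDerivAt
  have d3 : HasFDerivAt (fun z => partialSnd L x z) (partialSnd (partialSnd L) x y) y :=
    (differentiableAt_of_contDiffAt_snd (by norm_num) s2).hasFDerivAt
  have e1 : fderiv ℝ (fun z => partialFst (partialSnd L) x z u) y
      = (partialSnd (partialFst (partialSnd L)) x y).flip u := by
    simpa using (d1.clm_apply (hasFDerivAt_const u y)).fderiv
  have e2 := ((d2.clm_apply (Γ x u).hasFDerivAt).add (d3.clm_comp (hasFDerivAt_const (Γ x u) y))).fderiv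
  have e3 := e.fderiv_eq (𝕜 := ℝ)
  rw [e1] at e3
  erw [e2] at e3
  have e4 := congrArg (fun A : E →L[ℝ] E →L[ℝ] ℝ => A a b) e3
  simp at e4
  have t := congrArg (fun A : E →L[ℝ] ℝ => A b) (partialSnd_partialSnd_comm s2 a (Γ x u y))
  have c1 := partialSnd_partialSnd_comm (f := L) (s3.of_le (m := (2 : ℕ)) (by norm_cast)) (Γ x u a) b
  have hN := nonlinearConnection_eq_of_horizontallyConstant hL hΓ hO hs hi h
  have f1 : fderiv ℝ (fun x' => fundamentalTensor F x' y) x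
      = (1 / 2 : ℝ) • partialFst (partialSnd (partialSnd L)) x y :=
    fderiv_fun_const_smul (differentiableAt_of_contDiffAt_fst le_rfl s1) (1 / 2 : ℝ)
  have f2 : fderiv ℝ (fun z => fundamentalTensor F x z) y
      = (1 / 2 : ℝ) • partialSnd (partialSnd (partialSnd L)) x y :=
    fderiv_fun_const_smul (differentiableAt_of_contDiffAt_snd le_rfl s1) (1 / 2 : ℝ)
  unfold horizontalDeriv
  rw [f1, f2, hN, fundamentalTensor_eq_partialSnd]
  change (1 / 2 : ℝ) * partialFst (partialSnd (partialSnd L)) x y u a b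
    - (1 / 2 : ℝ) * partialSnd (partialSnd (partialSnd L)) x y (Γ x y u) a b
    = (1 / 2 : ℝ) * partialSnd (partialSnd L) x y (Γ x u a) b
      + (1 / 2 : ℝ) * partialSnd (partialSnd L) x y a (Γ x u b)
  rw [m, hΓ x y u, e4]
  rw [t]
  ring

/-- Koszul's argument: compatibility of the fundamental tensor with the symmetric `Γ` makes the
cyclic combination collapse to a single term. -/
theorem chernConnection_eq_of_horizontallyConstant {F : E → E → ℝ}
    (hL : HorizontallyConstant (fun x y => F x y ^ 2) Γ O) (hΓ : ∀ x u v, Γ x u v = Γ x v u)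
    (hO : IsOpen O) (hs : ∀ q ∈ O, ContDiffAt ℝ (3 : ℕ) (fun q : E × E => F q.1 q.2 ^ 2) q)
    (hi : ∀ x y, (x, y) ∈ O → (fundamentalTensor F x y).IsInvertible)
    {x y : E} (h : (x, y) ∈ O) (u v : E) :
    chernConnection F x y u v = Γ x u v := by
  unfold chernConnection
  rw [(hi x y h).inverse_apply_eq]
  ext w
  have H := horizontalDeriv_fundamentalTensor hL hΓ hO hs hi h
  have c : ∀ a b, fundamentalTensor F x y a b = fundamentalTensor F x y b a := fun a b => by
    rw [fundamentalTensor_eq_partialSnd]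
    simp only [smul_apply]
    rw [partialSnd_partialSnd_comm (f := fun x y => F x y ^ 2) ((hs _ h).of_le (m := (2 : ℕ)) (by norm_cast))]
  simp only [sub_apply, add_apply, smul_apply, ContinuousLinearMap.flip_apply,
    smul_eq_mul, H]
  rw [hΓ x v u, c (Γ x w u) v, hΓ x w u, hΓ x w v]
  ring

/-- The curvature of the linear connection with symbols `Γ`. -/
def linearCurvature (Γ : E → E →L[ℝ] E →L[ℝ] E) (x u v w : E) : E :=
  fderiv ℝ Γ x u v w - fderiv ℝ Γ x v u w + Γ x u (Γ x v w) - Γ x v (Γ x u w)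

/-- The Chern symbols do not depend on `y`, so the vertical part of each horizontal derivative
vanishes. -/
theorem chernCurvature_eq_of_horizontallyConstant {F : E → E → ℝ}
    (hL : HorizontallyConstant (fun x y => F x y ^ 2) Γ O) (hΓ : ∀ x u v, Γ x u v = Γ x v u)
    (hO : IsOpen O) (hs : ∀ q ∈ O, ContDiffAt ℝ (3 : ℕ) (fun q : E × E => F q.1 q.2 ^ 2) q)
    (hi : ∀ x y, (x, y) ∈ O → (fundamentalTensor F x y).IsInvertible)
    {x y : E} (h : (x, y) ∈ O) (hd : DifferentiableAt ℝ Γ x) (u v w : E) :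
    chernCurvature F x y u v w = linearCurvature Γ x u v w := by
  have C := fun {x y : E} (h : (x, y) ∈ O) =>
    chernConnection_eq_of_horizontallyConstant hL hΓ hO hs hi h
  have H : ∀ v w u, horizontalDeriv F (fun x' y' => chernConnection F x' y' v w) x y u
      = fderiv ℝ Γ x u v w := by
    intro v w u
    unfold horizontalDeriv
    have e1 : (fun x' => chernConnection F x' y v w) =ᶠ[𝓝 x] fun x' => Γ x' v w := by
      filter_upwards [eventually_fst_mem hO h] with x' hx' using C hx' v w
    have e2 : (fun z => chernConnection F x z v w) =ᶠ[𝓝 y] fun _ => Γ x v w := by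
      filter_upwards [eventually_snd_mem hO h] with x' hx' using C hx' v w
    rw [e1.fderiv_eq, e2.fderiv_eq, fderiv_fun_const]
    rw [Pi.zero_apply, ContinuousLinearMap.zero_comp, sub_zero,
      fderiv_apply_const (c := fun x' => Γ x' v) (differentiableAt_apply_const hd v),
      fderiv_apply_const hd]
  unfold chernCurvature linearCurvature
  rw [H, H, C h, C h, C h, C h]

end Berwald

/-! ### A quadratic spray forces invariance of the metric. -/

section BerwaldConverse

variable {E : Type*} [NormedAddCommGroup E] [NormedSpace ℝ E]

/-- Euler's identity for a function that is homogeneous of degree two. -/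
theorem fderiv_apply_self_of_homogeneous {L : E → ℝ} {y : E}
    (hh : ∀ t : ℝ, 0 < t → L (t • y) = t ^ 2 * L y) (hd : DifferentiableAt ℝ L y) :
    fderiv ℝ L y y = 2 * L y := by
  have h1 : HasDerivAt (fun t : ℝ => L (t • y)) (fderiv ℝ L y y) 1 := by
    have hd' : HasFDerivAt L (fderiv ℝ L y) ((1 : ℝ) • y) := by simpa using hd.hasFDerivAt
    have := hd'.comp_hasDerivAt (1 : ℝ) ((hasDerivAt_id (1 : ℝ)).smul_const y)
    simpa [Function.comp_def] using this
  have h2 : HasDerivAt (fun t : ℝ => t ^ 2 * L y) (2 * L y) 1 := by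
    simpa using (hasDerivAt_pow 2 (1 : ℝ)).mul_const (L y)
  refine h1.unique (h2.congr_of_eventuallyEq ?_)
  filter_upwards [lt_mem_nhds (show (0 : ℝ) < 1 by norm_num)] with t ht using hh t ht

/-- If the spray of a Finsler metric is given by the symmetric symbols `Γ` at the point `x`, then
the metric is constant along horizontal lifts. -/
theorem partialFst_eq_of_sprayCoeff {F : E → E → ℝ} {U : Set E} (hU : IsOpen U)
    (hs : ∀ x ∈ U, ∀ y ≠ 0, ContDiffAt ℝ (3 : ℕ) (fun q : E × E => F q.1 q.2 ^ 2) (x, y))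
    (hh : ∀ x ∈ U, ∀ y, ∀ t : ℝ, 0 < t → F x (t • y) ^ 2 = t ^ 2 * F x y ^ 2)
    {x : E} (hx : x ∈ U) (hi : ∀ y ≠ 0, (fundamentalTensor F x y).IsInvertible)
    {Γ : E →L[ℝ] E →L[ℝ] E} (hΓ : ∀ u v, Γ u v = Γ v u)
    (hG : ∀ y ≠ 0, sprayCoeff F x y = (1 / 2 : ℝ) • Γ y y) {y : E} (hy : y ≠ 0) (v : E) :
    partialFst (fun x y => F x y ^ 2) x y v = partialSnd (fun x y => F x y ^ 2) x y (Γ v y) := by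
  set L : E → E → ℝ := fun x y => F x y ^ 2 with hL
  have s2 : ∀ y ≠ 0, ContDiffAt ℝ (2 : ℕ) (fun q : E × E => L q.1 q.2) (x, y) :=
    fun y hy => (hs x hx y hy).of_le (by norm_cast)
  have hny : ∀ y : E, y ≠ 0 → ∀ᶠ z in 𝓝 y, z ≠ 0 := fun y hy => isOpen_ne.mem_nhds hy
  have eul : ∀ x ∈ U, ∀ y ≠ 0, partialSnd L x y y = 2 * L x y := fun x hx y hy =>
    fderiv_apply_self_of_homogeneous (hh x hx y)
      (differentiableAt_of_contDiffAt_snd (by norm_num) (hs x hx y hy))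
  -- The spray equation with the inverse fundamental tensor cleared.
  have hE : ∀ y ≠ 0, ∀ v, partialSnd (partialSnd L) x y (Γ y y) v
      = partialFst (partialSnd L) x y y v - partialFst L x y v := by
    intro y hy v
    have h := hG y hy
    rw [sprayCoeff_eq_partial] at h
    have h' : (fundamentalTensor F x y).inverse
        (partialFst (partialSnd L) x y y - partialFst L x y) = (2 : ℝ) • Γ y y := by
      calc _ = (4 : ℝ) • ((1 / 4 : ℝ) • (fundamentalTensor F x y).inverse
            (partialFst (partialSnd L) x y y - partialFst L x y)) := by
            rw [smul_smul]; norm_num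
        _ = _ := by rw [h, smul_smul]; norm_num
    rw [(hi y hy).inverse_apply_eq] at h'
    have := congrArg (fun A : E →L[ℝ] ℝ => A v) h'
    rw [fundamentalTensor_eq_partialSnd] at this
    simp only [sub_apply, smul_apply, map_smul, smul_eq_mul] at this
    linarith
  -- `e1` and `e2` are the `y`- and `x`-derivatives of Euler's identity `eul`.
  have e1 : ∀ y ≠ 0, ∀ z, partialSnd (partialSnd L) x y z y = partialSnd L x y z := by
    intro y hy z
    have d2 : HasFDerivAt (fun z => partialSnd L x z) (partialSnd (partialSnd L) x y) y :=
      (differentiableAt_of_contDiffAt_snd le_rfl (contDiffAt_partialSnd (s2 y hy))).hasFDerivAt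
    have d1 : HasFDerivAt (fun z => L x z) (partialSnd L x y) y :=
      (differentiableAt_of_contDiffAt_snd (by norm_num) (s2 y hy)).hasFDerivAt
    have e : (fun z => partialSnd L x z z) =ᶠ[𝓝 y] fun z => 2 * L x z := by
      filter_upwards [hny y hy] with z hz using eul x hx z hz
    have := e.fderiv_eq (𝕜 := ℝ)
    erw [(d2.clm_apply (hasFDerivAt_id y)).fderiv, (d1.const_mul 2).fderiv] at this
    have := congrArg (fun A : E →L[ℝ] ℝ => A z) this
    simp at this
    linarith
  have e2 : ∀ y ≠ 0, ∀ u, partialFst (partialSnd L) x y u y = 2 * partialFst L x y u := by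
    intro y hy u
    have d2 : DifferentiableAt ℝ (fun x' => partialSnd L x' y) x :=
      differentiableAt_of_contDiffAt_fst le_rfl (contDiffAt_partialSnd (s2 y hy))
    have d1 : HasFDerivAt (fun z => L z y) (partialFst L x y) x :=
      (differentiableAt_of_contDiffAt_fst (by norm_num) (s2 y hy)).hasFDerivAt
    have e : (fun x' => partialSnd L x' y y) =ᶠ[𝓝 x] fun x' => 2 * L x' y := by
      filter_upwards [hU.mem_nhds hx] with z hz using eul z hz y hy
    have := congrArg (fun A : E →L[ℝ] ℝ => A u) (e.fderiv_eq (𝕜 := ℝ))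
    beta_reduce at this
    rw [fderiv_apply_const d2, (d1.const_mul 2).fderiv] at this
    exact this
  -- Taking `v = y` in `hE` gives invariance along the direction `y` itself. Differentiating this
  -- diagonal identity in `y` and eliminating the second-order terms with `hE` polarizes it to
  -- arbitrary `v`.
  have w : ∀ y ≠ 0, partialFst L x y y = partialSnd L x y (Γ y y) := by
    intro y hy
    have := hE y hy y
    rw [e1 y hy, e2 y hy] at this
    linarith
  have e : (fun z => partialFst L x z z) =ᶠ[𝓝 y] fun z => partialSnd L x z (Γ z z) := by
    filter_upwards [hny y hy] with z hz using w z hz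
  have d1 : HasFDerivAt (fun z => partialFst L x z) (partialSnd (partialFst L) x y) y :=
    (differentiableAt_of_contDiffAt_snd le_rfl (contDiffAt_partialFst (s2 y hy))).hasFDerivAt
  have d2 : HasFDerivAt (fun z => partialSnd L x z) (partialSnd (partialSnd L) x y) y :=
    (differentiableAt_of_contDiffAt_snd le_rfl (contDiffAt_partialSnd (s2 y hy))).hasFDerivAt
  have d3 := (Γ.hasFDerivAt (x := y)).clm_apply (hasFDerivAt_id y)
  have key := e.fderiv_eq (𝕜 := ℝ)
  erw [(d1.clm_apply (hasFDerivAt_id y)).fderiv, (d2.clm_apply d3).fderiv] at key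
  have key := congrArg (fun A : E →L[ℝ] ℝ => A v) key
  simp at key
  have h1 := hE y hy v
  have h2 := partialFst_partialSnd (s2 y hy) y v
  have h3 := partialSnd_partialSnd_comm (s2 y hy) v (Γ y y)
  rw [hΓ y v] at key
  linarith

end BerwaldConverse

/-! ### Connections with constant coefficients in a frame with constant brackets. -/

section Frame

variable {E : Type*} [NormedAddCommGroup E] [NormedSpace ℝ E]
  {L : Type*} [NormedAddCommGroup L] [NormedSpace ℝ L]

/-- A smooth frame `Φ` on the open set `U`, parametrised by the vector space `L`, whose vector
fields `x ↦ Φ x a` have the brackets `[Φ a, Φ b] = Φ (br a b)`. -/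
structure IsInvariantFrame (Φ : E → L →L[ℝ] E) (br : L → L → L) (U : Set E) : Prop where
  isOpen : IsOpen U
  contDiffOn : ContDiffOn ℝ ∞ Φ U
  isInvertible : ∀ x ∈ U, (Φ x).IsInvertible
  bracket : ∀ x ∈ U, ∀ a b, fderiv ℝ Φ x (Φ x a) b - fderiv ℝ Φ x (Φ x b) a = Φ x (br a b)

/-- The symbols of the connection given by `nab` in the frame `Φ`. -/
def frameConnection (Φ : E → L →L[ℝ] E) (nab : L →L[ℝ] L →L[ℝ] L) (x : E) : E →L[ℝ] E →L[ℝ] E :=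
  (((ContinuousLinearMap.compL ℝ L L E (Φ x)).comp nab).bilinearComp (Φ x).inverse (Φ x).inverse)
    - (fderiv ℝ Φ x).bilinearComp (.id ℝ E) (Φ x).inverse

theorem frameConnection_apply (Φ : E → L →L[ℝ] E) (nab : L →L[ℝ] L →L[ℝ] L) (x u v : E) :
    frameConnection Φ nab x u v
      = Φ x (nab ((Φ x).inverse u) ((Φ x).inverse v)) - fderiv ℝ Φ x u ((Φ x).inverse v) := rfl

namespace IsInvariantFrame

variable {Φ : E → L →L[ℝ] E} {br : L → L → L} {U : Set E} {nab : L →L[ℝ] L →L[ℝ] L}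

theorem inverse_apply (h : IsInvariantFrame Φ br U) {x : E} (hx : x ∈ U) (a : L) :
    (Φ x).inverse (Φ x a) = a :=
  (h.isInvertible x hx).inverse_apply_eq.2 rfl

theorem apply_inverse (h : IsInvariantFrame Φ br U) {x : E} (hx : x ∈ U) (u : E) :
    Φ x ((Φ x).inverse u) = u :=
  ((h.isInvertible x hx).inverse_apply_eq.1 rfl).symm

theorem exists_eq (h : IsInvariantFrame Φ br U) {x : E} (hx : x ∈ U) (u : E) :
    ∃ a, u = Φ x a := ⟨_, (h.apply_inverse hx u).symm⟩

theorem contDiffAt (h : IsInvariantFrame Φ br U) {x : E} (hx : x ∈ U) : ContDiffAt ℝ ∞ Φ x :=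
  h.contDiffOn.contDiffAt (h.isOpen.mem_nhds hx)

theorem differentiableAt (h : IsInvariantFrame Φ br U) {x : E} (hx : x ∈ U) :
    DifferentiableAt ℝ Φ x :=
  (h.contDiffAt hx).differentiableAt (by simp)

theorem contDiffAt_fderiv (h : IsInvariantFrame Φ br U) {x : E} (hx : x ∈ U) :
    ContDiffAt ℝ ∞ (fderiv ℝ Φ) x :=
  (h.contDiffAt hx).fderiv_right (by simp)

theorem contDiffAt_inverse [CompleteSpace L] (h : IsInvariantFrame Φ br U) {x : E} (hx : x ∈ U) :
    ContDiffAt ℝ ∞ (fun x => (Φ x).inverse) x :=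
  (h.isInvertible x hx).contDiffAt_map_inverse.comp x (h.contDiffAt hx)

theorem frameConnection_apply_right (h : IsInvariantFrame Φ br U) {x : E} (hx : x ∈ U) (u : E)
    (b : L) : frameConnection Φ nab x u (Φ x b)
      = Φ x (nab ((Φ x).inverse u) b) - fderiv ℝ Φ x u b := by
  rw [frameConnection_apply, h.inverse_apply hx]

/-- The antisymmetric part of `nab` is `br`, and it cancels against the bracket of the frame fields.
-/
theorem frameConnection_comm (h : IsInvariantFrame Φ br U)
    (htor : ∀ a b, nab a b - nab b a = br a b) {x : E} (hx : x ∈ U) (u v : E) :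
    frameConnection Φ nab x u v = frameConnection Φ nab x v u := by
  obtain ⟨a, rfl⟩ := h.exists_eq hx u
  obtain ⟨b, rfl⟩ := h.exists_eq hx v
  rw [h.frameConnection_apply_right hx, h.frameConnection_apply_right hx, h.inverse_apply hx,
    h.inverse_apply hx, sub_eq_sub_iff_sub_eq_sub, ← map_sub, htor, h.bracket x hx]

theorem contDiffAt_frameConnection [FiniteDimensional ℝ E] [CompleteSpace L]
    (h : IsInvariantFrame Φ br U) {x : E} (hx : x ∈ U) :
    ContDiffAt ℝ ∞ (frameConnection Φ nab) x := by
  rw [← contDiffWithinAt_univ]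
  have : ContDiffOn ℝ ∞ (frameConnection Φ nab) U := by
    rw [contDiffOn_clm_apply]
    intro u
    rw [contDiffOn_clm_apply]
    intro v x hx
    have h1 := h.contDiffAt hx
    have h2 := h.contDiffAt_inverse hx
    have h3 := h.contDiffAt_fderiv hx
    refine ContDiffAt.contDiffWithinAt ?_
    simp only [frameConnection_apply]
    have i1 := h2.clm_apply (contDiffAt_const (c := u))
    have i2 := h2.clm_apply (contDiffAt_const (c := v))
    exact (h1.clm_apply ((nab.contDiff.contDiffAt.comp x i1).clm_apply i2)).sub
      ((h3.clm_apply contDiffAt_const).clm_apply i2)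
  exact (this.contDiffAt (h.isOpen.mem_nhds hx)).contDiffWithinAt

theorem isSymmSndFDerivAt (h : IsInvariantFrame Φ br U) {x : E} (hx : x ∈ U) (u v : E) :
    fderiv ℝ (fderiv ℝ Φ) x u v = fderiv ℝ (fderiv ℝ Φ) x v u :=
  ((h.contDiffAt hx).isSymmSndFDerivAt (by simp; norm_cast)).eq u v

/-- The derivative along `u` of the equation saying that the covariant derivative of `Φ b` along `Φ
a` is `Φ (nab a b)`. It gives access to the derivative of the symbols without differentiating the
inverse of `Φ`. -/
theorem fderiv_fderiv_add (h : IsInvariantFrame Φ br U) [FiniteDimensional ℝ E] [CompleteSpace L]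
    {x : E} (hx : x ∈ U) (a b : L) (u : E) :
    fderiv ℝ (fderiv ℝ Φ) x u (Φ x a) b + fderiv ℝ Φ x (fderiv ℝ Φ x u a) b
      + fderiv ℝ (frameConnection Φ nab) x u (Φ x a) (Φ x b)
      + frameConnection Φ nab x (fderiv ℝ Φ x u a) (Φ x b)
      + frameConnection Φ nab x (Φ x a) (fderiv ℝ Φ x u b) = fderiv ℝ Φ x u (nab a b) := by
  have e : (fun x => fderiv ℝ Φ x (Φ x a) b + frameConnection Φ nab x (Φ x a) (Φ x b))
      =ᶠ[𝓝 x] fun x => Φ x (nab a b) := by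
    filter_upwards [h.isOpen.mem_nhds hx] with z hz
    rw [h.frameConnection_apply_right hz, h.inverse_apply hz]
    abel
  have dΦ := (h.differentiableAt hx).hasFDerivAt
  have dD := ((h.contDiffAt_fderiv hx).differentiableAt (by simp)).hasFDerivAt
  have dΓ := ((h.contDiffAt_frameConnection (nab := nab) hx).differentiableAt (by simp)).hasFDerivAt
  have da := dΦ.clm_apply (hasFDerivAt_const a x)
  have db := dΦ.clm_apply (hasFDerivAt_const b x)
  have d1 := (dD.clm_apply da).clm_apply (hasFDerivAt_const b x)
  have d2 := (dΓ.clm_apply da).clm_apply db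
  have key := e.fderiv_eq (𝕜 := ℝ)
  erw [(d1.add d2).fderiv, (dΦ.clm_apply (hasFDerivAt_const (nab a b) x)).fderiv] at key
  have key := congrArg (fun A : E →L[ℝ] E => A u) key
  simp at key
  rw [← key]
  abel

/-- The curvature of the connection `nab`, in the frame. -/
theorem linearCurvature_frameConnection (h : IsInvariantFrame Φ br U) [FiniteDimensional ℝ E]
    [CompleteSpace L] {x : E} (hx : x ∈ U) (c a b : L) :
    linearCurvature (frameConnection Φ nab) x (Φ x c) (Φ x a) (Φ x b)
      = Φ x (nab c (nab a b) - nab a (nab c b) - nab (br c a) b) := by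
  have h1 := h.fderiv_fderiv_add (nab := nab) hx a b (Φ x c)
  have h2 := h.fderiv_fderiv_add (nab := nab) hx c b (Φ x a)
  -- After this, the second derivatives of `Φ` in `h1` and `h2` coincide and cancel on subtraction.
  -- Exchanging `c` and `a` in a first derivative of `Φ` costs a bracket, the source of the term
  -- `nab (br c a) b`.
  rw [h.isSymmSndFDerivAt hx] at h1
  have h3 := h.bracket x hx c a
  have h4 : fderiv ℝ Φ x (Φ x c) a = Φ x (br c a) + fderiv ℝ Φ x (Φ x a) c := by
    rw [← h3]; abel
  have h5 := h.frameConnection_apply_right (nab := nab) hx (Φ x (br c a)) b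
  have h6 : ∀ c b, frameConnection Φ nab x (Φ x c) (Φ x b) = Φ x (nab c b) - fderiv ℝ Φ x (Φ x c) b :=
    fun c b => by rw [h.frameConnection_apply_right hx, h.inverse_apply hx]
  rw [h.inverse_apply hx] at h5
  unfold linearCurvature
  rw [h6 a b, h6 c b, map_sub, map_sub, h6, h6, map_sub, map_sub]
  rw [h4] at h1
  simp only [map_add, add_apply] at h1
  rw [h5] at h1
  have := congrArg₂ (fun s t => s - t) h1 h2
  beta_reduce at this
  rw [sub_eq_iff_eq_add] at this
  grind

end IsInvariantFrame

end Frame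

/-! ### Finsler metrics that are a fixed norm in an invariant frame. -/

section FrameFinsler

variable {E : Type*} [NormedAddCommGroup E] [NormedSpace ℝ E]
  {L : Type*} [NormedAddCommGroup L] [NormedSpace ℝ L]
  {Φ : E → L →L[ℝ] E} {br : L → L → L} {U : Set E} {nab : L →L[ℝ] L →L[ℝ] L}
  {f : L → ℝ} {F : E → E → ℝ}

/-- The fundamental tensor of a norm on a vector space. -/
def normTensor (f : L → ℝ) (a : L) : L →L[ℝ] L →L[ℝ] ℝ := fundamentalTensor (fun _ => f) a a

theorem normTensor_eq (f : L → ℝ) (a : L) :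
    normTensor f a = (1 / 2 : ℝ) • fderiv ℝ (fderiv ℝ fun z => f z ^ 2) a := rfl

/-- Positivity makes `T` injective into the dual, which has the same finite dimension. -/
theorem isInvertible_of_posDef [FiniteDimensional ℝ L] {T : L →L[ℝ] L →L[ℝ] ℝ}
    (h : ∀ u ≠ 0, 0 < T u u) : T.IsInvertible := by
  have hinj : Function.Injective (LinearMap.toContinuousLinearMap.symm.toLinearMap ∘ₗ
      (T : L →ₗ[ℝ] L →L[ℝ] ℝ) : L →ₗ[ℝ] (L →ₗ[ℝ] ℝ)) := by
    rw [← LinearMap.ker_eq_bot, LinearMap.ker_eq_bot']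
    intro u hu
    by_contra hne
    have := h u hne
    have h0 : T u u = 0 := congrArg (fun A : L →ₗ[ℝ] ℝ => A u) hu
    linarith
  have hrank : Module.finrank ℝ L = Module.finrank ℝ (L →L[ℝ] ℝ) := by
    rw [← (LinearMap.toContinuousLinearMap (𝕜 := ℝ) (E := L) (F' := ℝ)).finrank_eq]
    exact (Subspace.dual_finrank_eq (K := ℝ) (V := L)).symm
  have hinj' : Function.Injective (T : L →ₗ[ℝ] L →L[ℝ] ℝ) := fun a b hab =>
    hinj (congrArg (LinearMap.toContinuousLinearMap (𝕜 := ℝ) (E := L) (F' := ℝ)).symm hab)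
  refine ⟨(LinearEquiv.ofInjectiveOfFinrankEq _ hinj' hrank).toContinuousLinearEquiv, ?_⟩
  ext u v
  rfl

namespace IsInvariantFrame

theorem inverse_ne_zero (h : IsInvariantFrame Φ br U) {x : E} (hx : x ∈ U) {y : E} (hy : y ≠ 0) :
    (Φ x).inverse y ≠ 0 := fun h0 => hy (by rw [← h.apply_inverse hx y, h0, map_zero])

theorem apply_ne_zero (h : IsInvariantFrame Φ br U) {x : E} (hx : x ∈ U) {a : L} (ha : a ≠ 0) :
    Φ x a ≠ 0 := fun h0 => ha (by rw [← h.inverse_apply hx a, h0, map_zero])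

theorem contDiffAt_finsler [CompleteSpace L] (h : IsInvariantFrame Φ br U)
    (hF : ∀ x ∈ U, ∀ y, F x y = f ((Φ x).inverse y))
    (hf : ∀ a ≠ 0, ContDiffAt ℝ ∞ (fun a => f a ^ 2) a)
    {x : E} (hx : x ∈ U) {y : E} (hy : y ≠ 0) :
    ContDiffAt ℝ (3 : ℕ) (fun q : E × E => F q.1 q.2 ^ 2) (x, y) := by
  have h1 : ContDiffAt ℝ ∞ (fun q : E × E => (Φ q.1).inverse q.2) (x, y) :=
    ((h.contDiffAt_inverse hx).comp (x, y) contDiffAt_fst).clm_apply contDiffAt_snd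
  have h2 : ContDiffAt ℝ ∞ (fun q : E × E => f ((Φ q.1).inverse q.2) ^ 2) (x, y) :=
    ContDiffAt.comp (g := fun a => f a ^ 2) (x, y) (hf _ (h.inverse_ne_zero hx hy)) h1
  refine (h2.of_le (by norm_cast)).congr_of_eventuallyEq ?_
  have : ∀ᶠ q : E × E in 𝓝 (x, y), q.1 ∈ U :=
    continuous_fst.tendsto (x, y) |>.eventually (h.isOpen.mem_nhds hx)
  filter_upwards [this] with q hq
  rw [hF q.1 hq]

theorem partialSnd_finsler (h : IsInvariantFrame Φ br U)
    (hF : ∀ x ∈ U, ∀ y, F x y = f ((Φ x).inverse y))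
    {x : E} (hx : x ∈ U) (y w : E) :
    partialSnd (fun x y => F x y ^ 2) x y w
      = fderiv ℝ (fun a => f a ^ 2) ((Φ x).inverse y) ((Φ x).inverse w) := by
  obtain ⟨A, hA⟩ := h.isInvertible x hx
  have e : (fun z => F x z ^ 2) = (fun a => f a ^ 2) ∘ A.symm := by
    ext z
    simp [hF x hx, ← hA]
  unfold partialSnd
  rw [e, ContinuousLinearEquiv.comp_right_fderiv, ← hA]
  simp

theorem fundamentalTensor_finsler (h : IsInvariantFrame Φ br U)
    (hF : ∀ x ∈ U, ∀ y, F x y = f ((Φ x).inverse y))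
    (hf : ∀ a ≠ 0, ContDiffAt ℝ ∞ (fun a => f a ^ 2) a)
    {x : E} (hx : x ∈ U) {y : E} (hy : y ≠ 0) (u v : E) :
    fundamentalTensor F x y u v
      = normTensor f ((Φ x).inverse y) ((Φ x).inverse u) ((Φ x).inverse v) := by
  have hd : DifferentiableAt ℝ (fderiv ℝ fun a => f a ^ 2) ((Φ x).inverse y) :=
    ((hf _ (h.inverse_ne_zero hx hy)).fderiv_right (m := 1) (by norm_cast)).differentiableAt
      (by simp)
  have e : (fun z => fderiv ℝ (fun z => F x z ^ 2) z) = fun z =>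
      (fderiv ℝ (fun a => f a ^ 2) ((Φ x).inverse z)).comp (Φ x).inverse := by
    ext z w
    exact h.partialSnd_finsler hF hx z w
  have d := (hd.hasFDerivAt.comp y (Φ x).inverse.hasFDerivAt).clm_comp
    (hasFDerivAt_const (Φ x).inverse y)
  rw [normTensor_eq]
  unfold fundamentalTensor
  change (1 / 2 : ℝ) * fderiv ℝ (fun z => fderiv ℝ (fun z => F x z ^ 2) z) y u v = _
  rw [e]
  erw [d.fderiv]
  simp

theorem isInvertible_fundamentalTensor [FiniteDimensional ℝ E] (h : IsInvariantFrame Φ br U)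
    (hF : ∀ x ∈ U, ∀ y, F x y = f ((Φ x).inverse y))
    (hf : ∀ a ≠ 0, ContDiffAt ℝ ∞ (fun a => f a ^ 2) a)
    (hpos : ∀ a ≠ 0, ∀ u ≠ 0, 0 < normTensor f a u u)
    {x : E} (hx : x ∈ U) {y : E} (hy : y ≠ 0) :
    (fundamentalTensor F x y).IsInvertible := by
  refine isInvertible_of_posDef fun u hu => ?_
  rw [h.fundamentalTensor_finsler hF hf hx hy]
  exact hpos _ (h.inverse_ne_zero hx hy) _ (h.inverse_ne_zero hx hu)

/-- A left invariant Finsler metric is constant along a left invariant frame. -/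
theorem partialFst_finsler [CompleteSpace L] (h : IsInvariantFrame Φ br U)
    (hF : ∀ x ∈ U, ∀ y, F x y = f ((Φ x).inverse y))
    (hf : ∀ a ≠ 0, ContDiffAt ℝ ∞ (fun a => f a ^ 2) a)
    {x : E} (hx : x ∈ U) {y : E} (hy : y ≠ 0) (u : E) :
    partialFst (fun x y => F x y ^ 2) x y u
      = - partialSnd (fun x y => F x y ^ 2) x y (fderiv ℝ Φ x u ((Φ x).inverse y)) := by
  set a := (Φ x).inverse y with ha
  have hya : y = Φ x a := (h.apply_inverse hx y).symm
  have hd := (h.contDiffAt_finsler hF hf hx hy).differentiableAt (by simp)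
  have dΦ := (h.differentiableAt hx).hasFDerivAt.clm_apply (hasFDerivAt_const a x)
  have dq := (hasFDerivAt_id x).prodMk dΦ
  have hd' : HasFDerivAt (fun q : E × E => F q.1 q.2 ^ 2)
      (fderiv ℝ (fun q : E × E => F q.1 q.2 ^ 2) (x, y)) (x, Φ x a) := by
    rw [← hya]; exact hd.hasFDerivAt
  have dc := HasFDerivAt.comp (g := fun q : E × E => F q.1 q.2 ^ 2)
    (f := fun z => (z, Φ z a)) x hd' dq
  -- Along the frame field `z ↦ Φ z a` the metric keeps the value `f a`; the chain rule turns this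
  -- into the relation between the two partial derivatives.
  have e : (fun q : E × E => F q.1 q.2 ^ 2) ∘ (fun z => (z, Φ z a)) =ᶠ[𝓝 x] fun _ => f a ^ 2 := by
    filter_upwards [h.isOpen.mem_nhds hx] with z hz
    simp [hF z hz, h.inverse_apply hz]
  have key := e.fderiv_eq (𝕜 := ℝ)
  rw [dc.fderiv, fderiv_fun_const] at key
  have key := congrArg (fun A : E →L[ℝ] ℝ => A u) key
  rw [partialFst_eq (f := fun x y => F x y ^ 2) hd, partialSnd_eq (f := fun x y => F x y ^ 2) hd,
    eq_neg_iff_add_eq_zero]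
  simp only [ContinuousLinearMap.comp_apply, ContinuousLinearMap.inl_apply,
    ContinuousLinearMap.inr_apply, ← map_add, Prod.mk_add_mk, add_zero, zero_add]
  simpa using key

/-- If `nab` is a symmetric connection that preserves the norm `f`, then it is the Chern
connection of the left invariant Finsler metric of `f`. -/
theorem horizontallyConstant [CompleteSpace L] (h : IsInvariantFrame Φ br U)
    (hF : ∀ x ∈ U, ∀ y, F x y = f ((Φ x).inverse y))
    (hf : ∀ a ≠ 0, ContDiffAt ℝ ∞ (fun a => f a ^ 2) a)
    (hnab : ∀ a ≠ 0, ∀ c, fderiv ℝ (fun a => f a ^ 2) a (nab c a) = 0) :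
    HorizontallyConstant (fun x y => F x y ^ 2) (frameConnection Φ nab) (U ×ˢ {0}ᶜ) := by
  rintro x y ⟨hx, hy⟩ u
  rw [h.partialFst_finsler hF hf hx hy, frameConnection_apply, map_sub,
    h.partialSnd_finsler hF hx y (Φ x _), h.inverse_apply hx,
    hnab _ (h.inverse_ne_zero hx hy), zero_sub]

/-- The flag curvature of a left invariant Finsler metric whose norm is preserved by the symmetric
connection `nab`. -/
theorem localFlagCurvature_finsler [FiniteDimensional ℝ E] [CompleteSpace L]
    (h : IsInvariantFrame Φ br U)
    (hF : ∀ x ∈ U, ∀ y, F x y = f ((Φ x).inverse y))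
    (hf : ∀ a ≠ 0, ContDiffAt ℝ ∞ (fun a => f a ^ 2) a)
    (hpos : ∀ a ≠ 0, ∀ u ≠ 0, 0 < normTensor f a u u)
    (htor : ∀ a b, nab a b - nab b a = br a b)
    (hnab : ∀ a ≠ 0, ∀ c, fderiv ℝ (fun a => f a ^ 2) a (nab c a) = 0)
    {x : E} (hx : x ∈ U) {a : L} (ha : a ≠ 0) (c : L) :
    localFlagCurvature F x (Φ x a) (Φ x c)
      = normTensor f a (nab c (nab a a) - nab a (nab c a) - nab (br c a) a) c
        / (normTensor f a a a * normTensor f a c c - normTensor f a c a ^ 2) := by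
  classical
  -- The symbols are cut off to zero outside `U`, because the general lemmas ask for symmetry of `Γ`
  -- at every point.
  set Γ : E → E →L[ℝ] E →L[ℝ] E := fun x => if x ∈ U then frameConnection Φ nab x else 0 with hΓdef
  have hΓU : ∀ x ∈ U, Γ x = frameConnection Φ nab x := fun x hx => by simp [hΓdef, hx]
  have hev : Γ =ᶠ[𝓝 x] frameConnection Φ nab := by
    filter_upwards [h.isOpen.mem_nhds hx] with z hz using hΓU z hz
  have hΓ : ∀ x u v, Γ x u v = Γ x v u := by
    intro x u v
    by_cases hx : x ∈ U
    · rw [hΓU x hx, h.frameConnection_comm htor hx]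
    · simp [hΓdef, hx]
  have hO : IsOpen (U ×ˢ ({0}ᶜ : Set E)) := h.isOpen.prod isOpen_compl_singleton
  have hL : HorizontallyConstant (fun x y => F x y ^ 2) Γ (U ×ˢ ({0}ᶜ : Set E)) := by
    rintro x y hxy u
    rw [hΓU x hxy.1]
    exact h.horizontallyConstant hF hf hnab x y hxy u
  have hmem : (x, Φ x a) ∈ U ×ˢ ({0}ᶜ : Set E) := ⟨hx, h.apply_ne_zero hx ha⟩
  have hc := chernCurvature_eq_of_horizontallyConstant hL hΓ hO
    (fun q hq => h.contDiffAt_finsler hF hf hq.1 hq.2)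
    (fun x y hq => h.isInvertible_fundamentalTensor hF hf hpos hq.1 hq.2) hmem
    (((h.contDiffAt_frameConnection hx).differentiableAt (by simp)).congr_of_eventuallyEq hev)
    (Φ x c) (Φ x a) (Φ x a)
  have hR : linearCurvature Γ x = linearCurvature (frameConnection Φ nab) x := by
    unfold linearCurvature
    rw [hev.fderiv_eq, hΓU x hx]
  unfold localFlagCurvature
  rw [hc, hR, h.linearCurvature_frameConnection hx]
  have hy := h.apply_ne_zero hx ha
  simp only [h.fundamentalTensor_finsler hF hf hx hy, h.inverse_apply hx]

/-- If the left invariant Finsler metric of `f` has at `x` the spray `½ Γ(y, y)`, then some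
connection on `L` with torsion zero preserves `f`. -/
theorem exists_connection_of_sprayCoeff [FiniteDimensional ℝ E] [CompleteSpace L]
    (h : IsInvariantFrame Φ br U)
    (hF : ∀ x ∈ U, ∀ y, F x y = f ((Φ x).inverse y))
    (hf : ∀ a ≠ 0, ContDiffAt ℝ ∞ (fun a => f a ^ 2) a)
    (hpos : ∀ a ≠ 0, ∀ u ≠ 0, 0 < normTensor f a u u)
    (hh : ∀ a, ∀ t : ℝ, 0 < t → f (t • a) ^ 2 = t ^ 2 * f a ^ 2)
    {x : E} (hx : x ∈ U) {Γ : E →L[ℝ] E →L[ℝ] E}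
    (hG : ∀ y ≠ 0, sprayCoeff F x y = (1 / 2 : ℝ) • Γ y y) :
    ∃ B : L →L[ℝ] L →L[ℝ] L, (∀ a b, B a b - B b a = br a b) ∧
      ∀ a ≠ 0, ∀ c, fderiv ℝ (fun a => f a ^ 2) a (B c a) = 0 := by
  -- The given symbols need not be symmetric; the spray only sees their symmetric part.
  set S : E →L[ℝ] E →L[ℝ] E := (1 / 2 : ℝ) • (Γ + Γ.flip) with hS
  have hSa : ∀ u v, S u v = (1 / 2 : ℝ) • (Γ u v + Γ v u) := fun _ _ => rfl
  have hSc : ∀ u v, S u v = S v u := fun u v => by rw [hSa, hSa, add_comm]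
  have hSG : ∀ y ≠ 0, sprayCoeff F x y = (1 / 2 : ℝ) • S y y := by
    intro y hy
    rw [hG y hy, hSa, ← two_smul ℝ, smul_smul, smul_smul]
    norm_num
  have key := fun (y : E) (hy : y ≠ 0) v => partialFst_eq_of_sprayCoeff h.isOpen
    (fun x hx y hy => h.contDiffAt_finsler hF hf hx hy)
    (fun x hx y t ht => by rw [hF x hx, hF x hx, map_smul, hh _ t ht]) hx
    (fun y hy => h.isInvertible_fundamentalTensor hF hf hpos hx hy) hSc hSG hy v
  set P := (Φ x).inverse
  -- The connection with symbols `S`, read in the frame: the covariant derivative of `Φ b` along `Φ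
  -- a` at `x`, pulled back by `Φ x`.
  let B : L →L[ℝ] L →L[ℝ] L := ((ContinuousLinearMap.compL ℝ L E L P).comp
    (((ContinuousLinearMap.compL ℝ L E E).flip (Φ x)).comp S + fderiv ℝ Φ x)).comp (Φ x)
  have hB : ∀ a b, B a b = P (S (Φ x a) (Φ x b) + fderiv ℝ Φ x (Φ x a) b) := fun _ _ => rfl
  refine ⟨B, fun a b => ?_, fun a ha c => ?_⟩
  · rw [hB, hB, ← map_sub, hSc, add_sub_add_left_eq_sub, h.bracket x hx, h.inverse_apply hx]
  · have h1 := key (Φ x a) (h.apply_ne_zero hx ha) (Φ x c)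
    rw [h.partialFst_finsler hF hf hx (h.apply_ne_zero hx ha), h.inverse_apply hx,
      neg_eq_iff_add_eq_zero, ← map_add, h.partialSnd_finsler hF hx, h.inverse_apply hx,
      add_comm] at h1
    exact h1

end IsInvariantFrame

end FrameFinsler

/-! ### Minkowski norms of (α, β)-type and their fundamental tensor. -/

section AlphaBeta

variable {L : Type*} [NormedAddCommGroup L] [NormedSpace ℝ L]

/-- The `(α, β)`-norm `α φ(β/α)` with `α = √m(a, a)` and `β = m(ξ, a)`. -/
def alphaBetaNorm (φ : ℝ → ℝ) (m : L →L[ℝ] L →L[ℝ] ℝ) (ξ a : L) : ℝ :=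
  Real.sqrt (m a a) * φ (m ξ a / Real.sqrt (m a a))

/-- The conditions on `φ`, an inner product `m` and a vector `ξ` under which `α φ(β/α)` is a
Minkowski norm. -/
structure IsAlphaBetaData (φ : ℝ → ℝ) (b₀ : ℝ) (m : L →L[ℝ] L →L[ℝ] ℝ) (ξ : L) : Prop where
  symm : ∀ a b, m a b = m b a
  pos : ∀ a ≠ 0, 0 < m a a
  smooth : ContDiffOn ℝ ∞ φ (Set.Ioo (-b₀) b₀)
  phi_pos : ∀ s ∈ Set.Ioo (-b₀) b₀, 0 < φ s
  reg : ∀ s b : ℝ, |s| ≤ b → b < b₀ →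
    0 < φ s - s * deriv φ s + (b ^ 2 - s ^ 2) * deriv (deriv φ) s
  norm_lt : Real.sqrt (m ξ ξ) < b₀

namespace IsAlphaBetaData

variable {φ : ℝ → ℝ} {b₀ : ℝ} {m : L →L[ℝ] L →L[ℝ] ℝ} {ξ : L}

theorem nonneg (h : IsAlphaBetaData φ b₀ m ξ) (a : L) : 0 ≤ m a a := by
  by_cases ha : a = 0
  · simp [ha]
  · exact (h.pos a ha).le

theorem sqrt_pos (h : IsAlphaBetaData φ b₀ m ξ) {a : L} (ha : a ≠ 0) :
    0 < Real.sqrt (m a a) := Real.sqrt_pos.2 (h.pos a ha)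

/-- Positivity of `m` on `a` minus its projection to `b`. -/
theorem cauchy_schwarz (h : IsAlphaBetaData φ b₀ m ξ) (a b : L) :
    m a b ^ 2 ≤ m a a * m b b := by
  by_cases hb : b = 0
  · simp [hb]
  have hbb := h.pos b hb
  have h1 := h.nonneg (a - (m a b / m b b) • b)
  simp only [map_sub, map_smul, sub_apply, smul_apply, smul_eq_mul, h.symm b a] at h1
  have h2 : m a a - m a b / m b b * m a b - m a b / m b b * (m a b - m a b / m b b * m b b)
      = (m a a * m b b - m a b ^ 2) / m b b := by
    field_simp
    ring
  rw [h2] at h1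
  have := mul_nonneg h1 hbb.le
  rw [div_mul_cancel₀ _ hbb.ne'] at this
  linarith

theorem abs_le (h : IsAlphaBetaData φ b₀ m ξ) {a : L} (ha : a ≠ 0) :
    |m ξ a / Real.sqrt (m a a)| ≤ Real.sqrt (m ξ ξ) := by
  apply Real.abs_le_sqrt
  rw [div_pow, Real.sq_sqrt (h.nonneg a), div_le_iff₀ (h.pos a ha)]
  exact h.cauchy_schwarz ξ a

theorem mem_Ioo (h : IsAlphaBetaData φ b₀ m ξ) {s : ℝ} (hs : |s| ≤ Real.sqrt (m ξ ξ)) :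
    s ∈ Set.Ioo (-b₀) b₀ := by
  have := lt_of_le_of_lt hs h.norm_lt
  exact abs_lt.1 this

theorem quotient_mem (h : IsAlphaBetaData φ b₀ m ξ) {a : L} (ha : a ≠ 0) :
    m ξ a / Real.sqrt (m a a) ∈ Set.Ioo (-b₀) b₀ := h.mem_Ioo (h.abs_le ha)

/-- The regularity condition with `b = |s|`, where the coefficient of `φ''` is zero. -/
theorem psi_pos (h : IsAlphaBetaData φ b₀ m ξ) {s : ℝ} (hs : s ∈ Set.Ioo (-b₀) b₀) :
    0 < φ s - s * deriv φ s := by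
  have := h.reg s |s| le_rfl (abs_lt.2 hs)
  simpa using this

theorem hasDerivAt (h : IsAlphaBetaData φ b₀ m ξ) {s : ℝ} (hs : s ∈ Set.Ioo (-b₀) b₀) :
    HasDerivAt φ (deriv φ s) s :=
  ((h.smooth.contDiffAt (isOpen_Ioo.mem_nhds hs)).differentiableAt (by simp)).hasDerivAt

theorem hasDerivAt_deriv (h : IsAlphaBetaData φ b₀ m ξ) {s : ℝ} (hs : s ∈ Set.Ioo (-b₀) b₀) :
    HasDerivAt (deriv φ) (deriv (deriv φ) s) s := by
  have h1 : ContDiffOn ℝ 1 (deriv φ) (Set.Ioo (-b₀) b₀) :=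
    h.smooth.deriv_of_isOpen isOpen_Ioo (by norm_cast)
  exact ((h1.contDiffAt (isOpen_Ioo.mem_nhds hs)).differentiableAt (by simp)).hasDerivAt

theorem hasFDerivAt_sqrt (h : IsAlphaBetaData φ b₀ m ξ) {a : L} (ha : a ≠ 0) :
    HasFDerivAt (fun a => Real.sqrt (m a a)) ((1 / Real.sqrt (m a a)) • m a) a := by
  have h1 : HasFDerivAt (fun a => m a a) ((2 : ℝ) • m a) a := by
    have := m.hasFDerivAt.clm_apply (hasFDerivAt_id a)
    refine this.congr_fderiv ?_
    ext u
    simp [h.symm u a, two_mul]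
  refine (h1.sqrt (h.pos a ha).ne').congr_fderiv ?_
  rw [smul_smul]
  congr 1
  have := (h.sqrt_pos ha).ne'
  field_simp

theorem hasFDerivAt_quotient (h : IsAlphaBetaData φ b₀ m ξ) {a : L} (ha : a ≠ 0) :
    HasFDerivAt (fun a => m ξ a / Real.sqrt (m a a))
      ((1 / Real.sqrt (m a a)) • m ξ
        - (m ξ a / Real.sqrt (m a a) ^ 3) • m a) a := by
  have := (m ξ).hasFDerivAt.mul ((hasDerivAt_inv (h.sqrt_pos ha).ne').comp_hasFDerivAt a
    (h.hasFDerivAt_sqrt ha))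
  refine this.congr_fderiv ?_
  have := (h.sqrt_pos ha).ne'
  ext u
  simp
  field_simp
  ring

/-- The first derivative of the square of an `(α, β)`-norm. -/
theorem hasFDerivAt_sq (h : IsAlphaBetaData φ b₀ m ξ) {a : L} (ha : a ≠ 0) :
    HasFDerivAt (fun a => alphaBetaNorm φ m ξ a ^ 2)
      ((2 * (φ (m ξ a / Real.sqrt (m a a)) * (φ (m ξ a / Real.sqrt (m a a))
          - m ξ a / Real.sqrt (m a a) * deriv φ (m ξ a / Real.sqrt (m a a))))) • m a
        + (2 * (Real.sqrt (m a a) * (φ (m ξ a / Real.sqrt (m a a))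
          * deriv φ (m ξ a / Real.sqrt (m a a))))) • m ξ) a := by
  have h1 := (h.hasDerivAt (h.quotient_mem ha)).comp_hasFDerivAt a (h.hasFDerivAt_quotient ha)
  have h2 := ((h.hasFDerivAt_sqrt ha).mul h1).pow 2
  refine h2.congr_fderiv ?_
  have := (h.sqrt_pos ha).ne'
  ext u
  simp
  field_simp
  ring

theorem fderiv_sq (h : IsAlphaBetaData φ b₀ m ξ) {a : L} (ha : a ≠ 0) (u : L) :
    fderiv ℝ (fun a => alphaBetaNorm φ m ξ a ^ 2) a u
      = 2 * (φ (m ξ a / Real.sqrt (m a a)) * (φ (m ξ a / Real.sqrt (m a a))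
          - m ξ a / Real.sqrt (m a a) * deriv φ (m ξ a / Real.sqrt (m a a)))) * m a u
        + 2 * (Real.sqrt (m a a) * (φ (m ξ a / Real.sqrt (m a a))
          * deriv φ (m ξ a / Real.sqrt (m a a)))) * m ξ u := by
  rw [(h.hasFDerivAt_sq ha).fderiv]
  rfl

theorem contDiffAt_sq (h : IsAlphaBetaData φ b₀ m ξ) (a : L) (ha : a ≠ 0) :
    ContDiffAt ℝ ∞ (fun a => alphaBetaNorm φ m ξ a ^ 2) a := by
  have h0 : ContDiffAt ℝ ∞ (fun a => m a a) a :=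
    m.contDiff.contDiffAt.clm_apply contDiffAt_id
  have h1 : ContDiffAt ℝ ∞ (fun a => Real.sqrt (m a a)) a := h0.sqrt (h.pos a ha).ne'
  have h2 : ContDiffAt ℝ ∞ (fun a => m ξ a / Real.sqrt (m a a)) a :=
    (m ξ).contDiff.contDiffAt.div h1 (h.sqrt_pos ha).ne'
  have h3 := (h.smooth.contDiffAt (isOpen_Ioo.mem_nhds (h.quotient_mem ha))).comp a h2
  exact (h1.mul h3).pow 2

/-- The fundamental tensor of an `(α, β)`-norm. -/
theorem normTensor_apply (h : IsAlphaBetaData φ b₀ m ξ) {a : L} (ha : a ≠ 0) {α s f f' f'' : ℝ}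
    (hα : Real.sqrt (m a a) = α) (hs : m ξ a / α = s) (hf : φ s = f) (hf' : deriv φ s = f')
    (hf'' : deriv (deriv φ) s = f'') (u v : L) :
    normTensor (alphaBetaNorm φ m ξ) a u v
      = ((f - s * f') * (m a u / α) + f' * m ξ u) * ((f - s * f') * (m a v / α) + f' * m ξ v)
        + f * f'' * (m ξ u - s * (m a u / α)) * (m ξ v - s * (m a v / α))
        + f * (f - s * f') * (m u v - m a u / α * (m a v / α)) := by
  have hαp : 0 < α := hα ▸ h.sqrt_pos ha
  have hmem : s ∈ Set.Ioo (-b₀) b₀ := by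
    have := h.quotient_mem ha
    rwa [hα, hs] at this
  have e : fderiv ℝ (fun a => alphaBetaNorm φ m ξ a ^ 2) =ᶠ[𝓝 a] fun a =>
      (2 * (φ (m ξ a / Real.sqrt (m a a)) * (φ (m ξ a / Real.sqrt (m a a))
          - m ξ a / Real.sqrt (m a a) * deriv φ (m ξ a / Real.sqrt (m a a))))) • m a
        + (2 * (Real.sqrt (m a a) * (φ (m ξ a / Real.sqrt (m a a))
          * deriv φ (m ξ a / Real.sqrt (m a a))))) • m ξ := by
    filter_upwards [isOpen_ne.mem_nhds ha] with z hz using (h.hasFDerivAt_sq hz).fderiv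
  have d1 := h.hasFDerivAt_sqrt ha
  have d2 := h.hasFDerivAt_quotient ha
  have d3 := (h.hasDerivAt (h.quotient_mem ha)).comp_hasFDerivAt a d2
  have d4 := (h.hasDerivAt_deriv (h.quotient_mem ha)).comp_hasFDerivAt a d2
  have d5 := (((d3.mul (d3.sub (d2.mul d4))).const_mul 2).smul m.hasFDerivAt).add
    (((d1.mul (d3.mul d4)).const_mul 2).smul_const (m ξ))
  rw [normTensor_eq, e.fderiv_eq]
  erw [d5.fderiv]
  simp
  rw [hα, hs, hf, hf', hf'']
  have hb : m ξ a = s * α := by rw [← hs]; field_simp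
  rw [hb]
  field_simp
  ring

/-- With `w` and `η` the parts of `u` and `ξ` orthogonal to `a`, the tensor is a square plus `φ (φ''
m(η, w)² + (φ - s φ') m(w, w))`, and `m(η, η) = m(ξ, ξ) - s²` is the coefficient in the regularity
condition at `b = √m(ξ, ξ)`. -/
theorem normTensor_pos (h : IsAlphaBetaData φ b₀ m ξ) (a : L) (ha : a ≠ 0) (u : L) (hu : u ≠ 0) :
    0 < normTensor (alphaBetaNorm φ m ξ) a u u := by
  rw [h.normTensor_apply ha rfl rfl rfl rfl rfl]
  have hα := h.sqrt_pos ha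
  have hα2 : Real.sqrt (m a a) ^ 2 = m a a := Real.sq_sqrt (h.nonneg a)
  have hmem := h.quotient_mem ha
  have hreg := h.reg _ _ (h.abs_le ha) h.norm_lt
  rw [Real.sq_sqrt (h.nonneg ξ)] at hreg
  have hpsi := h.psi_pos hmem
  have hphi := h.phi_pos _ hmem
  set α := Real.sqrt (m a a)
  set s := m ξ a / α with hs
  have hb : m ξ a = s * α := by rw [hs]; field_simp
  set f := φ s
  set f' := deriv φ s
  set f'' := deriv (deriv φ) s
  set ν := m a u / α with hν
  have hau : m a u = ν * α := by rw [hν]; field_simp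
  set w := u - (ν / α) • a with hw
  set η := ξ - (s / α) • a with hη
  have c1 : m w w = m u u - ν * ν := by
    simp only [hw, map_sub, map_smul, sub_apply, smul_apply, smul_eq_mul, h.symm u a, hau, ← hα2]
    field_simp
    ring
  have c2 : m η η = m ξ ξ - s ^ 2 := by
    simp only [hη, map_sub, map_smul, sub_apply, smul_apply, smul_eq_mul, h.symm a ξ, hb, ← hα2]
    field_simp
    ring
  have c3 : m η w = m ξ u - s * ν := by
    simp only [hη, hw, map_sub, map_smul, sub_apply, smul_apply, smul_eq_mul, hau, hb, ← hα2]
    field_simp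
    ring
  have cs := h.cauchy_schwarz η w
  rw [c2, c3] at cs
  rw [← c1]
  -- For `u` proportional to `a` only the square survives, and it equals `(f ν)²`.
  by_cases hw0 : w = 0
  · have hu' : u = (ν / α) • a := by rw [← sub_eq_zero, ← hw, hw0]
    have hν0 : ν ≠ 0 := by
      intro h0
      rw [h0] at hu'
      exact hu (by simpa using hu')
    have hx : m ξ u = s * ν := by
      have : m η w = 0 := by rw [hw0, map_zero]
      rw [c3] at this
      linarith
    rw [hw0, hx]
    have : 0 < (f * ν) ^ 2 := by positivity
    simp only [map_zero]
    nlinarith [this]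
  · have hww := h.pos w hw0
    have key : 0 < f'' * (m ξ u - s * ν) ^ 2 + (f - s * f') * m w w := by
      -- When `f''` is negative, Cauchy–Schwarz for `η` and `w` reduces the inequality to the
      -- regularity condition.
      by_cases hf'' : 0 ≤ f''
      · have := mul_nonneg hf'' (sq_nonneg (m ξ u - s * ν))
        have := mul_pos hpsi hww
        linarith
      · have h1 := mul_le_mul_of_nonpos_left cs (not_le.1 hf'').le
        have h2 := mul_pos hreg hww
        linarith
    have h3 := mul_pos hphi key
    have h4 := sq_nonneg ((f - s * f') * ν + f' * m ξ u)
    linarith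

/-- The flag curvature of an `(α, β)`-norm for a curvature vector orthogonal to `ξ`. -/
theorem flag_eq (h : IsAlphaBetaData φ b₀ m ξ) {a c Z : L} (haa : m a a = 1) (hcc : m c c = 1)
    (hac : m a c = 0) (hξZ : m ξ Z = 0) (haZ : m a Z = 0) :
    normTensor (alphaBetaNorm φ m ξ) a Z c
        / (normTensor (alphaBetaNorm φ m ξ) a a a * normTensor (alphaBetaNorm φ m ξ) a c c
          - normTensor (alphaBetaNorm φ m ξ) a c a ^ 2)
      = 1 / (φ (m ξ a) ^ 2 * (1 + m ξ c ^ 2 * curvatureD φ (m ξ a))) * m Z c := by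
  have ha : a ≠ 0 := by rintro rfl; simp at haa
  have hα : Real.sqrt (m a a) = 1 := by simp [haa]
  have hs : m ξ a / 1 = m ξ a := div_one _
  have hmem := h.quotient_mem ha
  rw [hα, hs] at hmem
  have hpsi := h.psi_pos hmem
  have hphi := h.phi_pos _ hmem
  simp only [h.normTensor_apply ha hα hs rfl rfl rfl, haa, hcc, hac, hξZ, haZ]
  unfold curvatureD
  set s := m ξ a
  set f := φ s
  set f' := deriv φ s
  set f'' := deriv (deriv φ) s
  set β := m ξ c
  set k := m Z c
  set p := f - s * f' with hp
  have hf : f = p + s * f' := by rw [hp]; ring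
  have e1 : 1 + β ^ 2 * (f'' / p) = (p + β ^ 2 * f'') / p := by field_simp
  rw [e1]
  have e2 : (p * (1 / 1) + f' * s) * (p * (1 / 1) + f' * s) + f * f'' * (s - s * (1 / 1))
      * (s - s * (1 / 1)) + f * p * (1 - 1 / 1 * (1 / 1)) = f ^ 2 := by rw [hf]; ring
  rw [e2]
  -- The denominator of the flag quotient is `f³ (p + β² f'')`. If it vanished, both sides would be
  -- quotients by zero and hence zero, so its positivity need not be established.
  by_cases hq : p + β ^ 2 * f'' = 0
  · have : f ^ 2 * ((p * (0 / 1) + f' * β) * (p * (0 / 1) + f' * β) + f * f'' * (β - s * (0 / 1))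
      * (β - s * (0 / 1)) + f * p * (1 - 0 / 1 * (0 / 1))) - ((p * (0 / 1) + f' * β)
      * (p * (1 / 1) + f' * s) + f * f'' * (β - s * (0 / 1)) * (s - s * (1 / 1)) + f * p
      * (0 - 0 / 1 * (1 / 1))) ^ 2 = f ^ 3 * (p + β ^ 2 * f'') := by rw [hf]; ring
    simp only [h.symm c a, hac]
    rw [this, hq]
    simp
  · have : f ^ 2 * ((p * (0 / 1) + f' * β) * (p * (0 / 1) + f' * β) + f * f'' * (β - s * (0 / 1))
      * (β - s * (0 / 1)) + f * p * (1 - 0 / 1 * (0 / 1))) - ((p * (0 / 1) + f' * β)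
      * (p * (1 / 1) + f' * s) + f * f'' * (β - s * (0 / 1)) * (s - s * (1 / 1)) + f * p
      * (0 - 0 / 1 * (1 / 1))) ^ 2 = f ^ 3 * (p + β ^ 2 * f'') := by rw [hf]; ring
    simp only [h.symm c a, hac]
    rw [this]
    field_simp
    ring

/-- A connection preserving `m` and `ξ` preserves the `(α, β)`-norm. -/
theorem fderiv_sq_eq_zero (h : IsAlphaBetaData φ b₀ m ξ) {nab : L →L[ℝ] L →L[ℝ] L}
    (hm : ∀ c a b, m (nab c a) b + m a (nab c b) = 0) (hξ : ∀ c, nab c ξ = 0) (a : L) (ha : a ≠ 0)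
    (c : L) : fderiv ℝ (fun a => alphaBetaNorm φ m ξ a ^ 2) a (nab c a) = 0 := by
  have h1 := hm c a a
  have h2 := hm c ξ a
  rw [h.symm (nab c a) a] at h1
  rw [hξ, map_zero, zero_apply, zero_add] at h2
  rw [h.fderiv_sq ha, h2, show m a (nab c a) = 0 by linarith]
  ring

theorem alphaBetaNorm_smul (t : ℝ) (ht : 0 < t) (a : L) :
    alphaBetaNorm φ m ξ (t • a) = t * alphaBetaNorm φ m ξ a := by
  have e : Real.sqrt (m (t • a) (t • a)) = t * Real.sqrt (m a a) := by
    simp only [map_smul, smul_apply, smul_eq_mul]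
    rw [← mul_assoc, Real.sqrt_mul (by positivity), Real.sqrt_mul_self ht.le]
  unfold alphaBetaNorm
  rw [e, map_smul, smul_eq_mul, mul_div_mul_left _ _ ht.ne', mul_assoc]

end IsAlphaBetaData

end AlphaBeta

/-! ### Dichotomy for a norm preserved by a torsion-free connection: Euclidean norm or parallel
vector. -/

section ParallelForm

variable {L : Type*} [NormedAddCommGroup L] [NormedSpace ℝ L]

/-- Two metric connections with the same torsion agree. -/
theorem connection_unique {m : L →L[ℝ] L →L[ℝ] ℝ} (symm : ∀ a b, m a b = m b a)
    (pos : ∀ a ≠ 0, 0 < m a a) {A B : L →L[ℝ] L →L[ℝ] L}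
    (htor : ∀ a b, A a b - A b a = B a b - B b a)
    (hA : ∀ c a b, m (A c a) b + m a (A c b) = 0) (hB : ∀ c a b, m (B c a) b + m a (B c b) = 0) :
    A = B := by
  set C := A - B with hC
  have hCa : ∀ a b, C a b = A a b - B a b := fun _ _ => rfl
  have hs : ∀ a b, C a b = C b a := by
    intro a b
    have := htor a b
    rw [hCa, hCa, sub_eq_sub_iff_sub_eq_sub, this]
  have hk : ∀ c a b, m (C c a) b = - m (C c b) a := by
    intro c a b
    have h1 := hA c a b
    have h2 := hB c a b
    rw [hCa, hCa, map_sub, map_sub, sub_apply, sub_apply, symm (A c b), symm (B c b)]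
    linarith
  -- `m (C a b) c` is symmetric in `a, b` and skew in `b, c`; alternating the two symmetries three
  -- times returns the same expression with the opposite sign.
  have hz : ∀ a b c, m (C a b) c = 0 := by
    intro a b c
    have h1 := hk a b c
    rw [hs a c] at h1
    have h2 := hk c a b
    rw [hs c b] at h2
    have h3 := hk b c a
    rw [hs b a] at h3
    linarith
  have : C = 0 := by
    ext a b
    by_contra hne
    exact (pos _ hne).ne' (hz a b _)
  rwa [hC, sub_eq_zero] at this

namespace IsAlphaBetaData

variable {φ : ℝ → ℝ} {b₀ : ℝ} {m : L →L[ℝ] L →L[ℝ] ℝ} {ξ : L}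

/-- If `φ' = k s (φ - s φ')`, then `φ²` is a polynomial in `s²` of degree one. -/
theorem sq_eq_of_deriv_eq (h : IsAlphaBetaData φ b₀ m ξ) (hξ : ξ ≠ 0) {k : ℝ}
    (hk : ∀ s, s ≠ 0 → |s| < Real.sqrt (m ξ ξ) → deriv φ s = k * s * (φ s - s * deriv φ s))
    {s : ℝ} (hs : |s| ≤ Real.sqrt (m ξ ξ)) : φ s ^ 2 = φ 0 ^ 2 * (1 + k * s ^ 2) := by
  set b := Real.sqrt (m ξ ξ) with hb
  have hbpos : 0 < b := h.sqrt_pos hξ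
  have hmem : ∀ s, |s| < b → s ∈ Set.Ioo (-b₀) b₀ := fun s hs => h.mem_Ioo hs.le
  have h0 : (0 : ℝ) ∈ Set.Ioo (-b₀) b₀ := hmem 0 (by simpa using hbpos)
  -- The equation is assumed only for `s ≠ 0`; at zero it follows by continuity of both sides.
  have k0 : deriv φ 0 = 0 := by
    have c1 : ContinuousAt (deriv φ) 0 := (h.hasDerivAt_deriv h0).continuousAt
    have c2 : ContinuousAt (fun s => k * s * (φ s - s * deriv φ s)) 0 :=
      (continuousAt_const.mul continuousAt_id).mul
        ((h.hasDerivAt h0).continuousAt.sub (continuousAt_id.mul c1))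
    have t1 := c1.tendsto.mono_left (nhdsWithin_le_nhds (s := {0}ᶜ))
    have t2 := c2.tendsto.mono_left (nhdsWithin_le_nhds (s := {0}ᶜ))
    have e : deriv φ =ᶠ[𝓝[≠] 0] fun s => k * s * (φ s - s * deriv φ s) := by
      have : ∀ᶠ s : ℝ in 𝓝[≠] 0, s ∈ Set.Ioo (-b) b :=
        nhdsWithin_le_nhds (isOpen_Ioo.mem_nhds ⟨by linarith, hbpos⟩)
      filter_upwards [this, self_mem_nhdsWithin] with s h1 h2
      exact hk s h2 (abs_lt.2 h1)
    simpa using tendsto_nhds_unique (t1.congr' e) t2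
  have hk' : ∀ s, |s| < b → deriv φ s * (1 + k * s ^ 2) = k * s * φ s := by
    intro s hs
    by_cases hs0 : s = 0
    · simp [hs0, k0]
    · have := hk s hs0 hs
      linear_combination this
  -- At a zero of `1 + k s²` the equation gives `k s φ = 0`; since `φ > 0` this means `k s = 0`, and
  -- then `1 + k s² = 1`.
  have hne : ∀ s, |s| < b → 1 + k * s ^ 2 ≠ 0 := by
    intro s hs h0
    have h1 := hk' s hs
    rw [h0, mul_zero] at h1
    have h2 := h.phi_pos s (hmem s hs)
    have h3 : k * s = 0 := by
      rcases mul_eq_zero.1 h1.symm with h | h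
      · exact h
      · linarith
    have : k * s ^ 2 = 0 := by rw [pow_two, ← mul_assoc, h3, zero_mul]
    linarith
  have hd : ∀ s ∈ Set.Ioo (-b) b, HasDerivAt (fun s => φ s ^ 2 / (1 + k * s ^ 2)) 0 s := by
    intro s hs
    have hs' := abs_lt.2 hs
    have d1 := (h.hasDerivAt (hmem s hs')).pow 2
    have d2 := (((hasDerivAt_id s).pow 2).const_mul k).const_add 1
    refine (d1.div d2 (hne s hs')).congr_deriv ?_
    have := hk' s hs'
    have h1 := hne s hs'
    rw [div_eq_zero_iff]
    left
    simp
    linear_combination 2 * φ s * this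
  have hconst : ∀ s ∈ Set.Ioo (-b) b, φ s ^ 2 = φ 0 ^ 2 * (1 + k * s ^ 2) := by
    intro s hs
    have := isOpen_Ioo.is_const_of_deriv_eq_zero isPreconnected_Ioo
      (fun s hs => (hd s hs).differentiableAt.differentiableWithinAt)
      (fun s hs => (hd s hs).deriv) hs (show (0 : ℝ) ∈ Set.Ioo (-b) b from ⟨by linarith, hbpos⟩)
    have h1 := hne s (abs_lt.2 hs)
    beta_reduce at this
    field_simp at this
    simp at this
    linear_combination this
  -- The endpoints `s = ±b` occur at multiples of `ξ`, so the identity is extended to the closed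
  -- interval by continuity.
  have hsub : Set.Icc (-b) b ⊆ closure (Set.Ioo (-b) b) := by
    rw [closure_Ioo (by linarith)]
  have hcont : ContinuousOn (fun s => φ s ^ 2) (Set.Icc (-b) b) :=
    (h.smooth.continuousOn.mono fun s hs => h.mem_Ioo (_root_.abs_le.2 hs)).pow 2
  exact Set.EqOn.of_subset_closure (s := Set.Ioo (-b) b) (t := Set.Icc (-b) b) hconst hcont
    (by fun_prop) Set.Ioo_subset_Icc_self hsub (_root_.abs_le.1 hs)

/-- Substituting `s = β/α` in `φ² = φ(0)² (1 + k s²)` and multiplying by `α²` leaves `φ(0)² (α² + k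
β²)`. -/
theorem isQuadratic_of_deriv_eq (h : IsAlphaBetaData φ b₀ m ξ) (hξ : ξ ≠ 0) {k : ℝ}
    (hk : ∀ s, s ≠ 0 → |s| < Real.sqrt (m ξ ξ) → deriv φ s = k * s * (φ s - s * deriv φ s)) :
    ∃ q : L →L[ℝ] L →L[ℝ] ℝ, ∀ a, alphaBetaNorm φ m ξ a ^ 2 = q a a := by
  refine ⟨(φ 0 ^ 2) • (m + k • (m ξ).smulRight (m ξ)), fun a => ?_⟩
  by_cases ha : a = 0
  · subst ha
    change _ = φ 0 ^ 2 * (m 0 0 + k * (m ξ 0 * m ξ 0))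
    simp [alphaBetaNorm]
  · have h1 := (h.pos a ha).ne'
    change _ = φ 0 ^ 2 * (m a a + k * (m ξ a * m ξ a))
    unfold alphaBetaNorm
    rw [mul_pow, h.sq_eq_of_deriv_eq hξ hk (h.abs_le ha), div_pow, Real.sq_sqrt (h.nonneg a)]
    field_simp

theorem normalize (h : IsAlphaBetaData φ b₀ m ξ) {w : L} (hw : w ≠ 0) :
    m ((1 / Real.sqrt (m w w)) • w) ((1 / Real.sqrt (m w w)) • w) = 1 := by
  have h1 := (h.pos w hw).ne'
  simp only [map_smul, smul_apply, smul_eq_mul]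
  rw [← mul_assoc, div_mul_div_comm, Real.mul_self_sqrt (h.nonneg w)]
  field_simp

/-- If a torsion-free connection preserves an `(α, β)`-norm, then the norm is Euclidean or `ξ` is
parallel for the metric connection. -/
theorem isQuadratic_or_parallel (h : IsAlphaBetaData φ b₀ m ξ)
    {nab B : L →L[ℝ] L →L[ℝ] L} (htor : ∀ a b, B a b - B b a = nab a b - nab b a)
    (hm : ∀ c a b, m (nab c a) b + m a (nab c b) = 0)
    (hB : ∀ a ≠ 0, ∀ c, fderiv ℝ (fun a => alphaBetaNorm φ m ξ a ^ 2) a (B c a) = 0)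
    {Y V : L} (hY : m Y Y = 1) (hV : m V V = 1) (hYV : m Y V = 0) :
    (∃ q : L →L[ℝ] L →L[ℝ] ℝ, ∀ a, alphaBetaNorm φ m ξ a ^ 2 = q a a) ∨ ∀ c, nab c ξ = 0 := by
  by_cases hξ : ξ = 0
  · right; intro c; rw [hξ, map_zero]
  rw [or_iff_not_imp_left]
  intro hq
  have hnot : ∀ k : ℝ, ¬ ∀ s, s ≠ 0 → |s| < Real.sqrt (m ξ ξ) →
      deriv φ s = k * s * (φ s - s * deriv φ s) :=
    fun k hk => hq (h.isQuadratic_of_deriv_eq hξ hk)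
  have hbb : 0 < m ξ ξ := h.pos ξ hξ
  -- the equation on unit vectors
  have key : ∀ c a, m a a = 1 → (φ (m ξ a) - m ξ a * deriv φ (m ξ a)) * m a (B c a)
      + deriv φ (m ξ a) * m ξ (B c a) = 0 := by
    intro c a ha
    have ha0 : a ≠ 0 := by rintro rfl; simp at ha
    have h1 := hB a ha0 c
    rw [h.fderiv_sq ha0, ha, Real.sqrt_one, div_one] at h1
    have hm := h.quotient_mem ha0
    rw [ha, Real.sqrt_one, div_one] at hm
    have hp := h.phi_pos _ hm
    have : 2 * φ (m ξ a) * ((φ (m ξ a) - m ξ a * deriv φ (m ξ a)) * m a (B c a)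
      + deriv φ (m ξ a) * m ξ (B c a)) = 0 := by linear_combination h1
    rcases mul_eq_zero.1 this with h | h
    · linarith
    · exact h
  -- separate into even and odd parts
  have split : ∀ c w, m w w = 1 → m ξ w = 0 → ∀ s t : ℝ, s ^ 2 / m ξ ξ + t ^ 2 = 1 →
      (φ s - s * deriv φ s) * ((s / m ξ ξ) ^ 2 * m ξ (B c ξ) + t ^ 2 * m w (B c w))
        + deriv φ s * ((s / m ξ ξ) * m ξ (B c ξ)) = 0 ∧
      (φ s - s * deriv φ s) * ((s / m ξ ξ) * t * (m ξ (B c w) + m w (B c ξ)))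
        + deriv φ s * (t * m ξ (B c w)) = 0 := by
    intro c w hw hξw s t hst
    have hwξ : m w ξ = 0 := by rw [h.symm, hξw]
    have gen : ∀ t : ℝ, s ^ 2 / m ξ ξ + t ^ 2 = 1 →
        (φ s - s * deriv φ s) * ((s / m ξ ξ) ^ 2 * m ξ (B c ξ)
          + (s / m ξ ξ) * t * (m ξ (B c w) + m w (B c ξ)) + t ^ 2 * m w (B c w))
        + deriv φ s * ((s / m ξ ξ) * m ξ (B c ξ) + t * m ξ (B c w)) = 0 := by
      intro t hst
      have h1 : m ((s / m ξ ξ) • ξ + t • w) ((s / m ξ ξ) • ξ + t • w) = 1 := by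
        simp only [map_add, map_smul, add_apply, smul_apply, smul_eq_mul, hw, hξw, hwξ]
        have h0 : s / m ξ ξ * m ξ ξ = s := div_mul_cancel₀ _ hbb.ne'
        linear_combination hst + s / m ξ ξ * h0
      have h2 : m ξ ((s / m ξ ξ) • ξ + t • w) = s := by
        simp only [map_add, map_smul, smul_eq_mul, hξw]
        field_simp
        ring
      have h3 := key c _ h1
      rw [h2] at h3
      rw [← h3]
      simp only [map_add, map_smul, add_apply, smul_apply, smul_eq_mul]
      ring
    have g1 := gen t hst
    have g2 := gen (-t) (by rw [neg_sq]; exact hst)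
    constructor
    · linear_combination (g1 + g2) / 2
    · linear_combination (g1 - g2) / 2
  have hsq : ∀ s : ℝ, |s| < Real.sqrt (m ξ ξ) → ∃ t : ℝ, t ≠ 0 ∧ s ^ 2 / m ξ ξ + t ^ 2 = 1 := by
    intro s hs
    have h1 : s ^ 2 < m ξ ξ := by
      have := sq_lt_sq' (by linarith [neg_abs_le s, (abs_lt.1 hs).1]) (lt_of_le_of_lt (le_abs_self s) hs)
      rwa [Real.sq_sqrt hbb.le] at this
    have h2 : 0 < 1 - s ^ 2 / m ξ ξ := by
      rw [sub_pos, div_lt_one hbb]; exact h1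
    exact ⟨_, (Real.sqrt_pos.2 h2).ne', by rw [Real.sq_sqrt h2.le]; ring⟩
  have hl1 : ∀ c w, m w w = 1 → m ξ w = 0 → m ξ (B c w) = 0 := by
    intro c w hw hξw
    by_contra hne
    -- If `m ξ (B c w) ≠ 0`, the odd equation divided by `t` is the excluded differential equation,
    -- with this constant as `k`.
    refine hnot (-(m ξ (B c w) + m w (B c ξ)) / (m ξ ξ * m ξ (B c w))) fun s _ hs => ?_
    obtain ⟨t, ht, hst⟩ := hsq s hs
    have h1 := (split c w hw hξw s t hst).2
    field_simp
    have h2 : t * ((φ s - s * deriv φ s) * (s * (m ξ (B c w) + m w (B c ξ)))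
        + m ξ ξ * deriv φ s * m ξ (B c w)) = 0 := by
      field_simp at h1
      linear_combination h1
    have h3 := (mul_eq_zero.1 h2).resolve_left ht
    linear_combination h3
  have hl2 : ∀ c w, m ξ w = 0 → m ξ (B c w) = 0 := by
    intro c w hξw
    by_cases hw : w = 0
    · simp [hw]
    · have hp := h.sqrt_pos hw
      have := hl1 c ((1 / Real.sqrt (m w w)) • w)
        (h.normalize hw)
        (by rw [map_smul, hξw, smul_zero])
      rw [map_smul, map_smul, smul_eq_mul] at this
      exact (mul_eq_zero.1 this).resolve_left (by positivity)
  -- The plane of `Y` and `V` contains a nonzero vector orthogonal to `ξ`; this is where dimension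
  -- at least two enters.
  obtain ⟨w, hw, hξw⟩ : ∃ w, m w w = 1 ∧ m ξ w = 0 := by
    obtain ⟨w, hw0, hξw⟩ : ∃ w, w ≠ 0 ∧ m ξ w = 0 := by
      by_cases hz : m ξ V = 0
      · exact ⟨V, by rintro rfl; simp at hV, hz⟩
      · refine ⟨m ξ V • Y - m ξ Y • V, ?_, ?_⟩
        · intro h0
          have := congrArg (m Y) h0
          simp only [map_sub, map_smul, smul_eq_mul, hY, hYV, map_zero] at this
          exact hz (by linarith)
        · simp only [map_sub, map_smul, smul_eq_mul]; ring
    have hp := h.sqrt_pos hw0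
    exact ⟨(1 / Real.sqrt (m w w)) • w,
      h.normalize hw0,
      by rw [map_smul, hξw, smul_zero]⟩
  have hl3 : ∀ c, m ξ (B c ξ) = 0 := by
    intro c
    by_contra hne
    have hb0 : (0 : ℝ) ∈ Set.Ioo (-b₀) b₀ := h.mem_Ioo (by simp)
    -- At `s = 0`, `t = 1` the even equation isolates `m w (B c w)`. Once that term is zero, the
    -- even equation for other `s` has the excluded form with `k = -1 / m ξ ξ`.
    have h0 := (split c w hw hξw 0 1 (by simp)).1
    simp only [zero_mul, sub_zero, zero_div, mul_zero, add_zero, one_pow, one_mul] at h0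
    norm_num at h0
    have hwB : m w (B c w) = 0 := by
      rcases h0 with h0 | h0
      · exact absurd h0 (h.phi_pos 0 hb0).ne'
      · exact h0
    refine hnot (-1 / m ξ ξ) fun s hs0 hs => ?_
    obtain ⟨t, ht, hst⟩ := hsq s hs
    have h1 := (split c w hw hξw s t hst).1
    rw [hwB] at h1
    field_simp at h1
    field_simp
    have h2 : s * m ξ (B c ξ) * (s * (φ s - s * deriv φ s) + m ξ ξ * deriv φ s) = 0 := by
      linear_combination h1
    have h3 := (mul_eq_zero.1 h2).resolve_left (mul_ne_zero hs0 hne)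
    linear_combination h3
  have hl : ∀ c a, m ξ (B c a) = 0 := by
    intro c a
    have h1 := hl2 c (a - (m ξ a / m ξ ξ) • ξ)
      (by simp only [map_sub, map_smul, smul_eq_mul]; field_simp; ring)
    simpa [hl3 c] using h1
  -- With `m ξ (B c a) = 0` only the term with the positive factor `φ - s φ'` is left in `key`, so
  -- `B c` is skew for `m`.
  have hQ1 : ∀ c a, m a a = 1 → m a (B c a) = 0 := by
    intro c a ha
    have h1 := key c a ha
    rw [hl, mul_zero, add_zero] at h1
    have ha0 : a ≠ 0 := by rintro rfl; simp at ha
    have hm := h.quotient_mem ha0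
    rw [ha, Real.sqrt_one, div_one] at hm
    exact (mul_eq_zero.1 h1).resolve_left (h.psi_pos hm).ne'
  have hQ : ∀ c a, m a (B c a) = 0 := by
    intro c a
    by_cases ha : a = 0
    · simp [ha]
    · have hp := h.sqrt_pos ha
      have := hQ1 c ((1 / Real.sqrt (m a a)) • a)
        (h.normalize ha)
      simp only [map_smul, smul_apply, smul_eq_mul] at this
      have h3 : 1 / Real.sqrt (m a a) ≠ 0 := by positivity
      exact (mul_eq_zero.1 ((mul_eq_zero.1 this).resolve_left h3)).resolve_left h3
  have hskew : ∀ c a b, m (B c a) b + m a (B c b) = 0 := by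
    intro c a b
    have h1 := hQ c (a + b)
    simp only [map_add, add_apply, hQ] at h1
    rw [h.symm (B c a) b]
    linarith
  have hBn : B = nab := connection_unique h.symm h.pos htor hskew hm
  intro c
  by_contra hne
  -- Skewness turns `m (B c ξ) (B c ξ)` into `-m ξ (B c (B c ξ))`, which is zero by `hl`.
  have h1 := hskew c ξ (B c ξ)
  rw [hl, add_zero] at h1
  rw [hBn] at h1
  exact (h.pos _ hne).ne' h1

end IsAlphaBetaData

end ParallelForm

/-! ### The Levi-Civita connection of the semidirect product and its curvature. -/

section TangentAlgebra

variable {L : Type*} [NormedAddCommGroup L] [NormedSpace ℝ L]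

/-- The curvature of the connection `nab` for the bracket `br`. -/
def algebraCurvature (nab : L →L[ℝ] L →L[ℝ] L) (br : L → L → L) (c a b : L) : L :=
  nab c (nab a b) - nab a (nab c b) - nab (br c a) b

/-- Commutators and linear combinations of skew operators are skew. -/
theorem algebraCurvature_skew {m : L →L[ℝ] L →L[ℝ] ℝ} {nab : L →L[ℝ] L →L[ℝ] L}
    (hm : ∀ c a b, m (nab c a) b + m a (nab c b) = 0) (br : L → L → L) (c a b d : L) :
    m (algebraCurvature nab br c a b) d = - m b (algebraCurvature nab br c a d) := by
  unfold algebraCurvature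
  simp only [map_sub, sub_apply]
  linear_combination hm c (nab a b) d - hm a b (nab c d) - hm a (nab c b) d + hm c b (nab a d)
    - hm (br c a) b d

/-- A left invariant metric on a Lie algebra: the bracket `br`, the adjoint `ads` of its adjoint
representation, and the Levi-Civita connection `nab`. -/
structure IsMetricLieData (m : L →L[ℝ] L →L[ℝ] ℝ) (br ads nab : L →L[ℝ] L →L[ℝ] L) : Prop where
  symm : ∀ a b, m a b = m b a
  pos : ∀ a ≠ 0, 0 < m a a
  skew : ∀ a b, br a b = - br b a
  ads_spec : ∀ a b c, m (ads a b) c = m b (br a c)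
  nab_eq : ∀ a b, nab a b = (1 / 2 : ℝ) • (br a b - ads a b - ads b a)

/-- The bracket of the semidirect product `L ⋉ L`. -/
def tangentBracket (br : L →L[ℝ] L →L[ℝ] L) (p q : L × L) : L × L :=
  (br p.1 q.1, br p.1 q.2 + br p.2 q.1)

/-- The Levi-Civita connection of `L ⋉ L`. -/
def tangentConnection (br ads nab : L →L[ℝ] L →L[ℝ] L) : L × L →L[ℝ] L × L →L[ℝ] L × L :=
  (ContinuousLinearMap.compL ℝ (L × L) L (L × L) (.inl ℝ L L)).comp
      (nab.bilinearComp (.fst ℝ L L) (.fst ℝ L L)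
        + (nab - (1 / 2 : ℝ) • br).bilinearComp (.snd ℝ L L) (.snd ℝ L L))
    + (ContinuousLinearMap.compL ℝ (L × L) L (L × L) (.inr ℝ L L)).comp
      ((nab + (1 / 2 : ℝ) • ads.flip).bilinearComp (.fst ℝ L L) (.snd ℝ L L)
        + (nab + (1 / 2 : ℝ) • ads).bilinearComp (.snd ℝ L L) (.fst ℝ L L))

theorem tangentConnection_apply (br ads nab : L →L[ℝ] L →L[ℝ] L) (p q : L × L) :
    tangentConnection br ads nab p q
      = (nab p.1 q.1 + (nab p.2 q.2 - (1 / 2 : ℝ) • br p.2 q.2),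
        nab p.1 q.2 + (1 / 2 : ℝ) • ads q.2 p.1 + (nab p.2 q.1 + (1 / 2 : ℝ) • ads p.2 q.1)) := by
  change (nab p.1 q.1 + (nab p.2 q.2 - (1 / 2 : ℝ) • br p.2 q.2), (0 : L))
    + ((0 : L), nab p.1 q.2 + (1 / 2 : ℝ) • ads q.2 p.1
      + (nab p.2 q.1 + (1 / 2 : ℝ) • ads p.2 q.1)) = _
  rw [Prod.mk_add_mk, add_zero, zero_add]

/-- The orthogonal sum metric on `L × L`. -/
def tangentMetric (m : L →L[ℝ] L →L[ℝ] ℝ) : L × L →L[ℝ] L × L →L[ℝ] ℝ :=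
  m.bilinearComp (.fst ℝ L L) (.fst ℝ L L) + m.bilinearComp (.snd ℝ L L) (.snd ℝ L L)

theorem tangentMetric_apply (m : L →L[ℝ] L →L[ℝ] ℝ) (p q : L × L) :
    tangentMetric m p q = m p.1 q.1 + m p.2 q.2 := rfl

namespace IsMetricLieData

variable {m : L →L[ℝ] L →L[ℝ] ℝ} {br ads nab : L →L[ℝ] L →L[ℝ] L}

theorem torsion (h : IsMetricLieData m br ads nab) (a b : L) : nab a b - nab b a = br a b := by
  rw [h.nab_eq, h.nab_eq, h.skew b a]
  module

theorem nab_skew (h : IsMetricLieData m br ads nab) (c a b : L) :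
    m (nab c a) b + m a (nab c b) = 0 := by
  rw [h.symm a, h.nab_eq, h.nab_eq]
  simp only [map_smul, map_sub, smul_apply, sub_apply, smul_eq_mul, h.ads_spec]
  rw [h.symm (br c a) b, h.symm (br c b) a, h.skew b a, map_neg]
  ring

/-- Together with `tangent_skew` this characterizes `tangentConnection` as the Levi-Civita
connection of the sum metric. -/
theorem tangent_torsion (h : IsMetricLieData m br ads nab) (p q : L × L) :
    tangentConnection br ads nab p q - tangentConnection br ads nab q p
      = tangentBracket br p q := by
  rw [tangentConnection_apply, tangentConnection_apply]
  unfold tangentBracket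
  ext
  · simp only [Prod.fst_sub]
    rw [← h.torsion p.1 q.1]
    have h1 := h.torsion p.2 q.2
    have h2 := h.skew q.2 p.2
    rw [h2, ← h1]
    module
  · simp only [Prod.snd_sub]
    rw [← h.torsion p.1 q.2, ← h.torsion p.2 q.1]
    module

theorem tangent_skew (h : IsMetricLieData m br ads nab) (c a b : L × L) :
    tangentMetric m (tangentConnection br ads nab c a) b
      + tangentMetric m a (tangentConnection br ads nab c b) = 0 := by
  simp only [tangentConnection_apply, tangentMetric_apply, map_add, map_sub, map_smul, add_apply,
    sub_apply, smul_apply, smul_eq_mul, h.ads_spec, h.symm a.2 (ads _ _)]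
  have h1 := h.nab_skew c.1 a.1 b.1
  have h2 := h.nab_skew c.1 a.2 b.2
  have h3 := h.nab_skew c.2 a.1 b.2
  have h4 := h.nab_skew c.2 a.2 b.1
  have e1 : m c.1 (br a.2 b.2) + m c.1 (br b.2 a.2) = 0 := by
    rw [h.skew b.2 a.2, map_neg]; ring
  rw [h.symm (br c.2 a.2) b.1]
  linear_combination h1 + h2 + h3 + h4 + 1 / 2 * e1

/-- The form dual to a parallel vector is closed: `m(ξ, [a, z]) = m(ξ, ∇_a z) - m(ξ, ∇_z a)`, and
both terms vanish by skewness. -/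
theorem ads_eq_zero (h : IsMetricLieData m br ads nab) {ξ : L} (hξ : ∀ c, nab c ξ = 0) (a : L) :
    ads a ξ = 0 := by
  by_contra hne
  apply (h.pos _ hne).ne'
  rw [h.ads_spec, ← h.torsion, map_sub]
  have h1 := h.nab_skew a ξ (ads a ξ)
  have h2 := h.nab_skew (ads a ξ) ξ a
  rw [hξ, map_zero, zero_apply, zero_add] at h1 h2
  rw [h1, h2, sub_zero]

/-- Besides `nab _ ξ`, the connection of the semidirect product contributes only `½ ads p.2 ξ`,
which `ads_eq_zero` removes. -/
theorem tangent_parallel (h : IsMetricLieData m br ads nab) {ξ : L} (hξ : ∀ c, nab c ξ = 0)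
    (p : L × L) : tangentConnection br ads nab p (ξ, 0) = 0 := by
  rw [tangentConnection_apply]
  simp [hξ, h.ads_eq_zero hξ]

theorem tangentMetric_symm (h : IsMetricLieData m br ads nab) (p q : L × L) :
    tangentMetric m p q = tangentMetric m q p := by
  rw [tangentMetric_apply, tangentMetric_apply, h.symm, h.symm p.2]

theorem tangentMetric_pos (h : IsMetricLieData m br ads nab) (p : L × L) (hp : p ≠ 0) :
    0 < tangentMetric m p p := by
  have nn : ∀ a, 0 ≤ m a a := fun a => by
    by_cases ha : a = 0
    · simp [ha]
    · exact (h.pos a ha).le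
  rw [tangentMetric_apply]
  by_cases h1 : p.1 = 0
  · have h2 : p.2 ≠ 0 := fun h2 => hp (Prod.ext h1 h2)
    have := h.pos _ h2
    have := nn p.1
    linarith
  · have := h.pos _ h1
    have := nn p.2
    linarith

/-- On the first factor `tangentConnection` restricts to `nab`, with no component in the second
factor. -/
theorem curvature_complete_complete (V Y : L) :
    tangentMetric m (algebraCurvature (tangentConnection br ads nab) (tangentBracket br)
        (V, 0) (Y, 0) (Y, 0)) (V, 0)
      = m (algebraCurvature nab (fun a b => br a b) V Y Y) V := by
  unfold algebraCurvature tangentBracket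
  simp [tangentConnection_apply, tangentMetric_apply]

/-- A direct expansion. Every `ads` in the outer slot is moved across by its defining property, and
skewness of `nab` brings the remaining terms to the stated form. -/
theorem curvature_vertical_complete (h : IsMetricLieData m br ads nab) (V Y : L) :
    tangentMetric m (algebraCurvature (tangentConnection br ads nab) (tangentBracket br)
        (0, V) (Y, 0) (Y, 0)) (0, V)
      = m (algebraCurvature nab (fun a b => br a b) V Y Y) V
        + 1 / 2 * m (br V (nab Y V)) Y - 1 / 2 * m (nab V (ads V Y)) Y
        + 1 / 4 * m (br V (ads V Y)) Y + 1 / 2 * m (br (br Y V) V) Y := by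
  unfold algebraCurvature tangentBracket
  simp [tangentConnection_apply, tangentMetric_apply, h.ads_spec]
  have hVV : br V V = 0 := by
    have := h.skew V V
    rwa [eq_neg_iff_add_eq_zero, ← two_smul ℝ, smul_eq_zero_iff_right two_ne_zero] at this
  have e1 := h.nab_skew Y (ads V Y) V
  have e2 := h.nab_skew V (ads V Y) Y
  rw [h.ads_spec] at e1 e2
  have e3 := h.symm (br V (nab Y V)) Y
  have e4 := h.symm (br V (ads V Y)) Y
  have e5 := h.symm (br (br Y V) V) Y
  have e9 : m Y (br (nab V Y) V) = - m Y (br V (nab V Y)) := by rw [h.skew, map_neg]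
  have e10 : m Y (br (ads V Y) V) = - m Y (br V (ads V Y)) := by rw [h.skew, map_neg]
  have e11 : m Y (br (br V Y) V) = - m Y (br (br Y V) V) := by
    rw [h.skew (br V Y) V, h.skew (br Y V) V, h.skew V Y]
    simp only [map_neg, neg_neg]
  rw [e3, e4, e5, e9, e10, e11]
  simp only [hVV, map_zero]
  linear_combination 1 / 2 * e2 - 1 / 2 * e1

/-- The second factor is abelian, so the term `nab (br V Y) Y` of the curvature of `nab` has no
counterpart and must be added back. The quadratic terms in `br V Y` add up to `1/2 - 1/4`. -/
theorem curvature_vertical_vertical (h : IsMetricLieData m br ads nab) (V Y : L) :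
    tangentMetric m (algebraCurvature (tangentConnection br ads nab) (tangentBracket br)
        (0, V) (0, Y) (0, Y)) (0, V)
      = m (algebraCurvature nab (fun a b => br a b) V Y Y) V
        + m (nab (br V Y) Y) V + 1 / 4 * m (br V Y) (br V Y) := by
  have hVV : ∀ V, br V V = 0 := by
    intro V
    have := h.skew V V
    rwa [eq_neg_iff_add_eq_zero, ← two_smul ℝ, smul_eq_zero_iff_right two_ne_zero] at this
  unfold algebraCurvature tangentBracket
  simp [tangentConnection_apply, tangentMetric_apply, h.ads_spec, hVV]
  have e1 := h.nab_skew Y (br V Y) V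
  have e2 := h.torsion V Y
  have e3 : m (nab V Y) (br V Y) - m (nab Y V) (br V Y) = m (br V Y) (br V Y) := by
    rw [← sub_apply, ← map_sub, e2]
  have e4 := h.symm (br V Y) (nab Y V)
  rw [h.skew Y V]
  simp only [map_neg]
  linear_combination 1 / 2 * e1 + 1 / 2 * e3 - 1 / 2 * e4

/-- Antisymmetry in the first pair and skewness in the second suffice here; the Bianchi identity is
not needed. -/
theorem curvature_swap {m : L →L[ℝ] L →L[ℝ] ℝ} {nab : L →L[ℝ] L →L[ℝ] L} {br : L → L → L}
    (hm : ∀ c a b, m (nab c a) b + m a (nab c b) = 0) (symm : ∀ a b, m a b = m b a)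
    (hbr : ∀ a b, br a b = - br b a) (V Y : L) :
    m (algebraCurvature nab br V Y Y) V = m (algebraCurvature nab br Y V V) Y := by
  have e : algebraCurvature nab br V Y V = - algebraCurvature nab br Y V V := by
    unfold algebraCurvature
    rw [hbr V Y, map_neg, neg_apply]
    abel
  rw [algebraCurvature_skew hm, e, map_neg, neg_neg, symm]

/-- The mixed plane again, with the roles of `V` and `Y` exchanged by `curvature_swap`. -/
theorem curvature_complete_vertical (h : IsMetricLieData m br ads nab) (V Y : L) :
    tangentMetric m (algebraCurvature (tangentConnection br ads nab) (tangentBracket br)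
        (V, 0) (0, Y) (0, Y)) (V, 0)
      = m (algebraCurvature nab (fun a b => br a b) V Y Y) V
        + 1 / 2 * m (br Y (nab V Y)) V - 1 / 2 * m (nab Y (ads Y V)) V
        + 1 / 4 * m (br Y (ads Y V)) V + 1 / 2 * m (br (br V Y) Y) V := by
  have hb : ∀ p q, tangentBracket br p q = - tangentBracket br q p := by
    intro p q
    unfold tangentBracket
    rw [h.skew p.1 q.1, h.skew p.1 q.2, h.skew p.2 q.1, Prod.neg_mk, neg_add, add_comm]
  rw [curvature_swap h.tangent_skew h.tangentMetric_symm hb, h.curvature_vertical_complete,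
    curvature_swap h.nab_skew h.symm h.skew]

/-- The flag curvature of the `(α, β)`-norm on `L ⋉ L`. -/
theorem tangent_flag_eq (h : IsMetricLieData m br ads nab) {φ : ℝ → ℝ} {b₀ : ℝ} {ξ : L}
    (hd : IsAlphaBetaData φ b₀ (tangentMetric m) (ξ, 0)) (hξ : ∀ c, nab c ξ = 0)
    {a c : L × L} (haa : tangentMetric m a a = 1) (hcc : tangentMetric m c c = 1)
    (hac : tangentMetric m a c = 0) :
    normTensor (alphaBetaNorm φ (tangentMetric m) (ξ, 0)) a
          (algebraCurvature (tangentConnection br ads nab) (tangentBracket br) c a a) c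
        / (normTensor (alphaBetaNorm φ (tangentMetric m) (ξ, 0)) a a a
            * normTensor (alphaBetaNorm φ (tangentMetric m) (ξ, 0)) a c c
          - normTensor (alphaBetaNorm φ (tangentMetric m) (ξ, 0)) a c a ^ 2)
      = 1 / (φ (m ξ a.1) ^ 2 * (1 + m ξ c.1 ^ 2 * curvatureD φ (m ξ a.1)))
        * tangentMetric m (algebraCurvature (tangentConnection br ads nab) (tangentBracket br)
            c a a) c := by
  have e : ∀ b, tangentMetric m (ξ, 0) b = m ξ b.1 := fun b => by simp [tangentMetric_apply]
  have h1 := algebraCurvature_skew h.tangent_skew (tangentBracket br) c a (ξ, 0) a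
  have h2 := algebraCurvature_skew h.tangent_skew (tangentBracket br) c a a a
  -- The curvature annihilates the parallel vector, so by skewness `R(c, a)a` is orthogonal to it,
  -- as `flag_eq` requires.
  have h3 : algebraCurvature (tangentConnection br ads nab) (tangentBracket br) c a (ξ, 0) = 0 := by
    unfold algebraCurvature
    simp [h.tangent_parallel hξ]
  rw [h3, map_zero, zero_apply] at h1
  rw [h.tangentMetric_symm _ a] at h2
  rw [hd.flag_eq haa hcc hac (by linarith) (by linarith), e, e]

end IsMetricLieData

end TangentAlgebra

/-! ### Left invariant fields as an invariant frame in a chart. -/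

section LieGroupFrame

variable {E : Type*} [NormedAddCommGroup E] [NormedSpace ℝ E] [FiniteDimensional ℝ E]
  {G : Type*} [TopologicalSpace G] [ChartedSpace E G] [Group G] [LieGroup 𝓘(ℝ, E) ∞ G]

-- The field is the tangent map of multiplication applied to the zero vector at `g` and to `v` at
-- `1`, hence a composition of smooth maps.
omit [FiniteDimensional ℝ E] in
theorem contMDiff_infty_mulInvariantVectorField (v : GroupLieAlgebra 𝓘(ℝ, E) G) :
    ContMDiff 𝓘(ℝ, E) 𝓘(ℝ, E).tangent ∞
      (fun (g : G) ↦ (mulInvariantVectorField v g : TangentBundle 𝓘(ℝ, E) G)) := by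
  let I := 𝓘(ℝ, E)
  let fg : G → TangentBundle I G := fun g ↦ TotalSpace.mk' E g 0
  have sfg : ContMDiff I I.tangent ∞ fg := contMDiff_zeroSection _ _
  let fv : G → TangentBundle I G := fun _ ↦ TotalSpace.mk' E 1 v
  have sfv : ContMDiff I I.tangent ∞ fv := contMDiff_const
  let F₁ : G → (TangentBundle I G × TangentBundle I G) := fun g ↦ (fg g, fv g)
  have S₁ : ContMDiff I (I.tangent.prod I.tangent) ∞ F₁ := sfg.prodMk sfv
  let F₂ : (TangentBundle I G × TangentBundle I G) → TangentBundle (I.prod I) (G × G) :=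
    (equivTangentBundleProd I G I G).symm
  have S₂ : ContMDiff (I.tangent.prod I.tangent) (I.prod I).tangent ∞ F₂ :=
    contMDiff_equivTangentBundleProd_symm
  let F₃ : TangentBundle (I.prod I) (G × G) → TangentBundle I G :=
    tangentMap (I.prod I) I (fun (p : G × G) ↦ p.1 * p.2)
  have S₃ : ContMDiff (I.prod I).tangent I.tangent ∞ F₃ := by
    apply ContMDiff.contMDiff_tangentMap _ (m := ∞) le_rfl
    exact contMDiff_mul I ∞
  let S := (S₃.comp S₂).comp S₁
  convert! S with g
  · simp [F₁, F₂, F₃, fg, fv]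
  · simp only [Function.comp_apply, tangentMap, F₃, F₂, F₁, fg, fv]
    rw [mfderiv_prod_eq_add_apply ((contMDiff_mul I ∞).mdifferentiableAt (by simp))]
    simp +instances [mulInvariantVectorField, I]
    refine (zero_add _).symm.trans ?_
    congr 1
    exact (map_zero _).symm

/-- The bracket of the Lie algebra, as a continuous bilinear map on the model space. -/
def lieBracketCLM (G : Type*) [TopologicalSpace G] [ChartedSpace E G] [Group G]
    [LieGroup 𝓘(ℝ, E) ∞ G] : E →L[ℝ] E →L[ℝ] E :=
  let B : GroupLieAlgebra 𝓘(ℝ, E) G →ₗ[ℝ] GroupLieAlgebra 𝓘(ℝ, E) G →ₗ[ℝ]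
      GroupLieAlgebra 𝓘(ℝ, E) G :=
    LinearMap.mk₂ ℝ (fun a b => ⁅a, b⁆) add_lie smul_lie lie_add lie_smul
  let B' : E →ₗ[ℝ] E →ₗ[ℝ] E := B
  LinearMap.toContinuousLinearMap (LinearMap.toContinuousLinearMap.toLinearMap ∘ₗ B')

/-- The derivative of the inverse of the chart at `q`, on the model space. -/
def chartSymmDeriv {M : Type*} [TopologicalSpace M] [ChartedSpace E M] (q : M) (x : E) :
    E →L[ℝ] E :=
  mfderiv 𝓘(ℝ, E) 𝓘(ℝ, E) (extChartAt 𝓘(ℝ, E) q).symm x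

/-- The derivative at `1` of the left translation by `g`, on the model space. -/
def leftMulDeriv (g : G) : E →L[ℝ] E :=
  mfderiv 𝓘(ℝ, E) 𝓘(ℝ, E) (fun z : G => g * z) 1

/-- The frame of left invariant vector fields in the chart at `q`. -/
def chartFrame (q : G) (x : E) : E →L[ℝ] E :=
  (chartSymmDeriv q x).inverse.comp (leftMulDeriv ((extChartAt 𝓘(ℝ, E) q).symm x))

omit [FiniteDimensional ℝ E] in
theorem isInvertible_mfderiv_extChartAt_symm {M : Type*} [TopologicalSpace M] [ChartedSpace E M]
    [IsManifold 𝓘(ℝ, E) 1 M] {q : M} {x : E}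
    (hx : x ∈ (extChartAt 𝓘(ℝ, E) q).target) :
    (mfderiv 𝓘(ℝ, E) 𝓘(ℝ, E) (extChartAt 𝓘(ℝ, E) q).symm x).IsInvertible := by
  have := isInvertible_mfderivWithin_extChartAt_symm hx
  rwa [modelWithCornersSelf_coe, Set.range_id, mfderivWithin_univ] at this

omit [FiniteDimensional ℝ E] in
theorem mdifferentiableAt_extChartAt_symm {M : Type*} [TopologicalSpace M] [ChartedSpace E M]
    [IsManifold 𝓘(ℝ, E) 1 M] {q : M} {x : E}
    (hx : x ∈ (extChartAt 𝓘(ℝ, E) q).target) :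
    MDifferentiableAt 𝓘(ℝ, E) 𝓘(ℝ, E) (extChartAt 𝓘(ℝ, E) q).symm x := by
  have := mdifferentiableWithinAt_extChartAt_symm (I := 𝓘(ℝ, E)) hx
  rwa [modelWithCornersSelf_coe, Set.range_id, mdifferentiableWithinAt_univ] at this

omit [FiniteDimensional ℝ E] in
theorem contMDiffAt_extChartAt_symm {M : Type*} [TopologicalSpace M] [ChartedSpace E M]
    [IsManifold 𝓘(ℝ, E) ∞ M] {q : M} {x : E}
    (hx : x ∈ (extChartAt 𝓘(ℝ, E) q).target) :
    ContMDiffAt 𝓘(ℝ, E) 𝓘(ℝ, E) ∞ (extChartAt 𝓘(ℝ, E) q).symm x :=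
  (contMDiffOn_extChartAt_symm q).contMDiffAt ((isOpen_extChartAt_target q).mem_nhds hx)

omit [FiniteDimensional ℝ E] in
theorem isInvertible_mfderiv_mul_left (g h : G) :
    (mfderiv 𝓘(ℝ, E) 𝓘(ℝ, E) (fun z : G => g * z) h).IsInvertible := by
  have d : ∀ g h : G, MDifferentiableAt 𝓘(ℝ, E) 𝓘(ℝ, E) (fun z : G => g * z) h := fun g h =>
    (contMDiff_mul_left (I := 𝓘(ℝ, E)) (n := ∞)).contMDiffAt.mdifferentiableAt (by simp)
  have A : ∀ g h : G, (mfderiv 𝓘(ℝ, E) 𝓘(ℝ, E) (fun z : G => g⁻¹ * z) (g * h)).comp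
      (mfderiv 𝓘(ℝ, E) 𝓘(ℝ, E) (fun z : G => g * z) h) = ContinuousLinearMap.id ℝ _ := by
    intro g h
    rw [← mfderiv_comp (I' := 𝓘(ℝ, E)) _ (d _ _) (d _ _)]
    have : (fun z : G => g⁻¹ * z) ∘ (fun z : G => g * z) = id := by ext x; simp
    rw [this, mfderiv_id]
  have A2 := A g⁻¹ (g * h)
  rw [inv_inv, inv_mul_cancel_left] at A2
  exact ContinuousLinearMap.IsInvertible.of_inverse A2 (A g h)

theorem contDiffAt_fieldInChart_mulInvariantVectorField (q : G) {x : E}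
    (hx : x ∈ (extChartAt 𝓘(ℝ, E) q).target) (a : GroupLieAlgebra 𝓘(ℝ, E) G) :
    ContDiffAt ℝ ∞ (fieldInChart 𝓘(ℝ, E) (mulInvariantVectorField a) q) x := by
  have : IsManifold 𝓘(ℝ, E) 1 G := .of_le (n := ∞) (by norm_cast)
  have := ContMDiffAt.mpullback_vectorField_preimage (m := ∞) (n := ∞)
    (contMDiff_infty_mulInvariantVectorField a).contMDiffAt (contMDiffAt_extChartAt_symm hx)
    (isInvertible_mfderiv_extChartAt_symm hx) (by norm_cast)
  exact contMDiffAt_vectorSpace_iff_contDiffAt.1 this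

omit [FiniteDimensional ℝ E] in
theorem isInvertible_chartFrame (q : G) {x : E} (hx : x ∈ (extChartAt 𝓘(ℝ, E) q).target) :
    (chartFrame q x).IsInvertible := by
  have : IsManifold 𝓘(ℝ, E) 1 G := .of_le (n := ∞) (by norm_cast)
  have h1 : (chartSymmDeriv q x).IsInvertible := isInvertible_mfderiv_extChartAt_symm hx
  have h2 : (leftMulDeriv (E := E) ((extChartAt 𝓘(ℝ, E) q).symm x)).IsInvertible :=
    isInvertible_mfderiv_mul_left (E := E) ((extChartAt 𝓘(ℝ, E) q).symm x) 1
  obtain ⟨A, hA⟩ := h1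
  obtain ⟨T, hT⟩ := h2
  refine ⟨T.trans A.symm, ?_⟩
  unfold chartFrame
  rw [← hA, ← hT, ContinuousLinearMap.inverse_equiv]
  rfl

/-- The chart pulls back Lie brackets to Lie brackets, and in the model space the bracket is the
difference of directional derivatives. -/
theorem isInvariantFrame_chartFrame (q : G) :
    IsInvariantFrame (chartFrame q) (fun a b => lieBracketCLM G a b)
      (extChartAt 𝓘(ℝ, E) q).target := by
  have : IsManifold 𝓘(ℝ, E) 1 G := .of_le (n := ∞) (by norm_cast)
  have hs : ContDiffOn ℝ ∞ (chartFrame q) (extChartAt 𝓘(ℝ, E) q).target := by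
    rw [contDiffOn_clm_apply]
    intro a x hx
    exact (contDiffAt_fieldInChart_mulInvariantVectorField q hx a).contDiffWithinAt
  have ho := isOpen_extChartAt_target (I := 𝓘(ℝ, E)) q
  refine ⟨ho, hs, fun x hx => isInvertible_chartFrame q hx,
    fun x hx (a b : GroupLieAlgebra 𝓘(ℝ, E) G) => ?_⟩
  have hd := (hs.contDiffAt (ho.mem_nhds hx)).differentiableAt (by simp)
  have h1 := mpullback_mlieBracket (I := 𝓘(ℝ, E)) (I' := 𝓘(ℝ, E)) (n := ∞)
    (f := (extChartAt 𝓘(ℝ, E) q).symm) (x₀ := x)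
    (mdifferentiableAt_mulInvariantVectorField a) (mdifferentiableAt_mulInvariantVectorField b)
    (contMDiffAt_extChartAt_symm hx) (by simp; norm_cast)
  rw [← mulInvariantVector_mlieBracket a b] at h1
  have e : ∀ V W : (x : E) → TangentSpace 𝓘(ℝ, E) x, mlieBracket 𝓘(ℝ, E) V W x = lieBracket ℝ V W x := by
    intro V W
    rw [← mlieBracketWithin_univ, mlieBracketWithin_eq_lieBracketWithin]
    exact congrFun (lieBracketWithin_univ (𝕜 := ℝ) (E := E)) x
  have h2 : chartFrame q x (lieBracketCLM (E := E) G a b) = lieBracket ℝ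
    (fieldInChart 𝓘(ℝ, E) (mulInvariantVectorField a) q)
    (fieldInChart 𝓘(ℝ, E) (mulInvariantVectorField b) q) x := h1.trans (e _ _)
  rw [h2]
  exact (congrArg₂ (fun s t : E => s - t)
    (fderiv_apply_const (E := E) (V := E) (W := E) hd b (chartFrame q x a))
    (fderiv_apply_const (E := E) (V := E) (W := E) hd a (chartFrame q x b))).symm

end LieGroupFrame

/-! ### Christoffel symbols of a metric that is constant in an invariant frame. -/

section LeviCivita

variable {E : Type*} [NormedAddCommGroup E] [NormedSpace ℝ E] [FiniteDimensional ℝ E]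
  {L : Type*} [NormedAddCommGroup L] [NormedSpace ℝ L]

/-- The adjoint of the adjoint representation of `br` with respect to `m`. -/
def adjointCLM (m : L →L[ℝ] L →L[ℝ] ℝ) (br : L →L[ℝ] L →L[ℝ] L) : L →L[ℝ] L →L[ℝ] L :=
  (ContinuousLinearMap.compL ℝ L (L →L[ℝ] ℝ) L m.inverse).comp
    ((ContinuousLinearMap.compL ℝ L L ℝ).bilinearComp m br).flip

/-- The Levi-Civita connection of `m`, by Koszul's formula. -/
def koszulCLM (m : L →L[ℝ] L →L[ℝ] ℝ) (br : L →L[ℝ] L →L[ℝ] L) : L →L[ℝ] L →L[ℝ] L :=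
  (1 / 2 : ℝ) • (br - adjointCLM m br - (adjointCLM m br).flip)

theorem isMetricLieData [FiniteDimensional ℝ L] {m : L →L[ℝ] L →L[ℝ] ℝ} {br : L →L[ℝ] L →L[ℝ] L}
    (symm : ∀ a b, m a b = m b a) (pos : ∀ a ≠ 0, 0 < m a a) (skew : ∀ a b, br a b = - br b a) :
    IsMetricLieData m br (adjointCLM m br) (koszulCLM m br) := by
  refine ⟨symm, pos, skew, fun a b c => ?_, fun a b => rfl⟩
  have h : m (adjointCLM m br a b) = (m b).comp (br a) :=
    ((isInvertible_of_posDef pos).inverse_apply_eq.1 rfl).symm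
  rw [h]
  rfl

/-- The frame connection of `nab` is torsion free and compatible with `g`, so the coordinate Koszul
formula returns it. -/
theorem christoffel_eq_frameConnection [CompleteSpace L] {Φ : E → L →L[ℝ] E} {U : Set E}
    {m : L →L[ℝ] L →L[ℝ] ℝ} {br ads nab : L →L[ℝ] L →L[ℝ] L} (hm : IsMetricLieData m br ads nab)
    (h : IsInvariantFrame Φ (fun a b => br a b) U) {g : E → E →L[ℝ] E →L[ℝ] ℝ}
    (hg : ∀ x ∈ U, ∀ a b, g x (Φ x a) (Φ x b) = m a b) {x : E} (hx : x ∈ U) (u v : E) :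
    christoffel g x u v = frameConnection Φ nab x u v := by
  set Γ := frameConnection Φ nab x with hΓ
  have hgu : ∀ x ∈ U, ∀ u v, g x u v = m ((Φ x).inverse u) ((Φ x).inverse v) := by
    intro x hx u v
    rw [← hg x hx, h.apply_inverse hx, h.apply_inverse hx]
  have symm : ∀ u v, g x u v = g x v u := fun u v => by rw [hgu x hx, hgu x hx, hm.symm]
  have inv : (g x).IsInvertible := by
    refine isInvertible_of_posDef fun u hu => ?_
    rw [hgu x hx]
    exact hm.pos _ (h.inverse_ne_zero hx hu)
  have hd : DifferentiableAt ℝ g x := by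
    have : ContDiffOn ℝ 1 g U := by
      rw [contDiffOn_clm_apply]
      intro u
      rw [contDiffOn_clm_apply]
      intro v
      have h1 : ContDiffOn ℝ 1 (fun x => m ((Φ x).inverse u) ((Φ x).inverse v)) U := by
        intro x hx
        have h2 : ContDiffAt ℝ 1 (fun x => (Φ x).inverse) x :=
          (h.contDiffAt_inverse hx).of_le (by norm_cast)
        exact ((m.contDiff.contDiffAt.comp x (h2.clm_apply contDiffAt_const)).clm_apply
          (h2.clm_apply contDiffAt_const)).contDiffWithinAt
      exact h1.congr fun x hx => hgu x hx u v
    exact (this.contDiffAt (h.isOpen.mem_nhds hx)).differentiableAt (by simp)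
  -- The derivative of the constant function `x ↦ g x (Φ x a) (Φ x b)`.
  have hD : ∀ u a b, fderiv ℝ g x u (Φ x a) (Φ x b) + g x (fderiv ℝ Φ x u a) (Φ x b)
      + g x (Φ x a) (fderiv ℝ Φ x u b) = 0 := by
    intro u a b
    have dΦ := (h.differentiableAt hx).hasFDerivAt
    have d := (hd.hasFDerivAt.clm_apply (dΦ.clm_apply (hasFDerivAt_const a x))).clm_apply
      (dΦ.clm_apply (hasFDerivAt_const b x))
    have e : (fun x => g x (Φ x a) (Φ x b)) =ᶠ[𝓝 x] fun _ => m a b := by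
      filter_upwards [h.isOpen.mem_nhds hx] with z hz using hg z hz a b
    have key := e.fderiv_eq (𝕜 := ℝ)
    rw [d.fderiv, fderiv_fun_const] at key
    have key := congrArg (fun A : E →L[ℝ] ℝ => A u) key
    simp at key
    linarith
  have compat : ∀ u v w, fderiv ℝ g x u v w = g x (Γ u v) w + g x v (Γ u w) := by
    intro u v w
    obtain ⟨a, rfl⟩ := h.exists_eq hx v
    obtain ⟨b, rfl⟩ := h.exists_eq hx w
    rw [hΓ, h.frameConnection_apply_right hx, h.frameConnection_apply_right hx]
    simp only [map_sub, sub_apply, hg x hx]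
    have := hD u a b
    have := hm.nab_skew ((Φ x).inverse u) a b
    linarith
  have comm : ∀ u v, Γ u v = Γ v u := h.frameConnection_comm hm.torsion hx
  unfold christoffel
  rw [inv.inverse_apply_eq]
  ext w
  change (1 / 2 : ℝ) * (fderiv ℝ g x u v w + fderiv ℝ g x v u w - fderiv ℝ g x w u v)
    = g x (Γ u v) w
  rw [compat, compat, compat, comm v u, comm w u, comm w v, symm (Γ u w) v]
  ring

end LeviCivita

/-! ### Levi-Civita connection of a left invariant metric on the group. -/

section LieGroupMetric

variable {E : Type*} [NormedAddCommGroup E] [NormedSpace ℝ E] [FiniteDimensional ℝ E]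
  {G : Type*} [TopologicalSpace G] [ChartedSpace E G] [Group G] [LieGroup 𝓘(ℝ, E) ∞ G]
  {g : ∀ q : G, TangentSpace 𝓘(ℝ, E) q →L[ℝ] TangentSpace 𝓘(ℝ, E) q →L[ℝ] ℝ}

/-- The inner product of a metric at the unit, on the model space. -/
def metricAtOne (g : ∀ q : G, TangentSpace 𝓘(ℝ, E) q →L[ℝ] TangentSpace 𝓘(ℝ, E) q →L[ℝ] ℝ) :
    E →L[ℝ] E →L[ℝ] ℝ := g 1

omit [FiniteDimensional ℝ E] [LieGroup 𝓘(ℝ, E) ∞ G] in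
theorem IsLeftInvariant.apply_leftMulDeriv (hg : IsLeftInvariant 𝓘(ℝ, E) g) (q : G) (a b : E) :
    (g q : E →L[ℝ] E →L[ℝ] ℝ) (leftMulDeriv (E := E) q a) (leftMulDeriv (E := E) q b)
      = metricAtOne g a b := by
  have h := hg q 1 a b
  -- Invariance is stated at `q * 1`; all fibres being the model space, the base point can be
  -- replaced by `q`.
  have key : ∀ r, r = q → ∀ u v : E, (g r : E →L[ℝ] E →L[ℝ] ℝ) u v
      = (g q : E →L[ℝ] E →L[ℝ] ℝ) u v := by
    rintro r rfl u v; rfl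
  exact (key _ (mul_one q) _ _).symm.trans h

-- A tangent vector at a point equals its coordinates in the preferred chart there, so the
-- derivative of the inverse chart is that of the transition to the preferred chart of the image
-- point.
omit [FiniteDimensional ℝ E] in
theorem chartSymmDeriv_eq_fderiv {M : Type*} [TopologicalSpace M] [ChartedSpace E M]
    [IsManifold 𝓘(ℝ, E) 1 M] {q : M} {x : E} (hx : x ∈ (extChartAt 𝓘(ℝ, E) q).target) :
    chartSymmDeriv q x = fderiv ℝ (extChartAt 𝓘(ℝ, E) ((extChartAt 𝓘(ℝ, E) q).symm x)
      ∘ (extChartAt 𝓘(ℝ, E) q).symm) x := by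
  have := (mdifferentiableAt_extChartAt_symm hx).mfderiv
  unfold chartSymmDeriv
  rw [this, modelWithCornersSelf_coe, Set.range_id, fderivWithin_univ]
  rfl

omit [FiniteDimensional ℝ E] in
theorem chartSymmDeriv_self {M : Type*} [TopologicalSpace M] [ChartedSpace E M]
    [IsManifold 𝓘(ℝ, E) 1 M] (q : M) :
    chartSymmDeriv q (extChartAt 𝓘(ℝ, E) q q) = .id ℝ E := by
  rw [chartSymmDeriv_eq_fderiv (mem_extChartAt_target q), extChartAt_to_inv]
  have : extChartAt 𝓘(ℝ, E) q ∘ (extChartAt 𝓘(ℝ, E) q).symm =ᶠ[𝓝 (extChartAt 𝓘(ℝ, E) q q)] id := by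
    filter_upwards [(isOpen_extChartAt_target q).mem_nhds (mem_extChartAt_target q)] with z hz
    exact (extChartAt 𝓘(ℝ, E) q).right_inv hz
  rw [this.fderiv_eq, fderiv_id]

omit [FiniteDimensional ℝ E] in
theorem chartFrame_self (q : G) : chartFrame q (extChartAt 𝓘(ℝ, E) q q) = leftMulDeriv q := by
  have : IsManifold 𝓘(ℝ, E) 1 G := .of_le (n := ∞) (by norm_cast)
  unfold chartFrame
  rw [chartSymmDeriv_self, extChartAt_to_inv, ContinuousLinearMap.inverse_id]
  rfl

omit [FiniteDimensional ℝ E] [LieGroup 𝓘(ℝ, E) ∞ G] in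
theorem leftMulDeriv_one : leftMulDeriv (1 : G) = .id ℝ E := by
  unfold leftMulDeriv
  have : (fun z : G => 1 * z) = id := by ext z; simp
  rw [this, mfderiv_id]
  rfl

omit [FiniteDimensional ℝ E] in
theorem chartSymmDeriv_chartFrame (q : G) {x : E} (hx : x ∈ (extChartAt 𝓘(ℝ, E) q).target) (a : E) :
    chartSymmDeriv q x (chartFrame q x a) = leftMulDeriv ((extChartAt 𝓘(ℝ, E) q).symm x) a := by
  have : IsManifold 𝓘(ℝ, E) 1 G := .of_le (n := ∞) (by norm_cast)
  have h1 : (chartSymmDeriv q x).IsInvertible := isInvertible_mfderiv_extChartAt_symm hx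
  exact (h1.inverse_apply_eq.1 rfl).symm

omit [FiniteDimensional ℝ E] in
theorem metricInChart_chartFrame (hg : IsLeftInvariant 𝓘(ℝ, E) g) (q : G) (x : E)
    (hx : x ∈ (extChartAt 𝓘(ℝ, E) q).target) (a b : E) :
    metricInChart 𝓘(ℝ, E) g q x (chartFrame q x a) (chartFrame q x b) = metricAtOne g a b := by
  have h1 : metricInChart 𝓘(ℝ, E) g q x (chartFrame q x a) (chartFrame q x b)
    = (g ((extChartAt 𝓘(ℝ, E) q).symm x) : E →L[ℝ] E →L[ℝ] ℝ)
      (chartSymmDeriv q x (chartFrame q x a)) (chartSymmDeriv q x (chartFrame q x b)) := rfl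
  rw [h1, chartSymmDeriv_chartFrame q hx, chartSymmDeriv_chartFrame q hx]
  exact hg.apply_leftMulDeriv _ a b

theorem lieBracketCLM_skew (a b : E) : lieBracketCLM G a b = - lieBracketCLM G b a :=
  have h : ∀ a b : GroupLieAlgebra 𝓘(ℝ, E) G, ⁅a, b⁆ = -⁅b, a⁆ := fun a b => (lie_skew a b).symm
  h a b

/-- The Levi-Civita connection of a left invariant metric on left invariant fields. -/
def invariantConnection
    (g : ∀ q : G, TangentSpace 𝓘(ℝ, E) q →L[ℝ] TangentSpace 𝓘(ℝ, E) q →L[ℝ] ℝ) :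
    E →L[ℝ] E →L[ℝ] E :=
  koszulCLM (metricAtOne g) (lieBracketCLM G)

/-- The adjoint of the adjoint representation for a metric on a Lie group. -/
def invariantAdjoint
    (g : ∀ q : G, TangentSpace 𝓘(ℝ, E) q →L[ℝ] TangentSpace 𝓘(ℝ, E) q →L[ℝ] ℝ) :
    E →L[ℝ] E →L[ℝ] E :=
  adjointCLM (metricAtOne g) (lieBracketCLM G)

theorem isMetricLieData_group (symm : ∀ a b, metricAtOne g a b = metricAtOne g b a)
    (pos : ∀ a ≠ 0, 0 < metricAtOne g a a) :
    IsMetricLieData (metricAtOne g) (lieBracketCLM G) (invariantAdjoint g)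
      (invariantConnection g) :=
  isMetricLieData symm pos lieBracketCLM_skew

theorem fderiv_chartFrame_add_christoffel (hg : IsLeftInvariant 𝓘(ℝ, E) g)
    (symm : ∀ a b, metricAtOne g a b = metricAtOne g b a)
    (pos : ∀ a ≠ 0, 0 < metricAtOne g a a) (a b : E) (q : G) {x : E}
    (hx : x ∈ (extChartAt 𝓘(ℝ, E) q).target) :
    fderiv ℝ (fun x => chartFrame q x b) x (chartFrame q x a)
      + christoffel (metricInChart 𝓘(ℝ, E) g q) x (chartFrame q x a) (chartFrame q x b)
      = chartFrame q x (invariantConnection g a b) := by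
  have hf := isInvariantFrame_chartFrame (E := E) q
  have hm := isMetricLieData_group symm pos
  rw [christoffel_eq_frameConnection hm hf (metricInChart_chartFrame hg q) hx,
    hf.frameConnection_apply_right hx, hf.inverse_apply hx,
    fderiv_apply_const (hf.differentiableAt hx)]
  exact add_sub_cancel _ _

theorem leviCivita_mulInvariantVectorField (hg : IsLeftInvariant 𝓘(ℝ, E) g)
    (symm : ∀ a b, metricAtOne g a b = metricAtOne g b a)
    (pos : ∀ a ≠ 0, 0 < metricAtOne g a a) (a b : GroupLieAlgebra 𝓘(ℝ, E) G) (q : G) :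
    leviCivita 𝓘(ℝ, E) g (mulInvariantVectorField b) q (mulInvariantVectorField a q)
      = mulInvariantVectorField (I := 𝓘(ℝ, E)) (G := G) (invariantConnection (E := E) g a b) q := by
  have h := fderiv_chartFrame_add_christoffel hg symm pos (a : E) (b : E) q
    (mem_extChartAt_target (I := 𝓘(ℝ, E)) q)
  rw [chartFrame_self] at h
  exact h

end LieGroupMetric

/-! ### Connection and sectional curvature on the Lie algebra. -/

section LieGroupCurvature

variable {E : Type*} [NormedAddCommGroup E] [NormedSpace ℝ E] [FiniteDimensional ℝ E]
  {G : Type*} [TopologicalSpace G] [ChartedSpace E G] [Group G] [LieGroup 𝓘(ℝ, E) ∞ G]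
  {g : ∀ q : G, TangentSpace 𝓘(ℝ, E) q →L[ℝ] TangentSpace 𝓘(ℝ, E) q →L[ℝ] ℝ}

omit [FiniteDimensional ℝ E] [LieGroup 𝓘(ℝ, E) ∞ G] in
theorem mulInvariantVectorField_one (a : GroupLieAlgebra 𝓘(ℝ, E) G) :
    mulInvariantVectorField (I := 𝓘(ℝ, E)) (G := G) a 1 = a :=
  congrArg (fun A : E →L[ℝ] E => A a) (leftMulDeriv_one (E := E) (G := G))

theorem leviCivita_mulInvariantVectorField_one (hg : IsLeftInvariant 𝓘(ℝ, E) g)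
    (symm : ∀ a b, metricAtOne g a b = metricAtOne g b a)
    (pos : ∀ a ≠ 0, 0 < metricAtOne g a a) (a b : GroupLieAlgebra 𝓘(ℝ, E) G) :
    leviCivita 𝓘(ℝ, E) g (mulInvariantVectorField b) 1 (mulInvariantVectorField a 1)
      = invariantConnection (E := E) g a b :=
  (leviCivita_mulInvariantVectorField hg symm pos a b 1).trans (mulInvariantVectorField_one _)

theorem lieConnection_eq (hg : IsLeftInvariant 𝓘(ℝ, E) g)
    (symm : ∀ a b, metricAtOne g a b = metricAtOne g b a)
    (pos : ∀ a ≠ 0, 0 < metricAtOne g a a) (a b : GroupLieAlgebra 𝓘(ℝ, E) G) :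
    lieConnection 𝓘(ℝ, E) g a b = invariantConnection (E := E) g a b :=
  (congrArg (leviCivita 𝓘(ℝ, E) g (mulInvariantVectorField b) 1)
    (mulInvariantVectorField_one a)).symm.trans
    (leviCivita_mulInvariantVectorField_one hg symm pos a b)

theorem invariantConnection_eq_zero (hg : IsLeftInvariant 𝓘(ℝ, E) g)
    (symm : ∀ a b, metricAtOne g a b = metricAtOne g b a)
    (pos : ∀ a ≠ 0, 0 < metricAtOne g a a) {b : GroupLieAlgebra 𝓘(ℝ, E) G}
    (hb : IsParallel 𝓘(ℝ, E) g (mulInvariantVectorField b)) (a : E) :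
    invariantConnection g a b = 0 :=
  (lieConnection_eq hg symm pos a b).symm.trans (hb 1 a)

theorem riemannCurvature_mulInvariantVectorField (hg : IsLeftInvariant 𝓘(ℝ, E) g)
    (symm : ∀ a b, metricAtOne g a b = metricAtOne g b a)
    (pos : ∀ a ≠ 0, 0 < metricAtOne g a a) (a b c : GroupLieAlgebra 𝓘(ℝ, E) G) :
    riemannCurvature 𝓘(ℝ, E) g (mulInvariantVectorField a) (mulInvariantVectorField b)
        (mulInvariantVectorField c) 1
      = algebraCurvature (L := E) (invariantConnection g) (fun a b => lieBracketCLM G a b)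
        a b c := by
  have : CompleteSpace E := FiniteDimensional.complete ℝ E
  have h1 : ∀ a b c : GroupLieAlgebra 𝓘(ℝ, E) G, leviCivita 𝓘(ℝ, E) g
      (fun q => leviCivita 𝓘(ℝ, E) g (mulInvariantVectorField c) q (mulInvariantVectorField b q)) 1
      (mulInvariantVectorField a 1)
      = invariantConnection (E := E) g a (invariantConnection (E := E) g b c) := by
    intro a b c
    -- The covariant derivative of one left invariant field along another is again left invariant,
    -- so the same formula can be applied a second time.
    have h2 : (fun q => leviCivita 𝓘(ℝ, E) g (mulInvariantVectorField c) q
      (mulInvariantVectorField b q)) = mulInvariantVectorField (I := 𝓘(ℝ, E)) (G := G)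
        (show GroupLieAlgebra 𝓘(ℝ, E) G from invariantConnection (E := E) g b c) :=
      funext (leviCivita_mulInvariantVectorField hg symm pos b c)
    rw [h2]
    exact leviCivita_mulInvariantVectorField_one hg symm pos a _
  have h3 : leviCivita 𝓘(ℝ, E) g (mulInvariantVectorField c) 1 (mlieBracket 𝓘(ℝ, E)
      (mulInvariantVectorField a) (mulInvariantVectorField b) 1)
      = invariantConnection (E := E) g (lieBracketCLM (E := E) G a b) c := by
    rw [← mulInvariantVector_mlieBracket]
    exact leviCivita_mulInvariantVectorField_one hg symm pos _ c
  exact congrArg₂ (fun s t : E => s - t) (congrArg₂ (fun s t : E => s - t) (h1 a b c) (h1 b a c)) h3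

theorem lieSectionalCurvature_eq (hg : IsLeftInvariant 𝓘(ℝ, E) g)
    (symm : ∀ a b, metricAtOne g a b = metricAtOne g b a)
    (pos : ∀ a ≠ 0, 0 < metricAtOne g a a) {a b : GroupLieAlgebra 𝓘(ℝ, E) G}
    (ha : metricAtOne g a a = 1) (hb : metricAtOne g b b = 1) (hab : metricAtOne g a b = 0) :
    lieSectionalCurvature 𝓘(ℝ, E) g a b
      = metricAtOne g (algebraCurvature (L := E) (invariantConnection g)
        (fun a b => lieBracketCLM G a b) a b b) a := by
  have h : lieSectionalCurvature 𝓘(ℝ, E) g a b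
    = metricAtOne g (riemannCurvature 𝓘(ℝ, E) g (mulInvariantVectorField a)
        (mulInvariantVectorField b) (mulInvariantVectorField b) 1)
        (mulInvariantVectorField a 1) /
      (metricAtOne g (mulInvariantVectorField a 1) (mulInvariantVectorField a 1)
        * metricAtOne g (mulInvariantVectorField b 1) (mulInvariantVectorField b 1)
        - metricAtOne g (mulInvariantVectorField a 1) (mulInvariantVectorField b 1) ^ 2) := rfl
  rw [h, riemannCurvature_mulInvariantVectorField hg symm pos]
  simp only [mulInvariantVectorField_one]
  erw [ha, hb, hab]
  simp

end LieGroupCurvature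

/-! ### The Berwald condition makes `X` parallel. -/

section BerwaldLieGroup

variable {E : Type*} [NormedAddCommGroup E] [NormedSpace ℝ E] [FiniteDimensional ℝ E]
  {G : Type*} [TopologicalSpace G] [ChartedSpace E G] [Group G] [LieGroup 𝓘(ℝ, E) ∞ G]
  {g : ∀ q : G, TangentSpace 𝓘(ℝ, E) q →L[ℝ] TangentSpace 𝓘(ℝ, E) q →L[ℝ] ℝ}
  {φ : ℝ → ℝ} {b₀ : ℝ} {X : GroupLieAlgebra 𝓘(ℝ, E) G}

omit [FiniteDimensional ℝ E] [LieGroup 𝓘(ℝ, E) ∞ G] in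
theorem alphaBeta_leftMulDeriv (hg : IsLeftInvariant 𝓘(ℝ, E) g) (q : G) (a : E) :
    alphaBeta 𝓘(ℝ, E) φ (fun q u v => g q u v) (mulInvariantVectorField X) q
        (leftMulDeriv (E := E) q a)
      = alphaBetaNorm φ (metricAtOne g) (X : E) a := by
  have h1 := hg.apply_leftMulDeriv q a a
  have h2 := hg.apply_leftMulDeriv q (X : E) a
  have : alphaBeta 𝓘(ℝ, E) φ (fun q u v => g q u v) (mulInvariantVectorField X) q
        (leftMulDeriv (E := E) q a)
      = Real.sqrt ((g q : E →L[ℝ] E →L[ℝ] ℝ) (leftMulDeriv (E := E) q a) (leftMulDeriv (E := E) q a))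
        * φ ((g q : E →L[ℝ] E →L[ℝ] ℝ) (leftMulDeriv (E := E) q (X : E)) (leftMulDeriv (E := E) q a)
          / Real.sqrt ((g q : E →L[ℝ] E →L[ℝ] ℝ) (leftMulDeriv (E := E) q a) (leftMulDeriv (E := E) q a))) := rfl
  rw [this, h1, h2]
  rfl

theorem finslerInChart_alphaBeta (hg : IsLeftInvariant 𝓘(ℝ, E) g) (q : G) (x : E)
    (hx : x ∈ (extChartAt 𝓘(ℝ, E) q).target) (y : E) :
    finslerInChart 𝓘(ℝ, E) (alphaBeta 𝓘(ℝ, E) φ (fun q u v => g q u v)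
        (mulInvariantVectorField X)) q x y
      = alphaBetaNorm φ (metricAtOne g) (X : E) ((chartFrame q x).inverse y) := by
  have h := (isInvariantFrame_chartFrame (E := E) q).apply_inverse hx y
  rw [← alphaBeta_leftMulDeriv hg ((extChartAt 𝓘(ℝ, E) q).symm x), ← chartSymmDeriv_chartFrame q hx,
    h]
  rfl

omit [FiniteDimensional ℝ E] in
theorem isRiemannian_alphaBeta (hg : IsLeftInvariant 𝓘(ℝ, E) g)
    {B : E →L[ℝ] E →L[ℝ] ℝ} (hB : ∀ a, alphaBetaNorm φ (metricAtOne g) (X : E) a ^ 2 = B a a) :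
    IsRiemannian 𝓘(ℝ, E) (alphaBeta 𝓘(ℝ, E) φ (fun q u v => g q u v)
      (mulInvariantVectorField X)) := by
  intro q
  have hi : (leftMulDeriv (E := E) q).IsInvertible := isInvertible_mfderiv_mul_left (E := E) q 1
  let A : E →L[ℝ] E →L[ℝ] ℝ :=
    B.bilinearComp (leftMulDeriv (E := E) q).inverse (leftMulDeriv (E := E) q).inverse
  refine ⟨A, fun y => ?_⟩
  have hy : leftMulDeriv q ((leftMulDeriv (E := E) q).inverse y) = y :=
    (hi.inverse_apply_eq.1 rfl).symm
  have := hB ((leftMulDeriv (E := E) q).inverse y)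
  rw [← alphaBeta_leftMulDeriv hg q, hy] at this
  exact this

/-- The spray at the unit gives a torsion-free connection preserving the norm. By the dichotomy
either the vector is parallel, or the norm is Euclidean and the Riemannian hypothesis applies. -/
theorem invariantConnection_eq_zero_of_isBerwald (hg : IsLeftInvariant 𝓘(ℝ, E) g)
    (h : IsAlphaBetaData φ b₀ (metricAtOne g) (X : E))
    (hF : IsBerwald 𝓘(ℝ, E) (alphaBeta 𝓘(ℝ, E) φ (fun q u v => g q u v)
      (mulInvariantVectorField X)))
    (hR : IsRiemannian 𝓘(ℝ, E) (alphaBeta 𝓘(ℝ, E) φ (fun q u v => g q u v)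
      (mulInvariantVectorField X)) → IsParallel 𝓘(ℝ, E) g (mulInvariantVectorField X))
    {Y V : E} (hY : metricAtOne g Y Y = 1) (hV : metricAtOne g V V = 1)
    (hYV : metricAtOne g Y V = 0) (a : E) :
    invariantConnection g a (X : E) = 0 := by
  have hm := isMetricLieData_group h.symm h.pos
  have hx := mem_extChartAt_target (I := 𝓘(ℝ, E)) (1 : G)
  have : CompleteSpace E := FiniteDimensional.complete ℝ E
  obtain ⟨Γ, hΓ⟩ := hF 1
  obtain ⟨B, htor, hB⟩ := (isInvariantFrame_chartFrame (1 : G)).exists_connection_of_sprayCoeff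
    (finslerInChart_alphaBeta hg 1) h.contDiffAt_sq h.normTensor_pos
    (fun a t ht => 
      (congrArg (· ^ 2) (IsAlphaBetaData.alphaBetaNorm_smul t ht a)).trans (mul_pow _ _ 2)) hx (fun y hy => hΓ _ hx y hy)
  rcases h.isQuadratic_or_parallel (fun a b => (htor a b).trans (hm.torsion a b).symm) hm.nab_skew
    hB hY hV hYV with ⟨q, hq⟩ | hp
  · exact invariantConnection_eq_zero hg h.symm h.pos (hR (isRiemannian_alphaBeta hg hq)) a
  · exact hp a

end BerwaldLieGroup

/-! ### Complete and vertical lifts of a frame. -/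

section TangentFrame

variable {E : Type*} [NormedAddCommGroup E] [NormedSpace ℝ E]
  {L : Type*} [NormedAddCommGroup L] [NormedSpace ℝ L]

/-- The frame of complete and vertical lifts of the fields of the frame `Φ`. -/
def tangentFrame (Φ : E → L →L[ℝ] E) (z : E × E) : L × L →L[ℝ] E × E :=
  ((Φ z.1).comp (.fst ℝ L L)).prod
    ((fderiv ℝ Φ z.1 z.2).comp (.fst ℝ L L) + (Φ z.1).comp (.snd ℝ L L))

theorem tangentFrame_apply (Φ : E → L →L[ℝ] E) (z : E × E) (p : L × L) :
    tangentFrame Φ z p = (Φ z.1 p.1, fderiv ℝ Φ z.1 z.2 p.1 + Φ z.1 p.2) := rfl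

-- The vertical component of the bracket of two complete lifts is the derivative along `y` of the
-- bracket identity of `Φ`; symmetry of the second derivative of `Φ` matches the two.
set_option synthInstance.maxHeartbeats 200000 in
theorem IsInvariantFrame.tangentFrame [FiniteDimensional ℝ L] [FiniteDimensional ℝ E]
    {Φ : E → L →L[ℝ] E} {br : L →L[ℝ] L →L[ℝ] L}
    {U : Set E} (h : IsInvariantFrame Φ (fun a b => br a b) U) :
    IsInvariantFrame (tangentFrame Φ) (tangentBracket br) (U ×ˢ Set.univ) := by
  have hT : ContDiffOn ℝ ∞ (_root_.tangentFrame Φ) (U ×ˢ Set.univ) := by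
    rw [contDiffOn_clm_apply]
    rintro p ⟨x, y⟩ ⟨hx, -⟩
    have h1 : ContDiffAt ℝ ∞ (fun z : E × E => Φ z.1) (x, y) :=
      (h.contDiffAt hx).comp (x, y) contDiffAt_fst
    have h2 : ContDiffAt ℝ ∞ (fun z : E × E => fderiv ℝ Φ z.1) (x, y) :=
      (h.contDiffAt_fderiv hx).comp (x, y) contDiffAt_fst
    exact ((h1.clm_apply contDiffAt_const).prodMk
      (((h2.clm_apply contDiffAt_snd).clm_apply contDiffAt_const).add
        (h1.clm_apply contDiffAt_const))).contDiffWithinAt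
  refine ⟨h.isOpen.prod isOpen_univ, hT, ?_, ?_⟩
  · rintro ⟨x, y⟩ ⟨hx, -⟩
    let P := (Φ x).inverse
    -- The lifted frame is block triangular with `Φ x` twice on the diagonal, and `Ψ` is its
    -- inverse.
    let Ψ : E × E →L[ℝ] L × L := (P.comp (.fst ℝ E E)).prod
      (P.comp (.snd ℝ E E - ((fderiv ℝ Φ x y).comp P).comp (.fst ℝ E E)))
    have hΨ : ∀ w, Ψ w = (P w.1, P (w.2 - fderiv ℝ Φ x y (P w.1))) := fun _ => rfl
    refine ContinuousLinearMap.IsInvertible.of_inverse (g := Ψ)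
      (ContinuousLinearMap.ext fun w => ?_) (ContinuousLinearMap.ext fun w => ?_)
    · rw [ContinuousLinearMap.comp_apply, hΨ, tangentFrame_apply, h.apply_inverse hx,
        h.apply_inverse hx, add_sub_cancel]
      rfl
    · rw [ContinuousLinearMap.comp_apply, hΨ, tangentFrame_apply, h.inverse_apply hx,
        add_sub_cancel_left, h.inverse_apply hx]
      rfl
  · rintro ⟨x, y⟩ ⟨hx, -⟩ p q
    have hd : ∀ (u v : E) (q : L × L), fderiv ℝ (_root_.tangentFrame Φ) (x, y) (u, v) q
        = (fderiv ℝ Φ x u q.1,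
          fderiv ℝ (fderiv ℝ Φ) x u y q.1 + fderiv ℝ Φ x v q.1 + fderiv ℝ Φ x u q.2) := by
      intro u v q
      have hz : U ×ˢ Set.univ ∈ 𝓝 (x, y) := (h.isOpen.prod isOpen_univ).mem_nhds ⟨hx, trivial⟩
      have e1 : HasFDerivAt (fun z : E × E => Φ z.1) ((fderiv ℝ Φ x).comp (.fst ℝ E E)) (x, y) :=
        (h.differentiableAt hx).hasFDerivAt.comp (x, y) hasFDerivAt_fst
      have e2 : HasFDerivAt (fun z : E × E => fderiv ℝ Φ z.1)
          ((fderiv ℝ (fderiv ℝ Φ) x).comp (.fst ℝ E E)) (x, y) :=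
        ((h.contDiffAt_fderiv hx).differentiableAt (by simp)).hasFDerivAt.comp (x, y)
          hasFDerivAt_fst
      have e3 := (e1.clm_apply (hasFDerivAt_const q.1 _)).prodMk
        (((e2.clm_apply hasFDerivAt_snd).clm_apply (hasFDerivAt_const q.1 _)).add
          (e1.clm_apply (hasFDerivAt_const q.2 _)))
      rw [← fderiv_apply_const ((hT.contDiffAt hz).differentiableAt (by simp))]
      simp only [tangentFrame_apply]
      erw [e3.fderiv]
      simp
      abel
    have hb : ∀ (u : E) (a b : L),
        fderiv ℝ (fderiv ℝ Φ) x u (Φ x a) b + fderiv ℝ Φ x (fderiv ℝ Φ x u a) b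
          - (fderiv ℝ (fderiv ℝ Φ) x u (Φ x b) a + fderiv ℝ Φ x (fderiv ℝ Φ x u b) a)
        = fderiv ℝ Φ x u (br a b) := by
      intro u a b
      have dΦ := (h.differentiableAt hx).hasFDerivAt
      have dD := ((h.contDiffAt_fderiv hx).differentiableAt (by simp)).hasFDerivAt
      have e : (fun x => fderiv ℝ Φ x (Φ x a) b - fderiv ℝ Φ x (Φ x b) a)
          =ᶠ[𝓝 x] fun x => Φ x (br a b) := by
        filter_upwards [h.isOpen.mem_nhds hx] with z hz using h.bracket z hz a b
      have d : ∀ a b, HasFDerivAt (fun x => fderiv ℝ Φ x (Φ x a) b) _ x := fun a b =>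
        (dD.clm_apply (dΦ.clm_apply (hasFDerivAt_const a x))).clm_apply (hasFDerivAt_const b x)
      have key := e.fderiv_eq (𝕜 := ℝ)
      erw [((d a b).sub (d b a)).fderiv,
        (dΦ.clm_apply (hasFDerivAt_const (br a b) x)).fderiv] at key
      have key := congrArg (fun A : E →L[ℝ] E => A u) key
      simp at key
      rw [← key]
      abel
    rw [tangentFrame_apply, tangentFrame_apply, hd, hd, tangentFrame_apply]
    have h1 := h.bracket x hx p.1 q.1
    have h2 := h.bracket x hx p.1 q.2
    have h3 := h.bracket x hx p.2 q.1
    have h4 := hb y p.1 q.1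
    refine Prod.ext h1 ?_
    simp only [tangentBracket, Prod.snd_sub, map_add, add_apply] at h1 h2 h3 ⊢
    rw [h.isSymmSndFDerivAt hx (Φ x p.1) y, h.isSymmSndFDerivAt hx (Φ x q.1) y, ← h2, ← h3, ← h4]
    abel

end TangentFrame

/-! ### Charts of the tangent bundle. -/

section TangentBundleChart

variable {E : Type*} [NormedAddCommGroup E] [NormedSpace ℝ E]
  {M : Type*} [TopologicalSpace M] [ChartedSpace E M]

/-- The change of coordinates from the chart at `q` to the chart at `r`. -/
def chartTransition (q r : M) : E → E := extChartAt 𝓘(ℝ, E) r ∘ (extChartAt 𝓘(ℝ, E) q).symm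

/-- The domain of the change of coordinates from the chart at `q` to the chart at `r`. -/
def chartTransitionSource (q r : M) : Set E :=
  (extChartAt 𝓘(ℝ, E) q).target ∩ (extChartAt 𝓘(ℝ, E) q).symm ⁻¹' (extChartAt 𝓘(ℝ, E) r).source

theorem isOpen_chartTransitionSource (q r : M) : IsOpen (chartTransitionSource (E := E) q r) :=
  (continuousOn_extChartAt_symm q).isOpen_inter_preimage (isOpen_extChartAt_target q)
    (isOpen_extChartAt_source r)

theorem chartTransition_mem {q r : M} {x : E} (hx : x ∈ chartTransitionSource q r) :
    chartTransition q r x ∈ (extChartAt 𝓘(ℝ, E) r).target :=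
  (extChartAt 𝓘(ℝ, E) r).map_source hx.2

theorem extChartAt_symm_chartTransition {q r : M} {x : E} (hx : x ∈ chartTransitionSource q r) :
    (extChartAt 𝓘(ℝ, E) r).symm (chartTransition q r x) = (extChartAt 𝓘(ℝ, E) q).symm x :=
  (extChartAt 𝓘(ℝ, E) r).left_inv hx.2

theorem contDiffOn_chartTransition [IsManifold 𝓘(ℝ, E) ∞ M] (q r : M) :
    ContDiffOn ℝ ∞ (chartTransition q r) (chartTransitionSource (E := E) q r) :=
  contDiffOn_ext_coord_change r q

variable [IsManifold 𝓘(ℝ, E) 1 M]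

theorem tangentBundle_extChartAt_target (p : TangentBundle 𝓘(ℝ, E) M) :
    (extChartAt 𝓘(ℝ, E).tangent p).target = (extChartAt 𝓘(ℝ, E) p.1).target ×ˢ Set.univ := by
  rw [FiberBundle.extChartAt_target, Set.inter_eq_left.2]
  intro x hx
  rw [Set.mem_preimage, TangentBundle.trivializationAt_baseSet, ← extChartAt_source 𝓘(ℝ, E)]
  exact (extChartAt 𝓘(ℝ, E) p.1).map_target hx

theorem tangentCoordChange_eq_fderiv (q r : M) {x : E} (hx : x ∈ (extChartAt 𝓘(ℝ, E) q).target) :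
    tangentCoordChange 𝓘(ℝ, E) q r ((extChartAt 𝓘(ℝ, E) q).symm x)
      = fderiv ℝ (chartTransition q r) x := by
  rw [tangentCoordChange_def, modelWithCornersSelf_coe, Set.range_id, fderivWithin_univ,
    (extChartAt 𝓘(ℝ, E) q).right_inv hx]
  rfl

theorem tangentBundle_extChartAt_self (p : TangentBundle 𝓘(ℝ, E) M) :
    extChartAt 𝓘(ℝ, E).tangent p p = ((extChartAt 𝓘(ℝ, E) p.1 p.1, p.2) : E × E) := by
  have h : tangentCoordChange 𝓘(ℝ, E) p.1 p.1 p.1 (p.2 : E) = (p.2 : E) :=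
    tangentCoordChange_self (mem_extChartAt_source p.1)
  exact congrArg (Prod.mk (extChartAt 𝓘(ℝ, E) p.1 p.1)) h

theorem tangentBundle_extChartAt_symm_snd (p : TangentBundle 𝓘(ℝ, E) M) {z : E × E}
    (hz : z.1 ∈ (extChartAt 𝓘(ℝ, E) p.1).target) :
    (((extChartAt 𝓘(ℝ, E).tangent p).symm z).2 : E)
      = fderiv ℝ (chartTransition p.1 ((extChartAt 𝓘(ℝ, E) p.1).symm z.1)) z.1 z.2 := by
  rw [← tangentCoordChange_eq_fderiv _ _ hz]
  rfl

/-- The change of coordinates of the tangent bundle is the tangent map of the change of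
coordinates of the base. -/
theorem tangentBundle_chartTransition (p p' : TangentBundle 𝓘(ℝ, E) M) {z : E × E}
    (hz : z.1 ∈ chartTransitionSource p.1 p'.1) :
    extChartAt 𝓘(ℝ, E).tangent p' ((extChartAt 𝓘(ℝ, E).tangent p).symm z)
      = (chartTransition p.1 p'.1 z.1, fderiv ℝ (chartTransition p.1 p'.1) z.1 z.2) := by
  have h : tangentCoordChange 𝓘(ℝ, E) ((extChartAt 𝓘(ℝ, E) p.1).symm z.1) p'.1
      ((extChartAt 𝓘(ℝ, E) p.1).symm z.1) (tangentCoordChange 𝓘(ℝ, E) p.1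
        ((extChartAt 𝓘(ℝ, E) p.1).symm z.1) ((extChartAt 𝓘(ℝ, E) p.1).symm z.1) z.2)
      = fderiv ℝ (chartTransition p.1 p'.1) z.1 z.2 := by
    rw [tangentCoordChange_comp, tangentCoordChange_eq_fderiv _ _ hz.1]
    exact ⟨⟨(extChartAt 𝓘(ℝ, E) p.1).map_target hz.1, mem_extChartAt_source _⟩, hz.2⟩
  exact congrArg (Prod.mk (chartTransition p.1 p'.1 z.1)) h

/-- In the preferred chart at the image point the inverse chart reads `(x, y) ↦ (τ x, Dτ(x) y)`;
this is its derivative. -/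
theorem mfderiv_tangentBundle_extChartAt_symm [IsManifold 𝓘(ℝ, E) ∞ M]
    (p : TangentBundle 𝓘(ℝ, E) M) {x y : E}
    (hx : x ∈ (extChartAt 𝓘(ℝ, E) p.1).target) (u v : E) :
    mfderiv 𝓘(ℝ, E × E) 𝓘(ℝ, E).tangent (extChartAt 𝓘(ℝ, E).tangent p).symm (x, y) (u, v)
      = ((fderiv ℝ (chartTransition p.1 ((extChartAt 𝓘(ℝ, E) p.1).symm x)) x u,
        fderiv ℝ (fderiv ℝ (chartTransition p.1 ((extChartAt 𝓘(ℝ, E) p.1).symm x))) x u y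
          + fderiv ℝ (chartTransition p.1 ((extChartAt 𝓘(ℝ, E) p.1).symm x)) x v) : E × E) := by
  set q := (extChartAt 𝓘(ℝ, E) p.1).symm x with hq
  set τ := chartTransition (E := E) p.1 q with hτ
  have hxs : x ∈ chartTransitionSource p.1 q := ⟨hx, mem_extChartAt_source q⟩
  have hd : MDifferentiableAt 𝓘(ℝ, E × E) 𝓘(ℝ, E).tangent (extChartAt 𝓘(ℝ, E).tangent p).symm
      (x, y) := by
    have : IsManifold 𝓘(ℝ, E) (1 + 1) M := .of_le (n := ∞) (by norm_cast)
    have hz : (x, y) ∈ (extChartAt 𝓘(ℝ, E).tangent p).target := by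
      rw [tangentBundle_extChartAt_target]
      exact ⟨hx, trivial⟩
    have h := mdifferentiableWithinAt_extChartAt_symm (I := 𝓘(ℝ, E).tangent) hz
    have hr : Set.range 𝓘(ℝ, E).tangent = Set.univ := ModelWithCorners.Boundaryless.range_eq_univ
    rwa [hr, mdifferentiableWithinAt_univ] at h
  have hs : ContDiffAt ℝ ∞ τ x := (contDiffOn_chartTransition p.1 q).contDiffAt
    ((isOpen_chartTransitionSource p.1 q).mem_nhds hxs)
  have e : (extChartAt 𝓘(ℝ, E).tangent ((extChartAt 𝓘(ℝ, E).tangent p).symm (x, y))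
      ∘ (extChartAt 𝓘(ℝ, E).tangent p).symm : E × E → E × E)
      =ᶠ[𝓝 (x, y)] fun z => (τ z.1, fderiv ℝ τ z.1 z.2) := by
    filter_upwards [continuous_fst.continuousAt.preimage_mem_nhds
      ((isOpen_chartTransitionSource p.1 q).mem_nhds hxs)] with z hz
    exact tangentBundle_chartTransition p ((extChartAt 𝓘(ℝ, E).tangent p).symm (x, y)) hz
  have h1 : HasFDerivAt (fun z : E × E => τ z.1) ((fderiv ℝ τ x).comp (.fst ℝ E E)) (x, y) :=
    HasFDerivAt.comp (f := Prod.fst) (g := τ) (x, y)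
      (hs.differentiableAt (by simp)).hasFDerivAt hasFDerivAt_fst
  have h2 : HasFDerivAt (fun z : E × E => fderiv ℝ τ z.1)
      ((fderiv ℝ (fderiv ℝ τ) x).comp (.fst ℝ E E)) (x, y) :=
    ((hs.fderiv_right (m := 1) (by norm_cast)).differentiableAt (by simp)).hasFDerivAt.comp (x, y)
      hasFDerivAt_fst
  have h3 := h1.prodMk (h2.clm_apply hasFDerivAt_snd)
  have h4 : mfderiv 𝓘(ℝ, E × E) 𝓘(ℝ, E).tangent (extChartAt 𝓘(ℝ, E).tangent p).symm (x, y)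
      = fderiv ℝ (fun z : E × E => (τ z.1, fderiv ℝ τ z.1 z.2)) (x, y) := by
    rw [← e.fderiv_eq (𝕜 := ℝ), hd.mfderiv, modelWithCornersSelf_coe, Set.range_id,
      fderivWithin_univ]
    rfl
  rw [h4, h3.fderiv]
  change ((fderiv ℝ τ x u, fderiv ℝ τ x v + fderiv ℝ (fderiv ℝ τ) x u y) : E × E) = _
  rw [add_comm]

end TangentBundleChart

/-! ### Independence of the lifted frame from the chart. -/

section TangentGroupFrame

variable {E : Type*} [NormedAddCommGroup E] [NormedSpace ℝ E] [FiniteDimensional ℝ E]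
  {G : Type*} [TopologicalSpace G] [ChartedSpace E G] [Group G] [LieGroup 𝓘(ℝ, E) ∞ G]

-- Both frames represent the same left invariant field, so they are related by the derivative of the
-- change of chart.
omit [FiniteDimensional ℝ E] in
theorem chartFrame_chartTransition {q r : G} {x : E} (hx : x ∈ chartTransitionSource q r) (a : E) :
    chartFrame r (chartTransition q r x) a
      = fderiv ℝ (chartTransition q r) x (chartFrame q x a) := by
  have : IsManifold 𝓘(ℝ, E) 1 G := .of_le (n := ∞) (by norm_cast)
  have hn := (isOpen_chartTransitionSource q r).mem_nhds hx
  have hd : DifferentiableAt ℝ (chartTransition q r) x :=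
    ((contDiffOn_chartTransition q r).contDiffAt hn).differentiableAt (by simp)
  have e : (extChartAt 𝓘(ℝ, E) q).symm =ᶠ[𝓝 x]
      (extChartAt 𝓘(ℝ, E) r).symm ∘ chartTransition q r := by
    filter_upwards [hn] with z hz using (extChartAt_symm_chartTransition hz).symm
  have h1 : chartSymmDeriv q x = (chartSymmDeriv r (chartTransition q r x)).comp
      (fderiv ℝ (chartTransition q r) x) := by
    have h2 := mfderiv_comp (I' := 𝓘(ℝ, E)) x
      (mdifferentiableAt_extChartAt_symm (chartTransition_mem hx)) hd.mdifferentiableAt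
    rw [mfderiv_eq_fderiv] at h2
    exact e.mfderiv_eq.trans h2
  obtain ⟨A, hA⟩ : (chartSymmDeriv r (chartTransition q r x)).IsInvertible :=
    isInvertible_mfderiv_extChartAt_symm (chartTransition_mem hx)
  have h2 := chartSymmDeriv_chartFrame q hx.1 a
  rw [h1, ← extChartAt_symm_chartTransition hx,
    ← chartSymmDeriv_chartFrame r (chartTransition_mem hx), ← hA] at h2
  exact (A.injective h2).symm

theorem fderiv_chartFrame_chartTransition {q r : G} {x : E} (hx : x ∈ chartTransitionSource q r)
    (a u : E) :
    fderiv ℝ (chartFrame r) (chartTransition q r x) (fderiv ℝ (chartTransition q r) x u) a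
      = fderiv ℝ (fderiv ℝ (chartTransition q r)) x u (chartFrame q x a)
        + fderiv ℝ (chartTransition q r) x (fderiv ℝ (chartFrame q) x u a) := by
  have hn := (isOpen_chartTransitionSource q r).mem_nhds hx
  have hs := (contDiffOn_chartTransition q r).contDiffAt hn
  have d1 := (hs.differentiableAt (by simp)).hasFDerivAt
  have d2 := ((hs.fderiv_right (m := 1) (by norm_cast)).differentiableAt (by simp)).hasFDerivAt
  have dq := ((isInvariantFrame_chartFrame q).differentiableAt hx.1).hasFDerivAt
  have dr := ((isInvariantFrame_chartFrame r).differentiableAt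
    (chartTransition_mem hx)).hasFDerivAt
  have e : (fun x => chartFrame r (chartTransition q r x) a) =ᶠ[𝓝 x]
      fun x => fderiv ℝ (chartTransition q r) x (chartFrame q x a) := by
    filter_upwards [hn] with z hz using chartFrame_chartTransition hz a
  have key := e.fderiv_eq (𝕜 := ℝ)
  erw [((dr.comp x d1).clm_apply (hasFDerivAt_const a x)).fderiv,
    (d2.clm_apply (dq.clm_apply (hasFDerivAt_const a x))).fderiv] at key
  have key := congrArg (fun A : E →L[ℝ] E => A u) key
  simp at key
  rw [key, add_comm]

/-- Complete and vertical lifts are intrinsic: the second derivative of the transition map coming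
from the derivative of the frame agrees, by symmetry, with the one in the tangent map of the bundle
chart. This lets one chart describe the lifts at all nearby points. -/
theorem mfderiv_tangentFrame (p : TangentBundle 𝓘(ℝ, E) G) {x : E} (y : E)
    (hx : x ∈ (extChartAt 𝓘(ℝ, E) p.1).target) (a : E × E) :
    mfderiv 𝓘(ℝ, E × E) 𝓘(ℝ, E).tangent (extChartAt 𝓘(ℝ, E).tangent p).symm (x, y)
        (tangentFrame (chartFrame p.1) (x, y) a)
      = tangentFrame (chartFrame ((extChartAt 𝓘(ℝ, E).tangent p).symm (x, y)).1)
        (extChartAt 𝓘(ℝ, E) ((extChartAt 𝓘(ℝ, E).tangent p).symm (x, y)).1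
          ((extChartAt 𝓘(ℝ, E).tangent p).symm (x, y)).1,
          ((extChartAt 𝓘(ℝ, E).tangent p).symm (x, y)).2) a := by
  have : IsManifold 𝓘(ℝ, E) 1 G := .of_le (n := ∞) (by norm_cast)
  set q := (extChartAt 𝓘(ℝ, E) p.1).symm x with hq
  have hxs : x ∈ chartTransitionSource p.1 q := ⟨hx, mem_extChartAt_source q⟩
  have h2 : (((extChartAt 𝓘(ℝ, E).tangent p).symm (x, y)).2 : E)
      = fderiv ℝ (chartTransition p.1 q) x y :=
    tangentBundle_extChartAt_symm_snd p (z := (x, y)) hx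
  have h3 : tangentFrame (chartFrame q) (chartTransition p.1 q x,
      fderiv ℝ (chartTransition p.1 q) x y) a
      = (fderiv ℝ (chartTransition p.1 q) x (chartFrame p.1 x a.1),
        fderiv ℝ (fderiv ℝ (chartTransition p.1 q)) x (chartFrame p.1 x a.1) y
          + fderiv ℝ (chartTransition p.1 q) x
            (fderiv ℝ (chartFrame p.1) x y a.1 + chartFrame p.1 x a.2)) := by
    have hs := (contDiffOn_chartTransition p.1 q).contDiffAt
      ((isOpen_chartTransitionSource p.1 q).mem_nhds hxs)
    have sym := (hs.isSymmSndFDerivAt (by simp; norm_cast)).eq (chartFrame p.1 x a.1) y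
    rw [tangentFrame_apply, fderiv_chartFrame_chartTransition hxs,
      chartFrame_chartTransition hxs, chartFrame_chartTransition hxs, sym, map_add, add_assoc]
  have h1 := mfderiv_tangentBundle_extChartAt_symm p (y := y) hx (chartFrame p.1 x a.1)
    (fderiv ℝ (chartFrame p.1) x y a.1 + chartFrame p.1 x a.2)
  refine h1.trans (h3.symm.trans ?_)
  have h4 := congrArg (fun v : E => tangentFrame (chartFrame q) (chartTransition p.1 q x, v) a) h2
  exact h4.symm

end TangentGroupFrame

/-! ### The lifted Finsler metric in the lifted frame, and its flag curvatures. -/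

section CompleteLiftedFinsler

variable {E : Type*} [NormedAddCommGroup E] [NormedSpace ℝ E] [FiniteDimensional ℝ E]
  {G : Type*} [TopologicalSpace G] [ChartedSpace E G] [Group G] [LieGroup 𝓘(ℝ, E) ∞ G]
  {g : ∀ q : G, TangentSpace 𝓘(ℝ, E) q →L[ℝ] TangentSpace 𝓘(ℝ, E) q →L[ℝ] ℝ}
  {φ : ℝ → ℝ} {b₀ : ℝ} {X : GroupLieAlgebra 𝓘(ℝ, E) G}

/-- The frame of complete and vertical lifts of left invariant fields, at the point `p`. -/
def liftFrame (p : TangentBundle 𝓘(ℝ, E) G) : E × E →L[ℝ] E × E :=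
  tangentFrame (chartFrame p.1) (extChartAt 𝓘(ℝ, E) p.1 p.1, p.2)

omit [FiniteDimensional ℝ E] in
theorem liftFrame_apply (p : TangentBundle 𝓘(ℝ, E) G) (a : E × E) :
    liftFrame p a = (leftMulDeriv p.1 a.1,
      fderiv ℝ (chartFrame p.1) (extChartAt 𝓘(ℝ, E) p.1 p.1) p.2 a.1 + leftMulDeriv p.1 a.2) := by
  rw [← chartFrame_self]
  rfl

theorem lieCompleteLift_eq (p : TangentBundle 𝓘(ℝ, E) G) (a : GroupLieAlgebra 𝓘(ℝ, E) G) :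
    lieCompleteLift 𝓘(ℝ, E) a p = liftFrame p ((a : E), (0 : E)) := by
  have h := fderiv_apply_const ((isInvariantFrame_chartFrame (E := E) p.1).differentiableAt
    (mem_extChartAt_target (I := 𝓘(ℝ, E)) p.1)) (a : E) p.2
  rw [liftFrame_apply, map_zero, add_zero, ← h]
  rfl

omit [FiniteDimensional ℝ E] in
theorem lieVerticalLift_eq (p : TangentBundle 𝓘(ℝ, E) G) (a : GroupLieAlgebra 𝓘(ℝ, E) G) :
    lieVerticalLift 𝓘(ℝ, E) a p = liftFrame p ((0 : E), (a : E)) := by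
  rw [liftFrame_apply, map_zero, map_zero, zero_add]
  rfl

omit [FiniteDimensional ℝ E] in
theorem leftInvariantExtension_leftMulDeriv (q : G) (a : E) :
    leftInvariantExtension 𝓘(ℝ, E) q (leftMulDeriv (E := E) q a) = a := by
  have hi : (leftMulDeriv (E := E) q).IsInvertible := isInvertible_mfderiv_mul_left (E := E) q 1
  exact hi.inverse_apply_eq.2 rfl

omit [FiniteDimensional ℝ E] in
theorem horPart_liftFrame (p : TangentBundle 𝓘(ℝ, E) G) (a : E × E) :
    horPart 𝓘(ℝ, E) p (liftFrame p a) = leftMulDeriv (E := E) p.1 a.1 := by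
  rw [liftFrame_apply]
  rfl

/-- The left invariant field with the same projection is that of `a.1`, and its complete lift is
`liftFrame p (a.1, 0)`; the difference is vertical. -/
theorem verPart_liftFrame (p : TangentBundle 𝓘(ℝ, E) G) (a : E × E) :
    verPart 𝓘(ℝ, E) p (liftFrame p a) = leftMulDeriv (E := E) p.1 a.2 := by
  have h1 : leftInvariantExtension 𝓘(ℝ, E) p.1 (horPart 𝓘(ℝ, E) p (liftFrame p a)) = a.1 := by
    rw [horPart_liftFrame]
    exact leftInvariantExtension_leftMulDeriv p.1 a.1
  have h2 : completeLift 𝓘(ℝ, E) (mulInvariantVectorField (leftInvariantExtension 𝓘(ℝ, E) p.1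
      (horPart 𝓘(ℝ, E) p (liftFrame p a)))) p = liftFrame p (a.1, (0 : E)) :=
    (congrArg (fun U => lieCompleteLift 𝓘(ℝ, E) U p) h1).trans (lieCompleteLift_eq p a.1)
  have h3 : verPart 𝓘(ℝ, E) p (liftFrame p a) = (liftFrame p a - liftFrame p (a.1, (0 : E))).2 :=
    congrArg (fun w : E × E => (liftFrame p a - w).2) h2
  rw [h3, liftFrame_apply, liftFrame_apply, map_zero, add_zero]
  exact add_sub_cancel_left _ _

theorem liftedMetric_liftFrame (hg : IsLeftInvariant 𝓘(ℝ, E) g) (p : TangentBundle 𝓘(ℝ, E) G)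
    (a b : E × E) :
    liftedMetric 𝓘(ℝ, E) g p (liftFrame p a) (liftFrame p b)
      = tangentMetric (metricAtOne g) a b := by
  unfold liftedMetric
  rw [horPart_liftFrame, horPart_liftFrame, verPart_liftFrame, verPart_liftFrame]
  exact congrArg₂ (· + ·) (hg.apply_leftMulDeriv p.1 a.1 b.1) (hg.apply_leftMulDeriv p.1 a.2 b.2)

theorem completeLiftedFinsler_liftFrame (hg : IsLeftInvariant 𝓘(ℝ, E) g)
    (p : TangentBundle 𝓘(ℝ, E) G) (a : E × E) :
    completeLiftedFinsler 𝓘(ℝ, E) φ g X p (liftFrame p a)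
      = alphaBetaNorm φ (tangentMetric (metricAtOne g)) ((X : E), (0 : E)) a := by
  have h := lieCompleteLift_eq p X
  unfold lieCompleteLift at h
  unfold completeLiftedFinsler alphaBeta
  rw [h, liftedMetric_liftFrame hg, liftedMetric_liftFrame hg]
  rfl

theorem finslerInChart_completeLiftedFinsler (hg : IsLeftInvariant 𝓘(ℝ, E) g)
    (p : TangentBundle 𝓘(ℝ, E) G) (z : E × E)
    (hz : z ∈ (extChartAt 𝓘(ℝ, E) p.1).target ×ˢ (Set.univ : Set E)) (w : E × E) :
    finslerInChart 𝓘(ℝ, E).tangent (completeLiftedFinsler 𝓘(ℝ, E) φ g X) p z w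
      = alphaBetaNorm φ (tangentMetric (metricAtOne g)) ((X : E), (0 : E))
        ((tangentFrame (chartFrame p.1) z).inverse w) := by
  have hf := (isInvariantFrame_chartFrame (E := E) p.1).tangentFrame
  have hw := hf.apply_inverse hz w
  rw [← completeLiftedFinsler_liftFrame hg ((extChartAt 𝓘(ℝ, E).tangent p).symm z)]
  have h := mfderiv_tangentFrame p z.2 hz.1 ((tangentFrame (chartFrame p.1) z).inverse w)
  unfold finslerInChart
  congr 1
  exact (congrArg _ hw).symm.trans h

/-- The Levi-Civita connection of the semidirect product preserves the norm because `(X, 0)` is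
parallel, so the frame formula for flag curvature applies and `tangent_flag_eq` evaluates it. -/
theorem flagCurvature_completeLiftedFinsler (hg : IsLeftInvariant 𝓘(ℝ, E) g)
    (h : IsAlphaBetaData φ b₀ (tangentMetric (metricAtOne g)) ((X : E), (0 : E)))
    (hm : IsMetricLieData (metricAtOne g) (lieBracketCLM G) (invariantAdjoint g)
      (invariantConnection g))
    (hX : ∀ c, invariantConnection g c (X : E) = 0) (p : TangentBundle 𝓘(ℝ, E) G) {a c : E × E}
    (ha : tangentMetric (metricAtOne g) a a = 1) (hc : tangentMetric (metricAtOne g) c c = 1)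
    (hac : tangentMetric (metricAtOne g) a c = 0) :
    flagCurvature 𝓘(ℝ, E).tangent (completeLiftedFinsler 𝓘(ℝ, E) φ g X) p
        (liftFrame p a) (liftFrame p c)
      = 1 / (φ (metricAtOne g (X : E) a.1) ^ 2 * (1 + metricAtOne g (X : E) c.1 ^ 2
          * curvatureD φ (metricAtOne g (X : E) a.1)))
        * tangentMetric (metricAtOne g) (algebraCurvature (tangentConnection (lieBracketCLM G)
          (invariantAdjoint g) (invariantConnection g)) (tangentBracket (lieBracketCLM G))
            c a a) c := by
  have hf := (isInvariantFrame_chartFrame (E := E) p.1).tangentFrame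
  have ha0 : a ≠ 0 := by rintro rfl; simp at ha
  have hz : ((extChartAt 𝓘(ℝ, E) p.1 p.1, p.2) : E × E)
      ∈ (extChartAt 𝓘(ℝ, E) p.1).target ×ˢ (Set.univ : Set E) :=
    ⟨mem_extChartAt_target p.1, trivial⟩
  have key := hf.localFlagCurvature_finsler (finslerInChart_completeLiftedFinsler hg p)
    h.contDiffAt_sq h.normTensor_pos hm.tangent_torsion
    (h.fderiv_sq_eq_zero hm.tangent_skew (hm.tangent_parallel hX)) hz ha0 c
  have e := hm.tangent_flag_eq h hX ha hc hac
  unfold flagCurvature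
  rw [tangentBundle_extChartAt_self]
  exact key.trans e

section Formulas

variable (hg : IsLeftInvariant 𝓘(ℝ, E) g)
  (h : IsAlphaBetaData φ b₀ (metricAtOne g) (X : E))
  (hX : ∀ c, invariantConnection g c (X : E) = 0) (p : TangentBundle 𝓘(ℝ, E) G) {Y V : E}
  (hY : metricAtOne g Y Y = 1) (hV : metricAtOne g V V = 1) (hYV : metricAtOne g Y V = 0)

theorem IsAlphaBetaData.tangent (h : IsAlphaBetaData φ b₀ (metricAtOne g) (X : E)) :
    IsAlphaBetaData φ b₀ (tangentMetric (metricAtOne g)) ((X : E), (0 : E)) := by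
  have hm := isMetricLieData_group h.symm h.pos
  refine ⟨hm.tangentMetric_symm, hm.tangentMetric_pos, h.smooth, h.phi_pos, h.reg, ?_⟩
  rw [tangentMetric_apply, map_zero, add_zero]
  exact h.norm_lt

include hg h hX hY hV hYV

theorem flagCurvature_complete_complete :
    flagCurvature 𝓘(ℝ, E).tangent (completeLiftedFinsler 𝓘(ℝ, E) φ g X) p
        (liftFrame p (Y, 0)) (liftFrame p (V, 0))
      = 1 / (φ (metricAtOne g (X : E) Y) ^ 2 * (1 + metricAtOne g (X : E) V ^ 2
          * curvatureD φ (metricAtOne g (X : E) Y)))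
        * lieSectionalCurvature 𝓘(ℝ, E) g V Y := by
  have hm := isMetricLieData_group h.symm h.pos
  rw [flagCurvature_completeLiftedFinsler hg h.tangent hm hX p (by simp [tangentMetric_apply, hY])
    (by simp [tangentMetric_apply, hV]) (by simp [tangentMetric_apply, hYV]),
    IsMetricLieData.curvature_complete_complete,
    lieSectionalCurvature_eq hg h.symm h.pos hV hY ((h.symm _ _).trans hYV)]

/-- A vertical second vector is orthogonal to `(X, 0)`, so the factor with `curvatureD` becomes 1.
-/
theorem flagCurvature_complete_vertical :
    flagCurvature 𝓘(ℝ, E).tangent (completeLiftedFinsler 𝓘(ℝ, E) φ g X) p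
        (liftFrame p (Y, 0)) (liftFrame p (0, V))
      = 1 / φ (metricAtOne g (X : E) Y) ^ 2 * (lieSectionalCurvature 𝓘(ℝ, E) g V Y
        + 1 / 2 * metricAtOne g (lieBracketCLM G V (invariantConnection g Y V)) Y
        - 1 / 2 * metricAtOne g (invariantConnection g V (invariantAdjoint g V Y)) Y
        + 1 / 4 * metricAtOne g (lieBracketCLM G V (invariantAdjoint g V Y)) Y
        + 1 / 2 * metricAtOne g (lieBracketCLM G (lieBracketCLM G Y V) V) Y) := by
  have hm := isMetricLieData_group h.symm h.pos
  rw [flagCurvature_completeLiftedFinsler hg h.tangent hm hX p (by simp [tangentMetric_apply, hY])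
    (by simp [tangentMetric_apply, hV]) (by simp [tangentMetric_apply]),
    hm.curvature_vertical_complete,
    lieSectionalCurvature_eq hg h.symm h.pos hV hY ((h.symm _ _).trans hYV), map_zero]
  ring

/-- A vertical flagpole is orthogonal to `(X, 0)`, so φ and `curvatureD φ` are evaluated at 0. -/
theorem flagCurvature_vertical_complete :
    flagCurvature 𝓘(ℝ, E).tangent (completeLiftedFinsler 𝓘(ℝ, E) φ g X) p
        (liftFrame p (0, Y)) (liftFrame p (V, 0))
      = 1 / (φ 0 ^ 2 * (1 + metricAtOne g (X : E) V ^ 2 * curvatureD φ 0))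
        * (lieSectionalCurvature 𝓘(ℝ, E) g V Y
        + 1 / 2 * metricAtOne g (lieBracketCLM G Y (invariantConnection g V Y)) V
        - 1 / 2 * metricAtOne g (invariantConnection g Y (invariantAdjoint g Y V)) V
        + 1 / 4 * metricAtOne g (lieBracketCLM G Y (invariantAdjoint g Y V)) V
        + 1 / 2 * metricAtOne g (lieBracketCLM G (lieBracketCLM G V Y) Y) V) := by
  have hm := isMetricLieData_group h.symm h.pos
  rw [flagCurvature_completeLiftedFinsler hg h.tangent hm hX p (by simp [tangentMetric_apply, hY])
    (by simp [tangentMetric_apply, hV]) (by simp [tangentMetric_apply]),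
    hm.curvature_complete_vertical,
    lieSectionalCurvature_eq hg h.symm h.pos hV hY ((h.symm _ _).trans hYV), map_zero]

theorem flagCurvature_vertical_vertical :
    flagCurvature 𝓘(ℝ, E).tangent (completeLiftedFinsler 𝓘(ℝ, E) φ g X) p
        (liftFrame p (0, Y)) (liftFrame p (0, V))
      = 1 / φ 0 ^ 2 * (lieSectionalCurvature 𝓘(ℝ, E) g V Y
        + metricAtOne g (invariantConnection g (lieBracketCLM G V Y) Y) V
        + 1 / 4 * metricAtOne g (lieBracketCLM G V Y) (lieBracketCLM G V Y)) := by
  have hm := isMetricLieData_group h.symm h.pos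
  rw [flagCurvature_completeLiftedFinsler hg h.tangent hm hX p (by simp [tangentMetric_apply, hY])
    (by simp [tangentMetric_apply, hV]) (by simp [tangentMetric_apply, hYV]),
    hm.curvature_vertical_vertical,
    lieSectionalCurvature_eq hg h.symm h.pos hV hY ((h.symm _ _).trans hYV), map_zero]
  ring

end Formulas

end CompleteLiftedFinsler

end

theorem mainTheorem5 {n : ℕ} {G : Type*} [TopologicalSpace G]
    [ChartedSpace (EuclideanSpace ℝ (Fin n)) G] [Group G] [LieGroup (𝓡 n) ∞ G]
    (g : ContMDiffRiemannianMetric (𝓡 n) ∞ (EuclideanSpace ℝ (Fin n))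
      (fun x : G => TangentSpace (𝓡 n) x))
    (hg : IsLeftInvariant (𝓡 n) g.inner)
    (X : GroupLieAlgebra (𝓡 n) G) (φ : ℝ → ℝ) (b₀ : ℝ)
    (hφ : ContDiffOn ℝ ∞ φ (Set.Ioo (-b₀) b₀))
    (hφ_pos : ∀ s ∈ Set.Ioo (-b₀) b₀, 0 < φ s)
    (hφ_reg : ∀ s b : ℝ, |s| ≤ b → b < b₀ →
      0 < φ s - s * deriv φ s + (b ^ 2 - s ^ 2) * deriv (deriv φ) s)
    (hX : Real.sqrt (g.inner 1 X X) < b₀)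
    (F : ∀ x : G, TangentSpace (𝓡 n) x → ℝ)
    (hF : F = alphaBeta (𝓡 n) φ (fun x u v => g.inner x u v) (mulInvariantVectorField X))
    (hF_berwald : IsBerwald (𝓡 n) F)
    (hF_riemannian : IsRiemannian (𝓡 n) F →
      IsParallel (𝓡 n) g.inner (mulInvariantVectorField X))
    (Y V : GroupLieAlgebra (𝓡 n) G)
    (hY : g.inner 1 Y Y = 1) (hV : g.inner 1 V V = 1) (hYV : g.inner 1 Y V = 0)
    (p : TangentBundle (𝓡 n) G) :
    flagCurvature (𝓡 n).tangent (completeLiftedFinsler (𝓡 n) φ g.inner X) p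
        (lieCompleteLift (𝓡 n) Y p) (lieCompleteLift (𝓡 n) V p) =
      1 / (φ (g.inner 1 X Y) ^ 2 *
          (1 + g.inner 1 X V ^ 2 * curvatureD φ (g.inner 1 X Y))) *
        lieSectionalCurvature (𝓡 n) g.inner V Y ∧
    flagCurvature (𝓡 n).tangent (completeLiftedFinsler (𝓡 n) φ g.inner X) p
        (lieCompleteLift (𝓡 n) Y p) (lieVerticalLift (𝓡 n) V p) =
      1 / φ (g.inner 1 X Y) ^ 2 *
        (lieSectionalCurvature (𝓡 n) g.inner V Y
          + 1 / 2 * g.inner 1 ⁅V, lieConnection (𝓡 n) g.inner Y V⁆ Y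
          - 1 / 2 * g.inner 1 (lieConnection (𝓡 n) g.inner V (adStar (𝓡 n) g.inner V Y)) Y
          + 1 / 4 * g.inner 1 ⁅V, adStar (𝓡 n) g.inner V Y⁆ Y
          + 1 / 2 * g.inner 1 ⁅⁅Y, V⁆, V⁆ Y) ∧
    flagCurvature (𝓡 n).tangent (completeLiftedFinsler (𝓡 n) φ g.inner X) p
        (lieVerticalLift (𝓡 n) Y p) (lieCompleteLift (𝓡 n) V p) =
      1 / (φ 0 ^ 2 * (1 + g.inner 1 X V ^ 2 * curvatureD φ 0)) *
        (lieSectionalCurvature (𝓡 n) g.inner V Y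
          + 1 / 2 * g.inner 1 ⁅Y, lieConnection (𝓡 n) g.inner V Y⁆ V
          - 1 / 2 * g.inner 1 (lieConnection (𝓡 n) g.inner Y (adStar (𝓡 n) g.inner Y V)) V
          + 1 / 4 * g.inner 1 ⁅Y, adStar (𝓡 n) g.inner Y V⁆ V
          + 1 / 2 * g.inner 1 ⁅⁅V, Y⁆, Y⁆ V) ∧
    flagCurvature (𝓡 n).tangent (completeLiftedFinsler (𝓡 n) φ g.inner X) p
        (lieVerticalLift (𝓡 n) Y p) (lieVerticalLift (𝓡 n) V p) =
      1 / φ 0 ^ 2 *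
        (lieSectionalCurvature (𝓡 n) g.inner V Y
          + g.inner 1 (lieConnection (𝓡 n) g.inner ⁅V, Y⁆ Y) V
          + 1 / 4 * g.inner 1 ⁅V, Y⁆ ⁅V, Y⁆) := by
  have symm : ∀ a b, metricAtOne g.inner a b = metricAtOne g.inner b a := fun a b => g.symm 1 a b
  have pos : ∀ a ≠ 0, 0 < metricAtOne g.inner a a := fun a ha => g.pos 1 a ha
  have hd : IsAlphaBetaData φ b₀ (metricAtOne g.inner) X :=
    ⟨symm, pos, hφ, hφ_pos, hφ_reg, hX⟩
  subst hF
  -- The Berwald condition on `F` enters only here, through the parallelism of `X`; the rest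
  -- concerns the lifted metric.
  have hp := invariantConnection_eq_zero_of_isBerwald hg hd hF_berwald hF_riemannian hY hV hYV
  have hc := lieConnection_eq hg symm pos
  rw [lieCompleteLift_eq, lieCompleteLift_eq, lieVerticalLift_eq, lieVerticalLift_eq]
  simp only [hc]
  exact ⟨flagCurvature_complete_complete hg hd hp p hY hV hYV,
    flagCurvature_complete_vertical hg hd hp p hY hV hYV,
    flagCurvature_vertical_complete hg hd hp p hY hV hYV,
    flagCurvature_vertical_vertical hg hd hp p hY hV hYV⟩
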